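/- **Definitions.** Let $k\in\mathbb N$, $\boldsymbol T:\mathbb Z\to\mathbb R^k$, $\mathcal A\subseteq\mathbb R^k$, and let $\|\cdot\|$ be the Euclidean norm. For $\boldsymbol a\in\mathbb R^k$ with $\sum_{x\in\mathbb Z}e^{-\boldsymbol a\cdot \boldsymbol T(x)}<\infty$, $\mathcal E_{\boldsymbol T}(\boldsymbol a)$ is the distribution on $\mathbb Z$ with $\Pr_{\boldsymbol a}[W=x]\propto e^{-\boldsymbol a\cdot\boldsymbol T(x)}$; the family $\mathcal E_{\boldsymbol T}(\mathcal S)$, $\mathcal S\subseteq\mathbb R^k$, is well-defined if these sums converge for all $\boldsymbol a\in \mathcal S$. An $\mathcal E_{\boldsymbol T}(\mathcal S)$-SIIRV of order $n$ is a sum $\sum_{i=1}^{n'}X_i$ with $1\le n'\le n$ of independent $X_i\sim\mathcal E_{\boldsymbol T}(\boldsymbol a_i)$, $\boldsymbol a_i\in \mathcal S$. $\mathrm{Cone}\,\mathcal A$ is the set of finite nonnegative combinations of elements of $\mathcal A$, and for $\varrho>0$, $\mathcal A_\varrho=\mathcal A\cup\{\boldsymbol u\in\mathrm{Cone}\,\mathcal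 A:\|\boldsymbol u\|\ge\varrho\}$. A distribution $D$ on $\mathbb Z$ is unimodal if for some $M\in\mathbb Z$, $D(x)\ge D(x+1)$ for $x\ge M$ and $D(x)\le D(x+1)$ for $x<M$; its modes are the global maximizers of $D(x)$. $d_{TV}(P,Q)=\frac12\sum_{x\in\mathbb Z}|P(x)-Q(x)|$. **Assumption** (for $\boldsymbol T,\mathcal A$, with constants $\varrho,L,B,\Lambda,\gamma>0$). $\mathcal E_{\boldsymbol T}(\mathcal A_\varrho)$ is well-defined, and: 1. $\mathcal A$ is closed and $\mathrm{Cone}\,\mathcal A$ is a polyhedral cone; 2. every distribution in $\mathcal E_{\boldsymbol T}(\mathcal A_\varrho)$ is unimodal; 3. every mode of every distribution in $\mathcal E_{\boldsymbol T}(\mathcal A_\varrho)$ lies in $[-L,L]$; 4. for every $\boldsymbol a\in\mathcal A_\varrho$ the fourth moment is finite and $\mathbf E_{\boldsymbol a}\big[|W-\mathbf E_{\boldsymbol a}[W]|^4\big]\le B$; 5. for every $\boldsymbol a$ in the convex hull of $\mathcal A_\varrho$ the covariance of $\boldsymbol T(W)$ exists and $\mathbf{Cov}_{\boldsymbol a}(\boldsymbol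 T(W))\preceq\Lambda\cdot I_k$; 6. $\mathcal A$ is (nonempty and) path-connected; 7. $\mathbf{Var}_{\boldsymbol a}(W)\ge\gamma$ for every $\boldsymbol a\in\mathcal A$. **Theorem 3.1 (Structure of SIIERVs).** There are absolute constants $C,C'\in\mathbb R$, $c\in\mathbb N_0$ and absolute real polynomials $P$ (in three variables) and $Q$ (in two variables) such that the following holds. For every $k$, $\boldsymbol T:\mathbb Z\to\mathbb R^k$ and $\mathcal A\subseteq\mathbb R^k$ there is $\theta=\theta(\mathcal A,\boldsymbol T)>0$ such that, whenever the Assumption holds with constants $\varrho,L,B,\Lambda,\gamma$, for every $n\in\mathbb N$ and $\epsilon\in(0,1)$, writing $R=\max\{2,\ \varrho\sqrt\Lambda/\theta\}$, there are finite sets $\mathcal S$ and $\mathcal D$ of distributions on $\mathbb Z$ with: * (sparse candidates) every element of $\mathcal S$ is the distribution of an $\mathcal E_{\boldsymbol T}(\mathcal A_\varrho)$-SIIRV of order $n$, and $$|\mathcal S|\le R^{\,k\cdot\left(C\,\frac1{\epsilon^2}\left(1+\ln\frac1\epsilon\right)^c\right)\cdot P(B,L,1/\gamma)};$$ * (dense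 candidates) every element of $\mathcal D$ is the distribution of a sum of $m\ge 1$ i.i.d. $\mathcal E_{\boldsymbol T}(\boldsymbol b)$ random variables, for some $m$ and some $\boldsymbol b\in\mathcal A_\varrho$, and $$|\mathcal D|\le\Big(n^2\cdot Q(B,1/\gamma)\cdot C'\,\frac{R}{\epsilon}\Big)^k;$$ * every $\mathcal E_{\boldsymbol T}(\mathcal A)$-SIIRV $X$ of order $n$ satisfies $d_{TV}(X,Y)\le\epsilon$ for some $Y$ whose distribution lies in $\mathcal S$ or in $\mathcal D$. -/

import Mathlib

open MeasureTheory ProbabilityTheory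
open scoped NNReal ENNReal

noncomputable section

namespace SIIERV

/-- The parameter space `ℝ^k` with its Euclidean norm and inner product. -/
abbrev Param (k : ℕ) : Type := EuclideanSpace ℝ (Fin k)

/-- The exponential-family distribution with sufficient statistics `T` and parameter `a`: the
measure on `ℤ` with mass at `x` proportional to `exp (-(a · T x))`. It is a probability measure as
soon as these weights are summable (see `WellDefined`), and it is the zero measure otherwise. -/
def expFam {k : ℕ} (T : ℤ → Param k) (a : Param k) : Measure ℤ :=
  (Measure.count : Measure ℤ).tilted (fun x => -inner ℝ a (T x))

/-- The exponential family with parameter space `S` is well-defined: every partition function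
`∑ x, exp (-(a · T x))` converges. -/
def WellDefined {k : ℕ} (T : ℤ → Param k) (S : Set (Param k)) : Prop :=
  ∀ a ∈ S, Summable (fun x : ℤ => Real.exp (-inner ℝ a (T x)))

/-- The total variation distance between two distributions on `ℤ`. -/
def tvDist (μ ν : Measure ℤ) : ℝ :=
  (1 / 2) * ∑' x : ℤ, |μ.real {x} - ν.real {x}|

/-- `M` is a mode of `μ`, i.e. a global maximizer of the probability mass function. -/
def IsMode (μ : Measure ℤ) (M : ℤ) : Prop :=
  ∀ x : ℤ, μ.real {x} ≤ μ.real {M}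

/-- The probability mass function of `μ` is nondecreasing up to some integer `M` and nonincreasing
from `M` on. -/
def Unimodal (μ : Measure ℤ) : Prop :=
  ∃ M : ℤ, (∀ x : ℤ, M ≤ x → μ.real {x + 1} ≤ μ.real {x}) ∧
    ∀ x : ℤ, x < M → μ.real {x} ≤ μ.real {x + 1}

/-- The conical hull: all finite combinations of elements of `A` with nonnegative coefficients. -/
def coneHull {k : ℕ} (A : Set (Param k)) : Set (Param k) :=
  (PointedCone.hull ℝ A : Set (Param k))

/-- The `ρ`-conical hull: `A` together with all points of its conical hull outside the open ball of
radius `ρ` around the origin. -/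
def rhoCone {k : ℕ} (ρ : ℝ) (A : Set (Param k)) : Set (Param k) :=
  A ∪ (coneHull A \ Metric.ball 0 ρ)

/-- A polyhedron: an intersection of finitely many affine halfspaces. (A polyhedral cone is a
polyhedron that is a cone; a conical hull is always a cone.) -/
def IsPolyhedron {k : ℕ} (s : Set (Param k)) : Prop :=
  ∃ (t : ℕ) (h : Fin t → Param k) (c : Fin t → ℝ), s = {u | ∀ i, c i ≤ inner ℝ (h i) u}

/-- The standing assumptions on the exponential family with sufficient statistics `T` and parameter
space `A`, with constants `ρ, L, B, Λ, γ`. -/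
structure Assumptions {k : ℕ} (T : ℤ → Param k) (A : Set (Param k)) (ρ L B Λ γ : ℝ) : Prop where
  rho_pos : 0 < ρ
  L_pos : 0 < L
  B_pos : 0 < B
  Lam_pos : 0 < Λ
  gamma_pos : 0 < γ
  wellDefined : WellDefined T (rhoCone ρ A)
  isClosed : IsClosed A
  polyhedral : IsPolyhedron (coneHull A)
  unimodal : ∀ a ∈ rhoCone ρ A, Unimodal (expFam T a)
  bounded_modes : ∀ a ∈ rhoCone ρ A, ∀ M : ℤ, IsMode (expFam T a) M → |(M : ℝ)| ≤ L
  /-- The fourth moment is finite and the fourth central moment is at most `B`. -/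
  fourth_moment : ∀ a ∈ rhoCone ρ A,
    MemLp (fun x : ℤ => (x : ℝ)) 4 (expFam T a) ∧
      centralMoment (fun x : ℤ => (x : ℝ)) 4 (expFam T a) ≤ B
  /-- The covariance matrix `C` of `T W` exists and `C ⪯ Λ • I`, that is
  `v ⬝ C v = Var (v · T W) ≤ Λ * ‖v‖ ^ 2` for every vector `v`. -/
  covariance : ∀ a ∈ convexHull ℝ (rhoCone ρ A),
    MemLp T 2 (expFam T a) ∧
      ∀ v : Param k, variance (fun x : ℤ => inner ℝ v (T x)) (expFam T a) ≤ Λ * ‖v‖ ^ 2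
  pathConnected : IsPathConnected A
  variance_ge : ∀ a ∈ A, γ ≤ variance (fun x : ℤ => (x : ℝ)) (expFam T a)

/-- The law of `X₁ + ⋯ + X_m` for independent `X_i` distributed as the member of the family with
parameter `a i`. -/
def sumLaw {k : ℕ} (T : ℤ → Param k) {m : ℕ} (a : Fin m → Param k) : Measure ℤ :=
  (Measure.pi fun i => expFam T (a i)).map (fun x => ∑ i, x i)

/-- `μ` is the law of a sum of at most `n` (and at least one) independent random variables, each
distributed as some member of the exponential family with parameter space `S`. -/
def IsSIIRV {k : ℕ} (T : ℤ → Param k) (S : Set (Param k)) (n : ℕ) (μ : Measure ℤ) : Prop :=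
  ∃ m : ℕ, 1 ≤ m ∧ m ≤ n ∧ ∃ a : Fin m → Param k, (∀ i, a i ∈ S) ∧ μ = sumLaw T a

/-- `μ` is the law of a nonempty sum of i.i.d. random variables, whose common distribution is a
member of the exponential family with parameter space `S`. -/
def IsIIDSum {k : ℕ} (T : ℤ → Param k) (S : Set (Param k)) (μ : Measure ℤ) : Prop :=
  ∃ m : ℕ, 1 ≤ m ∧ ∃ b ∈ S, μ = sumLaw T (fun _ : Fin m => b)

end SIIERV

end

/-!
A sum of few variables of the family is approximated summand by summand, a sum of many variables by
an i.i.d. sum; in both cases the parameters are moved to a finite net.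

*Long sums.* A unimodal law on `ℤ` with bounded fourth moment and variance at least `γ` has two
neighbouring atoms that are not small (`exists_adjacent_atoms`), so its characteristic function
decays on the whole period. Hence the characteristic function of a sum of `m` such variables is close
to a Gaussian one, and Fourier inversion together with Hoeffding's inequality shows that the sum is
`ε`-close to a shifted binomial law with roughly the same mean and variance once `m` is of order
`(1 + log (1 / ε)) / ε ^ 2` (`tvDist_indepSum_binomial_le`). As `A` is connected and the mean and the
variance depend continuously on the parameter, the intermediate value theorem gives a single parameter
whose ratio of mean and variance is that of the sum (`Assumptions.exists_matching_parameter`). An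
i.i.d. sum with this parameter and a suitable number of summands is close to the same binomial law
(`Assumptions.exists_iid_tvDist_le`).

*Moving parameters.* Distances between members of the family are measured by the Hellinger affinity,
whose deficit is subadditive under independent sums (`one_sub_affinity_indepSum_le`). The bound on the
covariance bounds the second derivative of the logarithm of the partition function, so nearby
parameters have affinity close to one (`one_sub_affinity_expFam_le`).

*Bounding parameters.* A parameter of large norm is replaced by one of norm `O(τ)`. Since the cone is
polyhedral and the modes lie in a fixed window, whether a vector of the cone has a given mode is
decided by finitely many linear functionals. By compactness, a long vector can be
shortened, with all functional values below `τ` kept and the other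
values lowered but not below `τ` (`exists_truncation`, `exists_small_parameter`); this changes the
distribution by a term of order `exp (-τ / 2)` (`one_sub_affinity_le_of_truncation`). The remaining
bounded set of parameters is covered by a grid (`Assumptions.exists_net`).

*The constant `θ`.* The truncation constants and the dimension depend only on `T` and `A`, and are
absorbed into `θ` (`Assumptions.exists_theta`): `Λ` is bounded below in terms of the family, and `ρ`
can be small only if `B` is large, because parameters close to `0` give flat distributions.
-/

noncomputable section

namespace SIIERV

/-! ### Measures on the integers and total variation -/

theorem hasSum_integral_int (μ : Measure ℤ) [IsFiniteMeasure μ] {f : ℤ → ℝ} (hf : Integrable f μ) :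
    HasSum (fun x : ℤ => f x * μ.real {x}) (∫ x, f x ∂μ) := by
  have h := hasSum_integral_measure (μ := fun x : ℤ => μ {x} • Measure.dirac x)
    (f := f) (by rwa [Measure.sum_smul_dirac])
  rw [Measure.sum_smul_dirac] at h
  refine h.congr_fun ?_
  intro x
  rw [integral_smul_measure, integral_dirac, smul_eq_mul, mul_comm]
  rfl

theorem hasSum_real_singleton (μ : Measure ℤ) [IsProbabilityMeasure μ] :
    HasSum (fun x : ℤ => μ.real {x}) 1 := by
  simpa using hasSum_integral_int μ (integrable_const (1 : ℝ))

theorem summable_real_singleton (μ : Measure ℤ) [IsProbabilityMeasure μ] :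
    Summable (fun x : ℤ => μ.real {x}) := (hasSum_real_singleton μ).summable

theorem real_singleton_nonneg (μ : Measure ℤ) (x : ℤ) : 0 ≤ μ.real {x} := measureReal_nonneg

theorem summable_abs_sub (μ ν : Measure ℤ) [IsProbabilityMeasure μ] [IsProbabilityMeasure ν] :
    Summable (fun x : ℤ => |μ.real {x} - ν.real {x}|) :=
  ((summable_real_singleton μ).sub (summable_real_singleton ν)).abs

theorem tvDist_comm (μ ν : Measure ℤ) : tvDist μ ν = tvDist ν μ := by
  simp only [tvDist, abs_sub_comm]

theorem tvDist_triangle (μ ν ρ : Measure ℤ) [IsProbabilityMeasure μ] [IsProbabilityMeasure ν]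
    [IsProbabilityMeasure ρ] : tvDist μ ρ ≤ tvDist μ ν + tvDist ν ρ := by
  unfold tvDist
  rw [← mul_add, ← (summable_abs_sub μ ν).tsum_add (summable_abs_sub ν ρ)]
  refine mul_le_mul_of_nonneg_left ?_ (by norm_num)
  exact (summable_abs_sub μ ρ).tsum_le_tsum (fun x => abs_sub_le _ _ _)
    ((summable_abs_sub μ ν).add (summable_abs_sub ν ρ))

/-- Only the positive part of `ν - μ` enters the total variation distance, so outside a window the
mass of `ν` alone has to be small. -/
theorem tvDist_le_window (μ ν : Measure ℤ) [IsProbabilityMeasure μ] [IsProbabilityMeasure ν]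
    (W : Finset ℤ) :
    tvDist μ ν ≤ ∑ x ∈ W, |μ.real {x} - ν.real {x}| + ν.real (W : Set ℤ)ᶜ := by
  have hμ := hasSum_real_singleton μ
  have hν := hasSum_real_singleton ν
  have habs := (summable_abs_sub μ ν).hasSum
  have hpos : HasSum (fun x : ℤ => max (ν.real {x} - μ.real {x}) 0) (tvDist μ ν) := by
    have h := (habs.add (hν.sub hμ)).mul_left (1 / 2 : ℝ)
    have e1 : (1 / 2 : ℝ) * ((∑' x : ℤ, |μ.real {x} - ν.real {x}|) + (1 - 1)) = tvDist μ ν := by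
      simp [tvDist]
    rw [e1] at h
    have hf : (fun x : ℤ => max (ν.real {x} - μ.real {x}) 0)
        = fun x => 1 / 2 * (|μ.real {x} - ν.real {x}| + (ν.real {x} - μ.real {x})) := by
      funext x
      rcases le_total (ν.real {x}) (μ.real {x}) with hx | hx
      · rw [max_eq_right (by linarith), abs_of_nonneg (by linarith)]; ring
      · rw [max_eq_left (by linarith), abs_of_nonpos (by linarith)]; ring
    rw [hf]; exact h
  have hbound : HasSum (fun x : ℤ => (if x ∈ W then |μ.real {x} - ν.real {x}| else 0) +
      (ν.real {x} - if x ∈ W then ν.real {x} else 0))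
      (∑ x ∈ W, |μ.real {x} - ν.real {x}| + (1 - ∑ x ∈ W, ν.real {x})) := by
    refine HasSum.add ?_ (hν.sub ?_)
    · have := hasSum_sum_of_ne_finset_zero (L := .unconditional ℤ) (s := W)
        (f := fun x : ℤ => if x ∈ W then |μ.real {x} - ν.real {x}| else 0)
        (fun x hx => by simp [hx])
      rwa [Finset.sum_congr rfl (g := fun x => |μ.real {x} - ν.real {x}|)
        (fun x hx => by simp [hx])] at this
    · have := hasSum_sum_of_ne_finset_zero (L := .unconditional ℤ) (s := W)
        (f := fun x : ℤ => if x ∈ W then ν.real {x} else 0) (fun x hx => by simp [hx])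
      rwa [Finset.sum_congr rfl (g := fun x => ν.real {x}) (fun x hx => by simp [hx])] at this
  have hle := hasSum_le (fun x => ?_) hpos hbound
  · rwa [measureReal_compl W.measurableSet, probReal_univ, ← sum_measureReal_singleton]
  · have h1 := real_singleton_nonneg μ x
    have h2 := real_singleton_nonneg ν x
    split_ifs with hx
    · have h3 := abs_nonneg (μ.real {x} - ν.real {x})
      have h4 := neg_le_abs (μ.real {x} - ν.real {x})
      refine max_le ?_ ?_ <;> linarith
    · refine max_le ?_ ?_ <;> linarith

/-! ### Characteristic functions on the integers -/

/-- The characteristic function `t ↦ E exp (i t X)` of a distribution on `ℤ`. -/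
def charZ (μ : Measure ℤ) (t : ℝ) : ℂ := ∫ x : ℤ, Complex.exp ((t * (x : ℝ) : ℝ) * Complex.I) ∂μ

theorem integrable_exp_mul_I (μ : Measure ℤ) [IsFiniteMeasure μ] (f : ℤ → ℝ) :
    Integrable (fun x : ℤ => Complex.exp ((f x : ℝ) * Complex.I)) μ := by
  refine Integrable.of_bound (C := 1) (measurable_of_countable _).aestronglyMeasurable ?_
  exact Filter.Eventually.of_forall fun x => by rw [Complex.norm_exp_ofReal_mul_I]

theorem continuous_charZ (μ : Measure ℤ) [IsProbabilityMeasure μ] : Continuous (charZ μ) := by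
  refine continuous_of_dominated (bound := fun _ => 1) (fun t => ?_) (fun t => ?_)
    (integrable_const _) ?_
  · exact (measurable_of_countable _).aestronglyMeasurable
  · exact Filter.Eventually.of_forall fun x => by rw [Complex.norm_exp_ofReal_mul_I]
  · exact Filter.Eventually.of_forall fun x => by fun_prop

theorem intervalIntegral_exp_int (n : ℤ) :
    ∫ t in (-Real.pi)..Real.pi, Complex.exp ((t * (n : ℝ) : ℝ) * Complex.I)
      = if n = 0 then ((2 * Real.pi : ℝ) : ℂ) else 0 := by
  split_ifs with h
  · subst h
    simp only [Int.cast_zero, mul_zero, Complex.ofReal_zero, zero_mul, Complex.exp_zero,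
      intervalIntegral.integral_const, sub_neg_eq_add]
    rw [Complex.real_smul, mul_one, two_mul]
  · have hc : (n : ℂ) * Complex.I ≠ 0 := by simp [h]
    have e := integral_exp_mul_complex (a := -Real.pi) (b := Real.pi) hc
    have e2 : ∀ t : ℝ, Complex.exp ((t * (n : ℝ) : ℝ) * Complex.I)
        = Complex.exp ((n : ℂ) * Complex.I * t) := fun t => by push_cast; ring_nf
    simp_rw [e2]
    rw [e, div_eq_zero_iff]; left
    rw [sub_eq_zero]
    have : (n : ℂ) * Complex.I * (Real.pi : ℝ)
        = (n : ℂ) * Complex.I * ((-Real.pi : ℝ) : ℂ) + n * (2 * Real.pi * Complex.I) := by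
      push_cast; ring
    rw [this]
    exact Complex.exp_periodic.int_mul n _

/-- Fourier inversion on `ℤ`. -/
theorem real_singleton_eq_integral_charZ (μ : Measure ℤ) [IsProbabilityMeasure μ] (y : ℤ) :
    ((2 * Real.pi : ℝ) : ℂ) * (μ.real {y} : ℂ) = ∫ t in (-Real.pi)..Real.pi,
      Complex.exp ((t * (-y : ℝ) : ℝ) * Complex.I) * charZ μ t := by
  have h1 : ∀ t : ℝ, Complex.exp ((t * (-y : ℝ) : ℝ) * Complex.I) * charZ μ t
      = ∫ x : ℤ, Complex.exp ((t * ((x - y : ℤ) : ℝ) : ℝ) * Complex.I) ∂μ := by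
    intro t
    rw [charZ, ← integral_const_mul]
    refine integral_congr_ae (Filter.Eventually.of_forall fun x => ?_)
    simp only
    rw [← Complex.exp_add]
    push_cast; ring_nf
  simp_rw [h1]
  rw [intervalIntegral.integral_of_le (by linarith [Real.pi_pos]), integral_integral_swap]
  · simp_rw [← intervalIntegral.integral_of_le (show -Real.pi ≤ Real.pi by linarith [Real.pi_pos]),
      intervalIntegral_exp_int]
    have : ∀ x : ℤ, (if x - y = 0 then ((2 * Real.pi : ℝ) : ℂ) else 0)
        = Set.indicator {y} (fun _ => ((2 * Real.pi : ℝ) : ℂ)) x := by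
      intro x; simp [Set.indicator, sub_eq_zero]
    simp_rw [this]
    rw [integral_indicator_const _ (measurableSet_singleton y), Complex.real_smul, mul_comm]
  · refine Integrable.of_bound (C := 1) ?_ ?_
    · refine Measurable.aestronglyMeasurable ?_
      have : Measurable fun p : ℝ × ℤ => (p.1 * ((p.2 - y : ℤ) : ℝ)) :=
        measurable_fst.mul ((measurable_of_countable fun x : ℤ => ((x - y : ℤ) : ℝ)).comp
          measurable_snd)
      exact Complex.measurable_exp.comp ((Complex.measurable_ofReal.comp this).mul_const _)
    · exact Filter.Eventually.of_forall fun x => by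
        rw [Function.uncurry, Complex.norm_exp_ofReal_mul_I]

/-- Point masses are close if the characteristic functions are close in `L¹` of a period. -/
theorem abs_sub_le_integral_charZ (μ ν : Measure ℤ) [IsProbabilityMeasure μ]
    [IsProbabilityMeasure ν] (y : ℤ) (F : ℝ → ℝ) (hF : IntervalIntegrable F volume (-Real.pi) Real.pi)
    (h : ∀ t, |t| ≤ Real.pi → ‖charZ μ t - charZ ν t‖ ≤ F t) :
    2 * Real.pi * |μ.real {y} - ν.real {y}| ≤ ∫ t in (-Real.pi)..Real.pi, F t := by
  have hpi := Real.pi_pos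
  have e : ((2 * Real.pi : ℝ) : ℂ) * ((μ.real {y} - ν.real {y} : ℝ) : ℂ)
      = ∫ t in (-Real.pi)..Real.pi,
        Complex.exp ((t * (-y : ℝ) : ℝ) * Complex.I) * (charZ μ t - charZ ν t) := by
    push_cast
    rw [mul_sub]
    have := real_singleton_eq_integral_charZ μ y
    have h2 := real_singleton_eq_integral_charZ ν y
    push_cast at this h2
    rw [this, h2, ← intervalIntegral.integral_sub]
    · simp_rw [mul_sub]
    · exact Continuous.intervalIntegrable (by have := continuous_charZ μ; fun_prop) _ _
    · exact Continuous.intervalIntegrable (by have := continuous_charZ ν; fun_prop) _ _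
  have e2 : 2 * Real.pi * |μ.real {y} - ν.real {y}|
      = ‖((2 * Real.pi : ℝ) : ℂ) * ((μ.real {y} - ν.real {y} : ℝ) : ℂ)‖ := by
    rw [norm_mul, Complex.norm_real, Complex.norm_real, Real.norm_eq_abs, Real.norm_eq_abs,
      abs_of_pos (by positivity : (0 : ℝ) < 2 * Real.pi)]
  rw [e2, e]
  refine intervalIntegral.norm_integral_le_of_norm_le (by linarith) ?_ hF
  refine Filter.Eventually.of_forall fun t ht => ?_
  rw [norm_mul, Complex.norm_exp_ofReal_mul_I, one_mul]
  exact h t (abs_le.2 ⟨ht.1.le, ht.2⟩)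

theorem integral_abs_mul_exp_neg_sq_le {a : ℝ} (ha : 0 < a) (b : ℝ) (hb : 0 ≤ b) :
    ∫ t in (-b)..b, |t| * Real.exp (-a * t ^ 2) ≤ 1 / a := by
  have hc : Continuous fun t : ℝ => |t| * Real.exp (-a * t ^ 2) := by fun_prop
  have h0 : ∫ t in (0 : ℝ)..b, |t| * Real.exp (-a * t ^ 2)
      = (1 - Real.exp (-a * b ^ 2)) / (2 * a) := by
    have hd : ∀ t ∈ Set.uIcc 0 b, HasDerivAt (fun t : ℝ => -Real.exp (-a * t ^ 2) / (2 * a))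
        (t * Real.exp (-a * t ^ 2)) t := by
      intro t _
      have := (((hasDerivAt_pow 2 t).const_mul (-a)).exp.neg).div_const (2 * a)
      refine this.congr_deriv ?_
      push_cast
      field_simp
    rw [intervalIntegral.integral_congr (g := fun t => t * Real.exp (-a * t ^ 2)),
      intervalIntegral.integral_eq_sub_of_hasDerivAt hd
        (Continuous.intervalIntegrable (by fun_prop) _ _)]
    · simp; ring
    · intro t ht
      rw [Set.uIcc_of_le hb] at ht
      simp [abs_of_nonneg ht.1]
  have h1 : ∫ t in (-b)..0, |t| * Real.exp (-a * t ^ 2)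
      = ∫ t in (0 : ℝ)..b, |t| * Real.exp (-a * t ^ 2) := by
    have := intervalIntegral.integral_comp_neg (a := 0) (b := b)
      (fun t : ℝ => |t| * Real.exp (-a * t ^ 2))
    simp only [abs_neg, neg_sq, neg_zero] at this
    exact this.symm
  rw [← intervalIntegral.integral_add_adjacent_intervals (b := 0) (hc.intervalIntegrable _ _)
    (hc.intervalIntegrable _ _), h1, h0, ← add_div, div_le_div_iff₀ (by positivity) ha]
  have := Real.exp_pos (-a * b ^ 2)
  nlinarith

/-! ### Sums of independent integer random variables -/

/-- The law of the sum of independent integer random variables with laws `ν i`. -/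
def indepSum {m : ℕ} (ν : Fin m → Measure ℤ) : Measure ℤ :=
  (Measure.pi ν).map (fun x => ∑ i, x i)

theorem sumLaw_eq_indepSum {k m : ℕ} (T : ℤ → Param k) (a : Fin m → Param k) :
    sumLaw T a = indepSum fun i => expFam T (a i) := rfl

instance isProbabilityMeasure_indepSum {m : ℕ} (ν : Fin m → Measure ℤ)
    [∀ i, IsProbabilityMeasure (ν i)] : IsProbabilityMeasure (indepSum ν) :=
  Measure.isProbabilityMeasure_map (measurable_of_countable _).aemeasurable

theorem charZ_indepSum {m : ℕ} (ν : Fin m → Measure ℤ) [∀ i, IsProbabilityMeasure (ν i)] (t : ℝ) :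
    charZ (indepSum ν) t = ∏ i, charZ (ν i) t := by
  unfold charZ indepSum
  rw [integral_map (measurable_of_countable _).aemeasurable
    (measurable_of_countable _).aestronglyMeasurable,
    ← integral_fintype_prod_eq_prod (fun i (x : ℤ) => Complex.exp ((t * (x : ℝ) : ℝ) * Complex.I))]
  refine integral_congr_ae (Filter.Eventually.of_forall fun x => ?_)
  simp only
  rw [← Complex.exp_sum]
  push_cast
  rw [Finset.mul_sum, Finset.sum_mul]

theorem charZ_map_add (μ : Measure ℤ) (c : ℤ) (t : ℝ) :
    charZ (μ.map (· + c)) t = Complex.exp ((t * (c : ℝ) : ℝ) * Complex.I) * charZ μ t := by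
  unfold charZ
  rw [integral_map (measurable_of_countable _).aemeasurable
    (measurable_of_countable _).aestronglyMeasurable, ← integral_const_mul]
  refine integral_congr_ae (Filter.Eventually.of_forall fun x => ?_)
  simp only
  rw [← Complex.exp_add]
  push_cast; ring_nf

/-! ### Unimodal laws with bounded fourth moment -/

/-- The mean of a distribution on `ℤ`. -/
def mean (ν : Measure ℤ) : ℝ := ∫ x : ℤ, (x : ℝ) ∂ν

/-- The variance of a distribution on `ℤ`. -/
def var (ν : Measure ℤ) : ℝ := variance (fun x : ℤ => (x : ℝ)) ν

/-- Probability distributions on `ℤ` whose fourth central moment is finite and at most `B`. -/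
structure FourthMomentLE (ν : Measure ℤ) (B : ℝ) : Prop where
  prob : IsProbabilityMeasure ν
  memLp : MemLp (fun x : ℤ => (x : ℝ)) 4 ν
  moment_le : ∫ x : ℤ, ((x : ℝ) - mean ν) ^ 4 ∂ν ≤ B

theorem integrable_of_le_fourth {ν : Measure ℤ} {B : ℝ} (h : FourthMomentLE ν B) {f : ℤ → ℝ}
    (C c : ℝ) (hf : ∀ x : ℤ, |f x| ≤ C * (1 + ((x : ℝ) - c) ^ 4)) : Integrable f ν := by
  have := h.prob
  have h1 : MemLp (fun x : ℤ => (x : ℝ) - c) 4 ν := h.memLp.sub (memLp_const c)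
  have h2 : Integrable (fun x : ℤ => ‖(x : ℝ) - c‖ ^ 4) ν := by
    simpa using h1.integrable_norm_pow (by norm_num)
  refine (((integrable_const 1).add h2).const_mul C).mono'
    (measurable_of_countable _).aestronglyMeasurable (Filter.Eventually.of_forall fun x => ?_)
  have e : ‖(x : ℝ) - c‖ ^ 4 = ((x : ℝ) - c) ^ 4 := by
    rw [Real.norm_eq_abs]; exact (even_two_mul 2).pow_abs _
  rw [Real.norm_eq_abs]
  simpa only [Pi.add_apply, e] using hf x

theorem abs_pow_le_one_add_pow_four (y : ℝ) :
    |y| ≤ 1 + y ^ 4 ∧ y ^ 2 ≤ 1 + y ^ 4 ∧ |y| ^ 3 ≤ 1 + y ^ 4 := by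
  have e4 : y ^ 4 = |y| ^ 4 := ((even_two_mul 2).pow_abs _).symm
  have e2 : y ^ 2 = |y| ^ 2 := (sq_abs y).symm
  rw [e4, e2]
  have := abs_nonneg y
  set a := |y|
  refine ⟨?_, ?_, ?_⟩
  · nlinarith [sq_nonneg (a ^ 2 - 1), sq_nonneg (a - 1), sq_nonneg (a ^ 2)]
  · nlinarith [sq_nonneg (a ^ 2 - 1)]
  · nlinarith [sq_nonneg (a ^ 2 - a), sq_nonneg (a ^ 2 - 1), sq_nonneg (a - 1), sq_nonneg a]

namespace FourthMomentLE

variable {ν : Measure ℤ} {B : ℝ}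

theorem integrable_cast (h : FourthMomentLE ν B) : Integrable (fun x : ℤ => (x : ℝ)) ν :=
  integrable_of_le_fourth h 1 0 fun x => by
    simpa using (abs_pow_le_one_add_pow_four (x : ℝ)).1

theorem integrable_pow_four (h : FourthMomentLE ν B) (c : ℝ) :
    Integrable (fun x : ℤ => ((x : ℝ) - c) ^ 4) ν :=
  integrable_of_le_fourth h 1 c fun x => by
    rw [abs_of_nonneg (by positivity)]; linarith

theorem integrable_sq (h : FourthMomentLE ν B) (c : ℝ) :
    Integrable (fun x : ℤ => ((x : ℝ) - c) ^ 2) ν :=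
  integrable_of_le_fourth h 1 c fun x => by
    rw [abs_of_nonneg (by positivity), one_mul]
    exact (abs_pow_le_one_add_pow_four ((x : ℝ) - c)).2.1

theorem B_nonneg (h : FourthMomentLE ν B) : 0 ≤ B :=
  (integral_nonneg fun x => by positivity).trans h.moment_le

theorem _root_.SIIERV.var_eq (ν : Measure ℤ) : var ν = ∫ x : ℤ, ((x : ℝ) - mean ν) ^ 2 ∂ν :=
  variance_eq_integral (measurable_of_countable _).aemeasurable

theorem integral_sub_mean (h : FourthMomentLE ν B) : ∫ x : ℤ, ((x : ℝ) - mean ν) ∂ν = 0 := by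
  have := h.prob
  rw [integral_sub h.integrable_cast (integrable_const _)]
  simp [mean]

theorem integral_sq_eq (h : FourthMomentLE ν B) (c : ℝ) :
    ∫ x : ℤ, ((x : ℝ) - c) ^ 2 ∂ν = var ν + (mean ν - c) ^ 2 := by
  have := h.prob
  have e : ∀ x : ℤ, ((x : ℝ) - c) ^ 2
      = (((x : ℝ) - mean ν) ^ 2 + 2 * (mean ν - c) * ((x : ℝ) - mean ν)) + (mean ν - c) ^ 2 :=
    fun x => by ring
  have hi : Integrable (fun x : ℤ => (x : ℝ) - mean ν) ν :=
    h.integrable_cast.sub (integrable_const _)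
  simp_rw [e]
  have hi' := hi.const_mul (2 * (mean ν - c))
  have h1 : ∫ x : ℤ, (((x : ℝ) - mean ν) ^ 2 + 2 * (mean ν - c) * ((x : ℝ) - mean ν)) ∂ν
      = var ν := by
    rw [integral_add (h.integrable_sq _) hi', integral_const_mul, h.integral_sub_mean, var_eq]
    simp
  have h2 : Integrable (fun x : ℤ => ((x : ℝ) - mean ν) ^ 2
      + 2 * (mean ν - c) * ((x : ℝ) - mean ν)) ν := (h.integrable_sq _).add hi'
  rw [integral_add h2 (integrable_const _), h1]
  simp

theorem var_le (h : FourthMomentLE ν B) : var ν ≤ 1 + B := by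
  have := h.prob
  rw [var_eq]
  calc _ ≤ ∫ x : ℤ, (1 + ((x : ℝ) - mean ν) ^ 4) ∂ν :=
        integral_mono (h.integrable_sq _) ((integrable_const _).add (h.integrable_pow_four _))
          fun x => (abs_pow_le_one_add_pow_four _).2.1
    _ = 1 + ∫ x : ℤ, ((x : ℝ) - mean ν) ^ 4 ∂ν := by
        rw [integral_add (integrable_const _) (h.integrable_pow_four _)]; simp
    _ ≤ 1 + B := by linarith [h.moment_le]

theorem var_nonneg (ν : Measure ℤ) : 0 ≤ var ν := variance_nonneg _ _

theorem integral_pow_four_le (h : FourthMomentLE ν B) (c : ℝ) :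
    ∫ x : ℤ, ((x : ℝ) - c) ^ 4 ∂ν ≤ 8 * (B + (mean ν - c) ^ 4) := by
  have := h.prob
  calc _ ≤ ∫ x : ℤ, (8 * ((x : ℝ) - mean ν) ^ 4 + 8 * (mean ν - c) ^ 4) ∂ν := by
        refine integral_mono (h.integrable_pow_four _)
          (((h.integrable_pow_four _).const_mul _).add (integrable_const _)) fun x => ?_
        have := (even_two_mul 2).add_pow_le (a := (x : ℝ) - mean ν) (b := mean ν - c)
        norm_num at this
        linarith
    _ = 8 * ∫ x : ℤ, ((x : ℝ) - mean ν) ^ 4 ∂ν + 8 * (mean ν - c) ^ 4 := by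
        rw [integral_add ((h.integrable_pow_four _).const_mul _) (integrable_const _),
          integral_const_mul]; simp
    _ ≤ _ := by linarith [h.moment_le]

/-- By Chebyshev's inequality half of the mass lies in an interval of length `O(1 + B)` around the
mean, so some atom there is large. -/
theorem exists_large_atom (h : FourthMomentLE ν B) :
    ∃ x : ℤ, |(x : ℝ) - mean ν| ≤ 2 * (1 + B) ∧ 1 ≤ 10 * (1 + B) * ν.real {x} := by
  have := h.prob
  have hB := h.B_nonneg
  set β := 1 + B with hβ
  have hβ1 : 1 ≤ β := by linarith
  set W : Finset ℤ := Finset.Icc ⌈mean ν - 2 * β⌉ ⌊mean ν + 2 * β⌋ with hW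
  have hmem : ∀ x : ℤ, x ∈ W ↔ |(x : ℝ) - mean ν| ≤ 2 * β := by
    intro x
    rw [hW, Finset.mem_Icc, Int.ceil_le, Int.le_floor, abs_le]
    constructor <;> rintro ⟨h1, h2⟩ <;> constructor <;> linarith
  have hcard : (W.card : ℝ) ≤ 5 * β := by
    rw [hW, Int.card_Icc]
    have h1 := Int.floor_le (mean ν + 2 * β)
    have h2 := Int.le_ceil (mean ν - 2 * β)
    have h3 : ((⌊mean ν + 2 * β⌋ + 1 - ⌈mean ν - 2 * β⌉).toNat : ℝ)
        = ((⌊mean ν + 2 * β⌋ + 1 - ⌈mean ν - 2 * β⌉).toNat : ℤ) := by norm_cast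
    rw [h3, Int.toNat_eq_max]
    push_cast
    refine max_le ?_ ?_ <;> linarith
  have hcompl : ν.real (W : Set ℤ)ᶜ ≤ 1 / 2 := by
    have hm := mul_meas_ge_le_integral_of_nonneg (μ := ν)
      (Filter.Eventually.of_forall fun x : ℤ => by positivity)
      (h.integrable_pow_four (mean ν)) (16 * β ^ 4)
    have hsub : ν.real (W : Set ℤ)ᶜ ≤ ν.real {x : ℤ | 16 * β ^ 4 ≤ ((x : ℝ) - mean ν) ^ 4} := by
      refine measureReal_mono fun x hx => ?_
      have hx' : 2 * β < |(x : ℝ) - mean ν| := by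
        by_contra hcon
        exact hx ((hmem x).2 (not_lt.1 hcon))
      have e : ((x : ℝ) - mean ν) ^ 4 = |(x : ℝ) - mean ν| ^ 4 := ((even_two_mul 2).pow_abs _).symm
      rw [Set.mem_ofPred_eq, e]
      calc 16 * β ^ 4 = (2 * β) ^ 4 := by ring
        _ ≤ _ := by gcongr
    have h16 : (16 * β ^ 4) * ν.real (W : Set ℤ)ᶜ ≤ B :=
      (mul_le_mul_of_nonneg_left hsub (by positivity)).trans (hm.trans h.moment_le)
    have hβ4 : β ≤ β ^ 4 := le_self_pow₀ hβ1 (by norm_num)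
    have hnn : 0 ≤ ν.real (W : Set ℤ)ᶜ := measureReal_nonneg
    by_contra hcon
    push Not at hcon
    nlinarith
  have hsum : 1 / 2 ≤ ∑ x ∈ W, ν.real {x} := by
    rw [measureReal_compl W.measurableSet, probReal_univ] at hcompl
    rw [sum_measureReal_singleton]; linarith
  by_contra hcon
  push Not at hcon
  have hlt : ∀ x ∈ W, ν.real {x} ≤ 1 / (10 * β) := fun x hx => by
    have := hcon x ((hmem x).1 hx)
    rw [le_div_iff₀ (by positivity)]; linarith
  have hne : W.Nonempty := by
    by_contra hemp
    rw [Finset.not_nonempty_iff_eq_empty] at hemp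
    rw [hemp] at hsum; norm_num at hsum
  have hlt' : ∑ x ∈ W, ν.real {x} < ∑ x ∈ W, 1 / (10 * β) := by
    refine Finset.sum_lt_sum_of_nonempty hne fun x hx => ?_
    have := hcon x ((hmem x).1 hx)
    rw [lt_div_iff₀ (by positivity)]; linarith
  rw [Finset.sum_const, nsmul_eq_mul] at hlt'
  have : (W.card : ℝ) * (1 / (10 * β)) ≤ 1 / 2 := by
    rw [mul_one_div, div_le_div_iff₀ (by positivity) (by norm_num)]; linarith
  linarith

theorem mode_mass_ge (h : FourthMomentLE ν B) {M : ℤ} (hM : IsMode ν M) :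
    1 ≤ 10 * (1 + B) * ν.real {M} := by
  obtain ⟨x, -, hx⟩ := h.exists_large_atom
  have := h.B_nonneg
  exact hx.trans (mul_le_mul_of_nonneg_left (hM x) (by positivity))

end FourthMomentLE

theorem antitone_right {ν : Measure ℤ} {M : ℤ} (h : ∀ x : ℤ, M ≤ x → ν.real {x + 1} ≤ ν.real {x})
    {x y : ℤ} (hx : M ≤ x) (hxy : x ≤ y) : ν.real {y} ≤ ν.real {x} := by
  induction y, hxy using Int.leInduction with
  | base => exact le_rfl
  | succ n hn ih => exact (h n (hx.trans hn)).trans ih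

theorem monotone_left {ν : Measure ℤ} {M : ℤ} (h : ∀ x : ℤ, x < M → ν.real {x} ≤ ν.real {x + 1})
    {x y : ℤ} (hy : y ≤ M) (hxy : x ≤ y) : ν.real {x} ≤ ν.real {y} := by
  induction y, hxy using Int.leInduction with
  | base => exact le_rfl
  | succ n hn ih => exact (ih (by omega)).trans (h n (by omega))

/-- All points between `x` and the mode have at least the mass of `x`. -/
theorem abs_sub_mode_mul_le_one {ν : Measure ℤ} [IsProbabilityMeasure ν] {M : ℤ}
    (hr : ∀ x : ℤ, M ≤ x → ν.real {x + 1} ≤ ν.real {x})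
    (hl : ∀ x : ℤ, x < M → ν.real {x} ≤ ν.real {x + 1}) (x : ℤ) :
    |(x : ℝ) - M| * ν.real {x} ≤ 1 := by
  have key : ∀ W : Finset ℤ, (∀ y ∈ W, ν.real {x} ≤ ν.real {y}) → (W.card : ℝ) * ν.real {x} ≤ 1 := by
    intro W hW
    calc (W.card : ℝ) * ν.real {x} = ∑ y ∈ W, ν.real {x} := by simp
      _ ≤ ∑ y ∈ W, ν.real {y} := Finset.sum_le_sum hW
      _ = ν.real W := sum_measureReal_singleton _
      _ ≤ 1 := measureReal_le_one
  rcases le_total M x with hx | hx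
  · have := key (Finset.Ico M x) fun y hy => by
      rw [Finset.mem_Ico] at hy
      exact antitone_right hr hy.1 hy.2.le
    rw [Int.card_Ico] at this
    have e : |(x : ℝ) - M| = ((x - M).toNat : ℝ) := by
      rw [abs_of_nonneg (by rw [sub_nonneg]; exact_mod_cast hx)]
      have : (((x - M).toNat : ℤ) : ℝ) = ((x - M : ℤ) : ℝ) := by
        rw [Int.toNat_of_nonneg (by omega)]
      push_cast at this; exact this.symm
    rwa [e]
  · have := key (Finset.Ioc x M) fun y hy => by
      rw [Finset.mem_Ioc] at hy
      exact monotone_left hl hy.2 hy.1.le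
    rw [Int.card_Ioc] at this
    have e : |(x : ℝ) - M| = ((M - x).toNat : ℝ) := by
      rw [abs_of_nonpos (by rw [sub_nonpos]; exact_mod_cast hx)]
      have : (((M - x).toNat : ℤ) : ℝ) = ((M - x : ℤ) : ℝ) := by
        rw [Int.toNat_of_nonneg (by omega)]
      push_cast at this; linarith
    rwa [e]

/-- The mode is close to a large atom near the mean, as atoms far from the mode are small. -/
theorem FourthMomentLE.abs_mean_sub_mode_le {ν : Measure ℤ} {B : ℝ} (h : FourthMomentLE ν B) {M : ℤ}
    (hr : ∀ x : ℤ, M ≤ x → ν.real {x + 1} ≤ ν.real {x})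
    (hl : ∀ x : ℤ, x < M → ν.real {x} ≤ ν.real {x + 1}) : |mean ν - M| ≤ 12 * (1 + B) := by
  have := h.prob
  have hB := h.B_nonneg
  obtain ⟨x, hx1, hx2⟩ := h.exists_large_atom
  have hx3 := abs_sub_mode_mul_le_one hr hl x
  have hx4 : |(x : ℝ) - M| ≤ 10 * (1 + B) := by
    calc |(x : ℝ) - M| ≤ |(x : ℝ) - M| * (10 * (1 + B) * ν.real {x}) :=
          le_mul_of_one_le_right (abs_nonneg _) hx2
      _ = 10 * (1 + B) * (|(x : ℝ) - M| * ν.real {x}) := by ring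
      _ ≤ 10 * (1 + B) * 1 := by gcongr
      _ = _ := mul_one _
  have := abs_sub_le (mean ν) (x : ℝ) M
  rw [abs_sub_comm (mean ν) (x : ℝ)] at this
  linarith

/-- A unimodal law of variance at least `γ` has two neighbouring atoms that both have mass at least
an inverse polynomial in `B` and `1 / γ`: the atoms other than the mode carry a second moment of at
least `γ` around it, and they are all dominated by the larger neighbour of the mode. -/
theorem exists_adjacent_atoms {ν : Measure ℤ} {B γ : ℝ} (h : FourthMomentLE ν B) (hu : Unimodal ν)
    (hγ : 0 < γ) (hv : γ ≤ var ν) :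
    ∃ (η : ℝ) (y : ℤ), η ≤ ν.real {y} ∧ η ≤ ν.real {y + 1} ∧
      1 ≤ 10 ^ 18 * ((1 + B) * (1 + 1 / γ)) ^ 12 * η := by
  have := h.prob
  have hB := h.B_nonneg
  obtain ⟨M, hr, hl⟩ := hu
  set β := 1 + B with hβ
  set g := 1 + 1 / γ with hg
  have hβ1 : 1 ≤ β := by linarith
  have hg1 : 1 ≤ g := by have : 0 < 1 / γ := by positivity
                         linarith
  have hMmean : |mean ν - M| ≤ 12 * β := h.abs_mean_sub_mode_le hr hl
  have h4 : ∫ x : ℤ, ((x : ℝ) - M) ^ 4 ∂ν ≤ 170000 * β ^ 4 := by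
    refine (h.integral_pow_four_le M).trans ?_
    have e : (mean ν - M) ^ 4 = |mean ν - M| ^ 4 := ((even_two_mul 2).pow_abs _).symm
    have h1 : (mean ν - M) ^ 4 ≤ (12 * β) ^ 4 := by rw [e]; gcongr
    have hβ4 : β ≤ β ^ 4 := le_self_pow₀ hβ1 (by norm_num)
    nlinarith
  have h2 : γ ≤ ∫ x : ℤ, ((x : ℝ) - M) ^ 2 ∂ν := by
    rw [h.integral_sq_eq]; nlinarith [sq_nonneg (mean ν - M)]
  set η := max (ν.real {M - 1}) (ν.real {M + 1}) with hη
  have hη0 : 0 ≤ η := (real_singleton_nonneg ν _).trans (le_max_left _ _)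
  have hηle : ∀ x : ℤ, x ≠ M → ν.real {x} ≤ η := by
    intro x hx
    rcases lt_or_gt_of_ne hx with h1 | h1
    · exact (monotone_left hl (by omega) (by omega : x ≤ M - 1)).trans (le_max_left _ _)
    · exact (antitone_right hr (by omega) (by omega : M + 1 ≤ x)).trans (le_max_right _ _)
  -- beyond distance `K` from the mode, the second moment is at most `γ / 2`, by the fourth moment
  set K : ℕ := ⌈2 * (170000 * β ^ 4) / γ⌉₊ with hK
  have hKge : 2 * (170000 * β ^ 4) / γ ≤ K := Nat.le_ceil _
  have hKpos : (1 : ℝ) ≤ K := by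
    have : 0 < K := Nat.ceil_pos.2 (by positivity)
    exact_mod_cast this
  have hKle : (K : ℝ) ≤ 400000 * (β ^ 4 * g) := by
    have h1 := (Nat.ceil_lt_add_one (by positivity : 0 ≤ 2 * (170000 * β ^ 4) / γ)).le
    have h3 : 1 ≤ β ^ 4 * g := one_le_mul_of_one_le_of_one_le (one_le_pow₀ hβ1) hg1
    have h5 : 2 * (170000 * β ^ 4) / γ ≤ 340000 * (β ^ 4 * g) := by
      have : 2 * (170000 * β ^ 4) / γ = 340000 * (β ^ 4 * (1 / γ)) := by ring
      rw [this]
      have h6 : 1 / γ ≤ g := by linarith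
      gcongr
    linarith
  have hsmall : 170000 * β ^ 4 / (K : ℝ) ^ 2 ≤ γ / 2 := by
    rw [div_le_div_iff₀ (by positivity) (by norm_num)]
    rw [div_le_iff₀ hγ] at hKge
    nlinarith [mul_le_mul_of_nonneg_left hKpos (by positivity : 0 ≤ γ * (K : ℝ))]
  set W : Finset ℤ := (Finset.Icc (M - K) (M + K)).erase M with hW
  have hWcard : (W.card : ℝ) ≤ 2 * K := by
    have : W.card = 2 * K := by
      rw [hW, Finset.card_erase_of_mem (by simp), Int.card_Icc]; omega
    rw [this]; push_cast; exact le_rfl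
  have hWmass : ν.real W ≤ 2 * K * η := by
    rw [← sum_measureReal_singleton]
    calc ∑ x ∈ W, ν.real {x} ≤ ∑ x ∈ W, η :=
          Finset.sum_le_sum fun x hx => hηle x (Finset.ne_of_mem_erase hx)
      _ = W.card * η := by simp
      _ ≤ _ := by gcongr
  have hint : ∫ x : ℤ, ((x : ℝ) - M) ^ 2 ∂ν
      ≤ (K : ℝ) ^ 2 * ν.real W + (170000 * β ^ 4) / (K : ℝ) ^ 2 := by
    calc ∫ x : ℤ, ((x : ℝ) - M) ^ 2 ∂ν
        ≤ ∫ x : ℤ, ((W : Set ℤ).indicator (fun _ => (K : ℝ) ^ 2) x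
            + ((x : ℝ) - M) ^ 4 / (K : ℝ) ^ 2) ∂ν := by
          refine integral_mono (h.integrable_sq _) (((integrable_const _).indicator
            W.measurableSet).add ((h.integrable_pow_four _).div_const _)) fun x => ?_
          by_cases hx : x ∈ (W : Set ℤ)
          · simp only [Set.indicator_of_mem hx]
            have hx' := Finset.mem_Icc.1 (Finset.mem_of_mem_erase hx)
            have h1 : ((M : ℝ) - K) ≤ x := by exact_mod_cast hx'.1
            have h3 : (x : ℝ) ≤ M + K := by exact_mod_cast hx'.2
            have h5 : ((x : ℝ) - M) ^ 2 ≤ (K : ℝ) ^ 2 := by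
              apply sq_le_sq'  <;> linarith
            have : 0 ≤ ((x : ℝ) - M) ^ 4 / (K : ℝ) ^ 2 := by positivity
            linarith
          · simp only [Set.indicator_of_notMem hx, zero_add]
            rw [le_div_iff₀ (by positivity)]
            by_cases hxM : x = M
            · simp [hxM]
            have h1 : (K : ℝ) ^ 2 ≤ ((x : ℝ) - M) ^ 2 := by
              rw [hW, Finset.mem_coe, Finset.mem_erase, Finset.mem_Icc] at hx
              have hcases : x < M - K ∨ M + K < x := by
                by_contra hcon
                push Not at hcon
                exact hx ⟨hxM, hcon⟩
              rcases hcases with h1 | h1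
              · have h3 : (x : ℝ) ≤ M - K := by exact_mod_cast h1.le
                nlinarith
              · have h3 : (M : ℝ) + K ≤ x := by exact_mod_cast h1.le
                nlinarith
            nlinarith [sq_nonneg ((x : ℝ) - M)]
      _ = (K : ℝ) ^ 2 * ν.real W + (∫ x : ℤ, ((x : ℝ) - M) ^ 4 ∂ν) / (K : ℝ) ^ 2 := by
          rw [integral_add ((integrable_const _).indicator W.measurableSet)
            ((h.integrable_pow_four _).div_const _), integral_indicator_const _ W.measurableSet,
            integral_div, smul_eq_mul, mul_comm]
      _ ≤ _ := by gcongr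
  have hfin : γ ≤ 4 * (K : ℝ) ^ 3 * η := by
    have : (K : ℝ) ^ 2 * ν.real W ≤ (K : ℝ) ^ 2 * (2 * K * η) := by gcongr
    nlinarith
  have hηfin : 1 ≤ 10 ^ 18 * (β * g) ^ 12 * η := by
    have hgγ : 1 ≤ g * γ := by rw [hg, add_mul, one_div_mul_cancel hγ.ne']; linarith
    have hK3 : (K : ℝ) ^ 3 ≤ (400000 * (β ^ 4 * g)) ^ 3 := by gcongr
    have hpow : g ^ 4 * β ^ 12 ≤ (β * g) ^ 12 := by
      rw [mul_pow, mul_comm]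
      exact mul_le_mul_of_nonneg_left (pow_le_pow_right₀ hg1 (by norm_num)) (by positivity)
    calc 1 ≤ g * γ := hgγ
      _ ≤ g * (4 * (K : ℝ) ^ 3 * η) := by gcongr
      _ ≤ g * (4 * (400000 * (β ^ 4 * g)) ^ 3 * η) := by gcongr
      _ = (4 * 400000 ^ 3) * (g ^ 4 * β ^ 12) * η := by ring
      _ ≤ (4 * 400000 ^ 3) * (β * g) ^ 12 * η := by gcongr
      _ ≤ 10 ^ 18 * (β * g) ^ 12 * η := by gcongr; norm_num
  rcases le_total (ν.real {M - 1}) (ν.real {M + 1}) with hc | hc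
  · refine ⟨η, M, ?_, ?_, hηfin⟩
    · rw [hη, max_eq_right hc]; exact hr M le_rfl
    · rw [hη, max_eq_right hc]
  · refine ⟨η, M - 1, ?_, ?_, hηfin⟩
    · rw [hη, max_eq_left hc]
    · rw [hη, max_eq_left hc]; exact hl (M - 1) (by omega)

/-! ### Characteristic functions of unimodal laws -/

theorem norm_one_add_exp_le {t : ℝ} (ht : |t| ≤ Real.pi) :
    ‖1 + Complex.exp ((t : ℝ) * Complex.I)‖ ≤ 2 - t ^ 2 / Real.pi ^ 2 := by
  have hpi := Real.pi_pos
  have h1 : |t / 2| ≤ Real.pi := by rw [abs_div, abs_two]; linarith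
  have hcos := Real.cos_le_one_sub_mul_cos_sq h1
  have h0 : 0 ≤ Real.cos (t / 2) := by
    rw [abs_le] at ht
    exact Real.cos_nonneg_of_neg_pi_div_two_le_of_le (by linarith [ht.1]) (by linarith [ht.2])
  have e : 1 + Complex.exp ((t : ℝ) * Complex.I)
      = Complex.exp ((t / 2 : ℝ) * Complex.I) * ((2 * Real.cos (t / 2) : ℝ) : ℂ) := by
    push_cast
    rw [Complex.two_cos, mul_add, ← Complex.exp_add, ← Complex.exp_add]
    ring_nf
    rw [Complex.exp_zero, add_comm]
  rw [e, norm_mul, Complex.norm_exp_ofReal_mul_I, one_mul, Complex.norm_real, Real.norm_eq_abs,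
    abs_of_nonneg (by positivity)]
  have : 2 / Real.pi ^ 2 * (t / 2) ^ 2 = t ^ 2 / Real.pi ^ 2 / 2 := by ring
  linarith

/-- Two neighbouring atoms of mass at least `η` make the characteristic function decay on the whole
period. -/
theorem norm_charZ_le_exp (ν : Measure ℤ) [IsProbabilityMeasure ν] {η : ℝ} {y : ℤ}
    (h1 : η ≤ ν.real {y}) (h2 : η ≤ ν.real {y + 1}) {t : ℝ} (hη : 0 ≤ η) (ht : |t| ≤ Real.pi) :
    ‖charZ ν t‖ ≤ Real.exp (-(η / Real.pi ^ 2) * t ^ 2) := by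
  set e : ℤ → ℂ := fun x => Complex.exp ((t * (x : ℝ) : ℝ) * Complex.I) with he
  have hen : ∀ x, ‖e x‖ = 1 := fun x => by rw [he]; exact Complex.norm_exp_ofReal_mul_I _
  -- split off the mass `η` at `y` and `y + 1`; the rest has mass `1 - 2 * η`
  set q : ℤ → ℝ := fun x => if x ∈ ({y, y + 1} : Finset ℤ) then η else 0 with hq
  have hyne : y ≠ y + 1 := by omega
  have hqle : ∀ x, q x ≤ ν.real {x} := by
    intro x
    simp only [hq]
    split_ifs with hx
    · rcases Finset.mem_insert.1 hx with rfl | hx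
      · exact h1
      · rw [Finset.mem_singleton.1 hx]; exact h2
    · exact real_singleton_nonneg _ _
  have hqs : HasSum q (2 * η) := by
    have := hasSum_sum_of_ne_finset_zero (L := .unconditional ℤ) (f := q) (s := {y, y + 1})
      (fun x hx => by simp only [hq, if_neg hx])
    rw [Finset.sum_pair hyne] at this
    simpa [hq, two_mul] using this
  have hqe : HasSum (fun x => (q x : ℂ) * e x) (η * e y + η * e (y + 1)) := by
    have := hasSum_sum_of_ne_finset_zero (L := .unconditional ℤ) (f := fun x => (q x : ℂ) * e x)
      (s := {y, y + 1}) (fun x hx => by simp only [hq, if_neg hx]; simp)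
    rw [Finset.sum_pair hyne] at this
    simpa [hq] using this
  have hchar : HasSum (fun x => ((ν.real {x} : ℝ) : ℂ) * e x) (charZ ν t) := by
    have hi := integrable_exp_mul_I ν (fun x : ℤ => t * (x : ℝ))
    have := integral_countable hi
    have hs : Summable (fun x => ((ν.real {x} : ℝ) : ℂ) * e x) := by
      refine Summable.of_norm_bounded (summable_real_singleton ν) fun x => ?_
      rw [norm_mul, hen, mul_one, Complex.norm_real, Real.norm_eq_abs,
        abs_of_nonneg (real_singleton_nonneg _ _)]
    have e2 : charZ ν t = ∑' x, ((ν.real {x} : ℝ) : ℂ) * e x := by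
      rw [charZ, this]
      exact tsum_congr fun x => by rw [Complex.real_smul]
    rw [e2]; exact hs.hasSum
  have hdiff : ‖charZ ν t - (η * e y + η * e (y + 1))‖ ≤ 1 - 2 * η := by
    refine (hchar.sub hqe).norm_le_of_bounded ((hasSum_real_singleton ν).sub hqs) fun x => ?_
    rw [← sub_mul, norm_mul, hen, mul_one, ← Complex.ofReal_sub, Complex.norm_real,
      Real.norm_eq_abs, abs_of_nonneg (sub_nonneg.2 (hqle x))]
  have hpair : ‖(η : ℂ) * e y + η * e (y + 1)‖ ≤ η * (2 - t ^ 2 / Real.pi ^ 2) := by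
    have : (η : ℂ) * e y + η * e (y + 1)
        = η * e y * (1 + Complex.exp ((t : ℝ) * Complex.I)) := by
      simp only [he]
      rw [mul_add, mul_one, mul_assoc (η : ℂ), ← Complex.exp_add]
      congr 3
      push_cast; ring
    rw [this, norm_mul, norm_mul, hen, mul_one, Complex.norm_real, Real.norm_eq_abs,
      abs_of_nonneg hη]
    exact mul_le_mul_of_nonneg_left (norm_one_add_exp_le ht) hη
  have htri := norm_add_le (charZ ν t - (η * e y + η * e (y + 1))) (η * e y + η * e (y + 1))
  rw [sub_add_cancel] at htri
  refine le_trans ?_ (Real.add_one_le_exp _)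
  have : -(η / Real.pi ^ 2) * t ^ 2 = - (η * (t ^ 2 / Real.pi ^ 2)) := by ring
  nlinarith

theorem norm_exp_mul_I_sub_taylor_le (x : ℝ) :
    ‖Complex.exp ((x : ℝ) * Complex.I) - (1 + x * Complex.I - x ^ 2 / 2)‖ ≤ 5 * |x| ^ 3 := by
  have hn : ‖(x : ℂ) * Complex.I‖ = |x| := by simp
  rcases le_total |x| 1 with hx | hx
  · have h := Complex.exp_bound (x := (x : ℂ) * Complex.I) (by rwa [hn]) (n := 3) (by norm_num)
    rw [hn] at h
    have e : ∑ m ∈ Finset.range 3, ((x : ℂ) * Complex.I) ^ m / (m.factorial : ℂ)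
        = 1 + x * Complex.I - x ^ 2 / 2 := by
      simp [Finset.sum_range_succ, Nat.factorial, mul_pow]
      ring
    rw [e] at h
    refine h.trans ?_
    have := pow_nonneg (abs_nonneg x) 3
    norm_num [Nat.factorial]
    linarith
  · have h3 : |x| ≤ |x| ^ 3 := le_self_pow₀ hx (by norm_num)
    have h2 : |x| ^ 2 ≤ |x| ^ 3 := pow_le_pow_right₀ hx (by norm_num)
    calc _ ≤ ‖Complex.exp ((x : ℝ) * Complex.I)‖ + ‖1 + x * Complex.I - x ^ 2 / 2‖ := norm_sub_le _ _
      _ ≤ 1 + ((‖(1 : ℂ)‖ + ‖(x : ℂ) * Complex.I‖) + ‖(x : ℂ) ^ 2 / 2‖) := by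
          rw [Complex.norm_exp_ofReal_mul_I]
          gcongr
          exact (norm_sub_le _ _).trans (add_le_add_left (norm_add_le _ _) _)
      _ = 1 + ((1 + |x|) + |x| ^ 2 / 2) := by
          rw [hn, norm_div, norm_pow, Complex.norm_real, Real.norm_eq_abs]; simp
      _ ≤ _ := by nlinarith

theorem abs_exp_neg_sub_le {y : ℝ} (hy : 0 ≤ y) : |Real.exp (-y) - (1 - y)| ≤ y ^ 2 := by
  have h1 := Real.add_one_le_exp (-y)
  rw [abs_of_nonneg (by linarith)]
  rcases le_total y 1 with hy1 | hy1
  · have := Real.abs_exp_sub_one_sub_id_le (x := -y) (by rwa [abs_neg, abs_of_nonneg hy])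
    rw [abs_le] at this
    nlinarith [this.2]
  · have : Real.exp (-y) ≤ 1 := Real.exp_le_one_iff.2 (by linarith)
    nlinarith

/-- The characteristic function of the centred law agrees with the Gaussian one of the same variance
to third order. -/
theorem norm_charZ_centred_sub_gaussian_le {ν : Measure ℤ} {B : ℝ} (h : FourthMomentLE ν B) {t : ℝ}
    (ht : |t| ≤ Real.pi) :
    ‖Complex.exp ((-(t * mean ν) : ℝ) * Complex.I) * charZ ν t
      - (Real.exp (-(var ν / 2) * t ^ 2) : ℝ)‖ ≤ 6 * (1 + B) ^ 2 * |t| ^ 3 := by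
  have := h.prob
  have hB := h.B_nonneg
  set m := mean ν with hm
  have e1 : Complex.exp ((-(t * m) : ℝ) * Complex.I) * charZ ν t
      = ∫ x : ℤ, Complex.exp ((t * ((x : ℝ) - m) : ℝ) * Complex.I) ∂ν := by
    rw [charZ, ← integral_const_mul]
    refine integral_congr_ae (Filter.Eventually.of_forall fun x => ?_)
    simp only
    rw [← Complex.exp_add]
    push_cast; ring_nf
  have hi0 : Integrable (fun x : ℤ => Complex.exp ((t * ((x : ℝ) - m) : ℝ) * Complex.I)) ν :=
    integrable_exp_mul_I ν _
  have hi1 : Integrable (fun x : ℤ => (x : ℝ) - m) ν := h.integrable_cast.sub (integrable_const _)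
  have hi2 := h.integrable_sq m
  have hlin : Integrable (fun x : ℤ => ((t * ((x : ℝ) - m) : ℝ) : ℂ) * Complex.I) ν :=
    ((hi1.const_mul t).ofReal).mul_const _
  have hquad : Integrable (fun x : ℤ => ((t * ((x : ℝ) - m) : ℝ) : ℂ) ^ 2 / 2) ν := by
    have e2 : ∀ x : ℤ, ((t * ((x : ℝ) - m) : ℝ) : ℂ) ^ 2 / 2
        = ((t ^ 2 / 2 * ((x : ℝ) - m) ^ 2 : ℝ) : ℂ) := fun x => by push_cast; ring
    simp_rw [e2]
    exact (hi2.const_mul (t ^ 2 / 2)).ofReal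
  have hT : ∫ x : ℤ, (1 + ((t * ((x : ℝ) - m) : ℝ) : ℂ) * Complex.I
      - ((t * ((x : ℝ) - m) : ℝ) : ℂ) ^ 2 / 2) ∂ν = ((1 - var ν / 2 * t ^ 2 : ℝ) : ℂ) := by
    have hA : Integrable (fun x : ℤ => 1 + ((t * ((x : ℝ) - m) : ℝ) : ℂ) * Complex.I) ν :=
      (integrable_const 1).add hlin
    have hlin0 : ∫ x : ℤ, ((t * ((x : ℝ) - m) : ℝ) : ℂ) ∂ν = 0 := by
      have : ∫ x : ℤ, ((t * ((x : ℝ) - m) : ℝ) : ℂ) ∂ν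
          = ((∫ x : ℤ, t * ((x : ℝ) - m) ∂ν : ℝ) : ℂ) := integral_ofReal
      rw [this, integral_const_mul, hm, h.integral_sub_mean]; simp
    rw [integral_sub hA hquad, integral_add (integrable_const _) hlin, integral_mul_const,
      hlin0]
    have e2 : ∀ x : ℤ, ((t * ((x : ℝ) - mean ν) : ℝ) : ℂ) ^ 2 / 2
        = ((t ^ 2 / 2 * ((x : ℝ) - mean ν) ^ 2 : ℝ) : ℂ) := fun x => by push_cast; ring
    have e4 : ∫ x : ℤ, ((t ^ 2 / 2 * ((x : ℝ) - mean ν) ^ 2 : ℝ) : ℂ) ∂ν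
        = ((∫ x : ℤ, t ^ 2 / 2 * ((x : ℝ) - mean ν) ^ 2 ∂ν : ℝ) : ℂ) := integral_ofReal
    simp_rw [hm, e2]
    rw [e4, integral_const_mul, ← var_eq]
    simp
    ring
  have hmain : ‖(∫ x : ℤ, Complex.exp ((t * ((x : ℝ) - m) : ℝ) * Complex.I) ∂ν)
      - ((1 - var ν / 2 * t ^ 2 : ℝ) : ℂ)‖ ≤ 5 * (1 + B) * |t| ^ 3 := by
    have hAll : Integrable (fun x : ℤ => 1 + ((t * ((x : ℝ) - m) : ℝ) : ℂ) * Complex.I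
        - ((t * ((x : ℝ) - m) : ℝ) : ℂ) ^ 2 / 2) ν := ((integrable_const 1).add hlin).sub hquad
    rw [← hT, ← integral_sub hi0 hAll]
    have hb : Integrable (fun x : ℤ => 5 * |t| ^ 3 * (1 + ((x : ℝ) - m) ^ 4)) ν :=
      ((integrable_const _).add (h.integrable_pow_four m)).const_mul _
    refine (norm_integral_le_of_norm_le hb (Filter.Eventually.of_forall fun x => ?_)).trans ?_
    · refine (norm_exp_mul_I_sub_taylor_le _).trans ?_
      rw [abs_mul, mul_pow, ← mul_assoc]
      exact mul_le_mul_of_nonneg_left (abs_pow_le_one_add_pow_four _).2.2 (by positivity)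
    · rw [integral_const_mul, integral_add (integrable_const _) (h.integrable_pow_four m)]
      have := h.moment_le
      simp only [integral_const, probReal_univ, one_smul]
      rw [mul_assoc, mul_comm (|t| ^ 3), ← mul_assoc]
      gcongr
  have hv0 := FourthMomentLE.var_nonneg ν
  have hexp := abs_exp_neg_sub_le (y := var ν / 2 * t ^ 2) (by positivity)
  have hq : (var ν / 2 * t ^ 2) ^ 2 ≤ (1 + B) ^ 2 * |t| ^ 3 := by
    have hv : var ν ^ 2 ≤ (1 + B) ^ 2 := by
      have := h.var_le
      gcongr
    have ht4 : t ^ 2 * t ^ 2 = |t| ^ 3 * |t| := by rw [← sq_abs]; ring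
    have hpi := Real.pi_le_four
    have h3 := pow_nonneg (abs_nonneg t) 3
    calc (var ν / 2 * t ^ 2) ^ 2 = var ν ^ 2 / 4 * (|t| ^ 3 * |t|) := by rw [← ht4]; ring
      _ ≤ (1 + B) ^ 2 / 4 * (|t| ^ 3 * 4) := by gcongr; linarith
      _ = _ := by ring
  rw [e1]
  have e3 : (∫ x : ℤ, Complex.exp ((t * ((x : ℝ) - m) : ℝ) * Complex.I) ∂ν)
      - ((Real.exp (-(var ν / 2) * t ^ 2) : ℝ) : ℂ)
      = ((∫ x : ℤ, Complex.exp ((t * ((x : ℝ) - m) : ℝ) * Complex.I) ∂ν)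
        - ((1 - var ν / 2 * t ^ 2 : ℝ) : ℂ))
        - ((Real.exp (-(var ν / 2 * t ^ 2)) - (1 - var ν / 2 * t ^ 2) : ℝ) : ℂ) := by
    rw [neg_mul]; push_cast; ring
  rw [e3]
  refine (norm_sub_le _ _).trans ?_
  rw [Complex.norm_real, Real.norm_eq_abs]
  have h3 := pow_nonneg (abs_nonneg t) 3
  nlinarith [mul_nonneg h3 hB, mul_nonneg h3 (sq_nonneg B)]

theorem norm_prod_sub_prod_le {m : ℕ} (z w : Fin m → ℂ) (r d : ℝ) (hz : ∀ i, ‖z i‖ ≤ r)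
    (hw : ∀ i, ‖w i‖ ≤ r) (hd : ∀ i, ‖z i - w i‖ ≤ d) (hr : 0 ≤ r) :
    ‖∏ i, z i - ∏ i, w i‖ ≤ m * d * r ^ (m - 1) := by
  induction m with
  | zero => simp
  | succ n ih =>
    rw [Fin.prod_univ_succ, Fin.prod_univ_succ]
    have e : z 0 * ∏ i : Fin n, z i.succ - w 0 * ∏ i : Fin n, w i.succ
        = (z 0 - w 0) * ∏ i : Fin n, z i.succ
          + w 0 * (∏ i : Fin n, z i.succ - ∏ i : Fin n, w i.succ) := by ring
    rw [e]
    have hp : ‖∏ i : Fin n, z i.succ‖ ≤ r ^ n := by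
      rw [norm_prod]
      calc ∏ i : Fin n, ‖z i.succ‖ ≤ ∏ _i : Fin n, r :=
            Finset.prod_le_prod (fun _ _ => norm_nonneg _) fun i _ => hz _
        _ = r ^ n := by simp
    have hih := ih (fun i => z i.succ) (fun i => w i.succ) (fun i => hz _) (fun i => hw _)
      (fun i => hd _)
    have hd0 : 0 ≤ d := (norm_nonneg _).trans (hd 0)
    calc _ ≤ ‖z 0 - w 0‖ * ‖∏ i : Fin n, z i.succ‖
          + ‖w 0‖ * ‖∏ i : Fin n, z i.succ - ∏ i : Fin n, w i.succ‖ := by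
          rw [← norm_mul, ← norm_mul]; exact norm_add_le _ _
      _ ≤ d * r ^ n + r * (n * d * r ^ (n - 1)) := by gcongr <;> first | exact hd 0 | exact hw 0
      _ = ((n + 1 : ℕ) : ℝ) * d * r ^ (n + 1 - 1) := by
          rcases n with _ | n
          · simp
          · push_cast
            simp only [pow_succ]; ring

/-! ### Shifted binomial laws -/

/-- The fair Bernoulli law on `{0, 1} ⊆ ℤ`. -/
def fairBernoulli : Measure ℤ :=
  (2⁻¹ : ℝ≥0∞) • Measure.dirac 0 + (2⁻¹ : ℝ≥0∞) • Measure.dirac 1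

instance : IsProbabilityMeasure fairBernoulli :=
  ⟨by simp [fairBernoulli, ENNReal.inv_two_add_inv_two]⟩

/-- The law of `c + X`, where `X` has the binomial distribution with `N` trials and success
probability `1 / 2`. -/
def shiftedBinomial (N : ℕ) (c : ℤ) : Measure ℤ :=
  (indepSum fun _ : Fin N => fairBernoulli).map (· + c)

instance (N : ℕ) (c : ℤ) : IsProbabilityMeasure (shiftedBinomial N c) :=
  Measure.isProbabilityMeasure_map (measurable_of_countable _).aemeasurable

theorem integrable_fairBernoulli {E : Type*} [NormedAddCommGroup E] (f : ℤ → E) :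
    Integrable f fairBernoulli :=
  ((integrable_dirac (by simp)).smul_measure (by simp)).add_measure
    ((integrable_dirac (by simp)).smul_measure (by simp))

theorem integral_fairBernoulli {E : Type*} [NormedAddCommGroup E] [NormedSpace ℝ E]
    [CompleteSpace E] (f : ℤ → E) :
    ∫ x, f x ∂fairBernoulli = (2⁻¹ : ℝ) • f 0 + (2⁻¹ : ℝ) • f 1 := by
  rw [fairBernoulli, integral_add_measure ((integrable_dirac (by simp)).smul_measure (by simp))
    ((integrable_dirac (by simp)).smul_measure (by simp)), integral_smul_measure,
    integral_smul_measure, integral_dirac, integral_dirac]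
  simp

theorem charZ_fairBernoulli (t : ℝ) :
    charZ fairBernoulli t = Complex.exp ((t / 2 : ℝ) * Complex.I) * (Real.cos (t / 2) : ℝ) := by
  rw [charZ, integral_fairBernoulli, Complex.real_smul, Complex.real_smul]
  push_cast
  have h : Complex.cos ((t : ℂ) / 2) = (Complex.exp ((t / 2 : ℂ) * Complex.I)
      + Complex.exp (-(t / 2 : ℂ) * Complex.I)) / 2 := by
    rw [← Complex.two_cos]; ring
  rw [h, mul_div_assoc', mul_add, ← Complex.exp_add, ← Complex.exp_add]
  ring_nf

theorem charZ_shiftedBinomial (N : ℕ) (c : ℤ) (t : ℝ) :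
    charZ (shiftedBinomial N c) t
      = Complex.exp ((t * (c + N / 2) : ℝ) * Complex.I) * (Real.cos (t / 2) ^ N : ℝ) := by
  rw [shiftedBinomial, charZ_map_add, charZ_indepSum, Finset.prod_const, charZ_fairBernoulli,
    mul_pow, ← Complex.exp_nat_mul, ← mul_assoc, ← Complex.exp_add, Finset.card_univ,
    Fintype.card_fin]
  push_cast
  ring_nf

theorem integral_exp_shiftedBinomial (N : ℕ) (c : ℤ) (h : ℝ) :
    Integrable (fun x : ℤ => Real.exp (h * ((x : ℝ) - (c + N / 2)))) (shiftedBinomial N c) ∧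
    ∫ x : ℤ, Real.exp (h * ((x : ℝ) - (c + N / 2))) ∂(shiftedBinomial N c)
      = Real.cosh (h / 2) ^ N := by
  have hm1 : AEMeasurable (fun x : ℤ => x + c) (indepSum fun _ : Fin N => fairBernoulli) :=
    (measurable_of_countable _).aemeasurable
  have hm2 : AEMeasurable (fun x : Fin N → ℤ => ∑ i, x i)
      (Measure.pi fun _ : Fin N => fairBernoulli) := (measurable_of_countable _).aemeasurable
  have e : ∀ x : Fin N → ℤ, Real.exp (h * (((∑ i, x i + c : ℤ) : ℝ) - (c + N / 2)))
      = ∏ i, Real.exp (h * ((x i : ℝ) - 1 / 2)) := by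
    intro x
    rw [← Real.exp_sum, ← Finset.mul_sum, Finset.sum_sub_distrib]
    push_cast
    simp only [Finset.sum_const, Finset.card_univ, Fintype.card_fin, nsmul_eq_mul]
    ring_nf
  unfold shiftedBinomial
  constructor
  · rw [integrable_map_measure (measurable_of_countable _).aestronglyMeasurable hm1]
    unfold indepSum
    rw [integrable_map_measure (measurable_of_countable _).aestronglyMeasurable hm2]
    have : (((fun x : ℤ => Real.exp (h * ((x : ℝ) - (c + N / 2)))) ∘ fun x : ℤ => x + c) ∘
        fun x : Fin N → ℤ => ∑ i, x i) = fun x => ∏ i, Real.exp (h * ((x i : ℝ) - 1 / 2)) :=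
      funext e
    rw [this]
    exact Integrable.fintype_prod (f := fun _ (x : ℤ) => Real.exp (h * ((x : ℝ) - 1 / 2)))
      fun i => integrable_fairBernoulli _
  · rw [integral_map hm1 (measurable_of_countable _).aestronglyMeasurable]
    unfold indepSum
    rw [integral_map hm2 (measurable_of_countable _).aestronglyMeasurable]
    simp_rw [e]
    rw [integral_fintype_prod_eq_prod (fun _ (x : ℤ) => Real.exp (h * ((x : ℝ) - 1 / 2))),
      Finset.prod_const, integral_fairBernoulli, Real.cosh_eq, Finset.card_univ, Fintype.card_fin]
    congr 1
    simp only [smul_eq_mul]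
    push_cast
    ring_nf

/-- Hoeffding's inequality for the fair binomial law. -/
theorem shiftedBinomial_tail_le {N : ℕ} (hN : 0 < N) (c : ℤ) {y : ℝ} (hy : 0 ≤ y) :
    (shiftedBinomial N c).real {x : ℤ | y ≤ |(x : ℝ) - (c + N / 2)|}
      ≤ 2 * Real.exp (-(2 * y ^ 2 / N)) := by
  have hN' : (0 : ℝ) < N := by exact_mod_cast hN
  set q := shiftedBinomial N c
  set h : ℝ := 4 * y / N with hh
  have hh0 : 0 ≤ h := by positivity
  obtain ⟨i1, e1⟩ := integral_exp_shiftedBinomial N c h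
  obtain ⟨i2, e2⟩ := integral_exp_shiftedBinomial N c (-h)
  have hm := mul_meas_ge_le_integral_of_nonneg (μ := q)
    (Filter.Eventually.of_forall fun x : ℤ =>
      add_nonneg (Real.exp_pos _).le (Real.exp_pos _).le) (i1.add i2) (Real.exp (h * y))
  have hint : ∫ x : ℤ, ((fun x : ℤ => Real.exp (h * ((x : ℝ) - (c + N / 2)))) +
      fun x : ℤ => Real.exp (-h * ((x : ℝ) - (c + N / 2)))) x ∂q ≤ 2 * Real.exp (2 * y ^ 2 / N) := by
    rw [integral_add' i1 i2, e1, e2, neg_div, Real.cosh_neg, ← two_mul]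
    have : Real.cosh (h / 2) ^ N ≤ Real.exp (2 * y ^ 2 / N) := by
      calc Real.cosh (h / 2) ^ N ≤ Real.exp ((h / 2) ^ 2 / 2) ^ N :=
            pow_le_pow_left₀ (Real.cosh_pos _).le (Real.cosh_le_exp_half_sq _) _
        _ = Real.exp (2 * y ^ 2 / N) := by
            rw [← Real.exp_nat_mul]; congr 1; rw [hh]; field_simp; ring
    linarith
  have hsub : q.real {x : ℤ | y ≤ |(x : ℝ) - (c + N / 2)|} ≤ q.real {x : ℤ | Real.exp (h * y) ≤
      ((fun x : ℤ => Real.exp (h * ((x : ℝ) - (c + N / 2)))) +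
      fun x : ℤ => Real.exp (-h * ((x : ℝ) - (c + N / 2)))) x} := by
    refine measureReal_mono fun x hx => ?_
    simp only [Set.mem_ofPred_eq, Pi.add_apply] at hx ⊢
    have p1 := Real.exp_pos (h * ((x : ℝ) - (c + N / 2)))
    have p2 := Real.exp_pos (-h * ((x : ℝ) - (c + N / 2)))
    rcases le_abs.1 hx with h1 | h1
    · have : Real.exp (h * y) ≤ Real.exp (h * ((x : ℝ) - (c + N / 2))) :=
        Real.exp_le_exp.2 (mul_le_mul_of_nonneg_left h1 hh0)
      linarith
    · have : Real.exp (h * y) ≤ Real.exp (-h * ((x : ℝ) - (c + N / 2))) :=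
        Real.exp_le_exp.2 (by rw [neg_mul_comm]; exact mul_le_mul_of_nonneg_left h1 hh0)
      linarith
  have h3 : Real.exp (h * y) * q.real {x : ℤ | y ≤ |(x : ℝ) - (c + N / 2)|}
      ≤ 2 * Real.exp (2 * y ^ 2 / N) :=
    (mul_le_mul_of_nonneg_left hsub (Real.exp_pos _).le).trans (hm.trans hint)
  have e3 : Real.exp (2 * y ^ 2 / N) = Real.exp (h * y) * Real.exp (-(2 * y ^ 2 / N)) := by
    rw [← Real.exp_add]; congr 1; rw [hh]; field_simp; ring
  rw [e3] at h3
  have h4 := Real.exp_pos (h * y)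
  have h5 : Real.exp (h * y) * q.real {x : ℤ | y ≤ |(x : ℝ) - (c + N / 2)|}
      ≤ Real.exp (h * y) * (2 * Real.exp (-(2 * y ^ 2 / N))) := by linarith
  exact le_of_mul_le_mul_left h5 h4

theorem abs_cos_half_le_exp {t : ℝ} (ht : |t| ≤ Real.pi) :
    |Real.cos (t / 2)| ≤ Real.exp (-(1 / 20) * t ^ 2) := by
  have hpi := Real.pi_pos
  have h1 : |t / 2| ≤ Real.pi := by rw [abs_div, abs_two]; linarith
  have hcos := Real.cos_le_one_sub_mul_cos_sq h1
  have h0 : 0 ≤ Real.cos (t / 2) := by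
    rw [abs_le] at ht
    exact Real.cos_nonneg_of_neg_pi_div_two_le_of_le (by linarith [ht.1]) (by linarith [ht.2])
  rw [abs_of_nonneg h0]
  have h2 : 1 / 20 * t ^ 2 ≤ 2 / Real.pi ^ 2 * (t / 2) ^ 2 := by
    have : 2 / Real.pi ^ 2 * (t / 2) ^ 2 = 1 / (2 * Real.pi ^ 2) * t ^ 2 := by field_simp
    rw [this]
    refine mul_le_mul_of_nonneg_right ?_ (sq_nonneg t)
    rw [div_le_div_iff₀ (by norm_num) (by positivity)]
    nlinarith [Real.pi_lt_d2]
  have := Real.add_one_le_exp (-(1 / 20) * t ^ 2)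
  linarith

theorem abs_cos_half_sub_exp_le {t : ℝ} (ht : |t| ≤ Real.pi) :
    |Real.cos (t / 2) - Real.exp (-(1 / 8) * t ^ 2)| ≤ |t| ^ 3 := by
  have h1 := norm_exp_mul_I_sub_taylor_le (t / 2)
  have h2 : |Real.cos (t / 2) - (1 - (t / 2) ^ 2 / 2)| ≤ 5 * |t / 2| ^ 3 := by
    refine le_trans ?_ h1
    refine le_trans (le_of_eq ?_) (Complex.abs_re_le_norm _)
    congr 1
    have e : (1 + ((t / 2 : ℝ) : ℂ) * Complex.I - ((t / 2 : ℝ) : ℂ) ^ 2 / 2)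
        = ((1 - (t / 2) ^ 2 / 2 : ℝ) : ℂ) + ((t / 2 : ℝ) : ℂ) * Complex.I := by push_cast; ring
    rw [e, Complex.sub_re, Complex.exp_ofReal_mul_I_re, Complex.add_re, Complex.ofReal_re,
      Complex.re_ofReal_mul, Complex.I_re]
    ring
  have h3 := abs_exp_neg_sub_le (y := (t / 2) ^ 2 / 2) (by positivity)
  have e4 : -((t / 2) ^ 2 / 2) = -(1 / 8) * t ^ 2 := by ring
  rw [e4] at h3
  have h5 : ((t / 2) ^ 2 / 2) ^ 2 ≤ |t| ^ 3 / 16 := by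
    have : ((t / 2) ^ 2 / 2) ^ 2 = |t| ^ 3 * |t| / 64 := by
      have : t ^ 2 = |t| ^ 2 := (sq_abs t).symm
      rw [div_pow t, this]; ring
    rw [this]
    have := Real.pi_le_four
    have h6 := pow_nonneg (abs_nonneg t) 3
    nlinarith
  rw [abs_div, abs_two, div_pow |t|] at h2
  have h7 := abs_sub_le (Real.cos (t / 2)) (1 - (t / 2) ^ 2 / 2) (Real.exp (-(1 / 8) * t ^ 2))
  rw [abs_sub_comm (1 - (t / 2) ^ 2 / 2)] at h7
  have h6 := pow_nonneg (abs_nonneg t) 3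
  linarith

/-! ### Local limit theorem in total variation -/

theorem abs_exp_neg_sub_exp_neg_le {a b k : ℝ} (ha : k ≤ a) (hb : k ≤ b) :
    |Real.exp (-a) - Real.exp (-b)| ≤ |a - b| * Real.exp (-k) := by
  wlog hab : a ≤ b generalizing a b
  · rw [abs_sub_comm, abs_sub_comm a]; exact this hb ha (not_le.1 hab).le
  have h1 : Real.exp (-b) = Real.exp (-a) * Real.exp (-(b - a)) := by
    rw [← Real.exp_add]; ring_nf
  have h2 := Real.add_one_le_exp (-(b - a))
  have h3 : Real.exp (-a) ≤ Real.exp (-k) := Real.exp_le_exp.2 (by linarith)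
  have h4 := Real.exp_pos (-a)
  rw [abs_of_nonneg (by rw [sub_nonneg]; exact Real.exp_le_exp.2 (by linarith)),
    abs_of_nonpos (by linarith), h1]
  nlinarith

theorem cube_mul_exp_le {k : ℝ} (hk : 0 < k) (t : ℝ) :
    |t| ^ 3 * Real.exp (-(k / 2) * t ^ 2) ≤ 4 / k * (|t| * Real.exp (-(k / 4) * t ^ 2)) := by
  have h1 := Real.add_one_le_exp (k / 4 * t ^ 2)
  have e1 : Real.exp (-(k / 4) * t ^ 2)
      = Real.exp (-(k / 2) * t ^ 2) * Real.exp (k / 4 * t ^ 2) := by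
    rw [← Real.exp_add]; ring_nf
  have h2 : t ^ 2 ≤ 4 / k * Real.exp (k / 4 * t ^ 2) := by
    rw [div_mul_eq_mul_div, le_div_iff₀ hk]; linarith
  rw [e1]
  have e2 : |t| ^ 3 = |t| * t ^ 2 := by rw [← sq_abs t]; ring
  rw [e2]
  calc |t| * t ^ 2 * Real.exp (-(k / 2) * t ^ 2)
      ≤ |t| * (4 / k * Real.exp (k / 4 * t ^ 2)) * Real.exp (-(k / 2) * t ^ 2) := by gcongr
    _ = _ := by ring

/-- Decay of the characteristic function of a unimodal law with variance at least `γ`. Here and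
below `K` is any number above the numerical constant `10 ^ 20`. -/
theorem norm_charZ_le_of_unimodal {ν : Measure ℤ} {B γ G K : ℝ} (h : FourthMomentLE ν B)
    (hu : Unimodal ν) (hγ : 0 < γ) (hv : γ ≤ var ν) (hG : (1 + B) * (1 + 1 / γ) ≤ G)
    (hK : 10 ^ 20 ≤ K) {t : ℝ} (ht : |t| ≤ Real.pi) :
    ‖charZ ν t‖ ≤ Real.exp (-(1 / (K * G ^ 12)) * t ^ 2) := by
  have := h.prob
  have hB := h.B_nonneg
  obtain ⟨η, y, h1, h2, h3⟩ := exists_adjacent_atoms h hu hγ hv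
  have hβg : 0 < (1 + B) * (1 + 1 / γ) := by positivity
  set b := (1 + B) * (1 + 1 / γ)
  have hη : 0 < η := by
    by_contra hcon
    have : 10 ^ 18 * b ^ 12 * η ≤ 0 :=
      mul_nonpos_of_nonneg_of_nonpos (by positivity) (not_lt.1 hcon)
    linarith
  refine (norm_charZ_le_exp ν h1 h2 hη.le ht).trans (Real.exp_le_exp.2 ?_)
  refine mul_le_mul_of_nonneg_right (neg_le_neg ?_) (sq_nonneg t)
  have hG0 : 0 < G := hβg.trans_le hG
  have hK0 : 0 < K := lt_of_lt_of_le (by norm_num) hK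
  rw [div_le_div_iff₀ (by positivity) (by positivity), one_mul]
  have hp : Real.pi ^ 2 ≤ 10 := by nlinarith [Real.pi_lt_d2, Real.pi_pos]
  have h4 : b ^ 12 * η ≤ G ^ 12 * η := by gcongr
  have h5 : 10 ^ 20 * (G ^ 12 * η) ≤ K * (G ^ 12 * η) := by gcongr
  have h6 : 0 < G ^ 12 * η := by positivity
  linarith

/-- The characteristic function of a sum of independent variables against the Gaussian one with the
same mean and variance. -/
theorem norm_charZ_indepSum_sub_gaussian_le {m : ℕ} (ν : Fin m → Measure ℤ) {B κ : ℝ}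
    (hν : ∀ i, FourthMomentLE (ν i) B) {t : ℝ} (ht : |t| ≤ Real.pi)
    (hdecay : ∀ i, ‖charZ (ν i) t‖ ≤ Real.exp (-κ * t ^ 2)) (hκ : ∀ i, κ ≤ var (ν i) / 2) :
    ‖charZ (indepSum ν) t - Complex.exp ((t * ∑ i, mean (ν i) : ℝ) * Complex.I)
        * (Real.exp (-((∑ i, var (ν i)) / 2) * t ^ 2) : ℝ)‖
      ≤ m * (6 * (1 + B) ^ 2 * |t| ^ 3) * Real.exp (-κ * t ^ 2) ^ (m - 1) := by
  have hprob : ∀ i, IsProbabilityMeasure (ν i) := fun i => (hν i).prob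
  set z : Fin m → ℂ := fun i =>
    Complex.exp ((-(t * mean (ν i)) : ℝ) * Complex.I) * charZ (ν i) t with hz
  set w : Fin m → ℂ := fun i => ((Real.exp (-(var (ν i) / 2) * t ^ 2) : ℝ) : ℂ) with hw
  have hzle : ∀ i, ‖z i‖ ≤ Real.exp (-κ * t ^ 2) := fun i => by
    rw [hz, norm_mul, Complex.norm_exp_ofReal_mul_I, one_mul]
    exact hdecay i
  have hwle : ∀ i, ‖w i‖ ≤ Real.exp (-κ * t ^ 2) := fun i => by
    rw [hw, Complex.norm_real, Real.norm_eq_abs, Real.abs_exp]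
    exact Real.exp_le_exp.2 (mul_le_mul_of_nonneg_right (neg_le_neg (hκ i)) (sq_nonneg t))
  have hprodw : ∏ i, w i = ((Real.exp (-((∑ i, var (ν i)) / 2) * t ^ 2) : ℝ) : ℂ) := by
    rw [hw, ← Complex.ofReal_prod, ← Real.exp_sum]
    congr 2
    rw [← Finset.sum_mul, Finset.sum_neg_distrib, Finset.sum_div]
  have hprodz : charZ (indepSum ν) t
      = Complex.exp ((t * ∑ i, mean (ν i) : ℝ) * Complex.I) * ∏ i, z i := by
    rw [charZ_indepSum, hz, Finset.prod_mul_distrib, ← Complex.exp_sum, ← mul_assoc,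
      ← Complex.exp_add]
    have : ((t * ∑ i, mean (ν i) : ℝ) : ℂ) * Complex.I
        + ∑ i, ((-(t * mean (ν i)) : ℝ) : ℂ) * Complex.I = 0 := by
      rw [← Finset.sum_mul, ← Complex.ofReal_sum, Finset.sum_neg_distrib, ← Finset.mul_sum]
      push_cast; ring
    rw [this, Complex.exp_zero, one_mul]
  rw [hprodz, ← hprodw, ← mul_sub, norm_mul, Complex.norm_exp_ofReal_mul_I, one_mul]
  exact norm_prod_sub_prod_le z w _ _ hzle hwle
    (fun i => norm_charZ_centred_sub_gaussian_le (hν i) ht) (Real.exp_pos _).le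

theorem norm_charZ_shiftedBinomial_sub_gaussian_le (N : ℕ) (c : ℤ) {t : ℝ}
    (ht : |t| ≤ Real.pi) :
    ‖charZ (shiftedBinomial N c) t - Complex.exp ((t * (c + N / 2) : ℝ) * Complex.I)
        * (Real.exp (-(N / 8) * t ^ 2) : ℝ)‖
      ≤ N * |t| ^ 3 * Real.exp (-(1 / 20) * t ^ 2) ^ (N - 1) := by
  rw [charZ_shiftedBinomial, ← mul_sub, norm_mul, Complex.norm_exp_ofReal_mul_I, one_mul]
  have h := norm_prod_sub_prod_le (fun _ : Fin N => ((Real.cos (t / 2) : ℝ) : ℂ))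
    (fun _ => ((Real.exp (-(1 / 8) * t ^ 2) : ℝ) : ℂ))
    (Real.exp (-(1 / 20) * t ^ 2)) (|t| ^ 3)
    (fun _ => by rw [Complex.norm_real, Real.norm_eq_abs]; exact abs_cos_half_le_exp ht)
    (fun _ => by
      rw [Complex.norm_real, Real.norm_eq_abs, Real.abs_exp]
      exact Real.exp_le_exp.2 (mul_le_mul_of_nonneg_right (by norm_num) (sq_nonneg t)))
    (fun _ => by
      rw [← Complex.ofReal_sub, Complex.norm_real, Real.norm_eq_abs]
      exact abs_cos_half_sub_exp_le ht) (Real.exp_pos _).le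
  rw [Finset.prod_const, Finset.prod_const, Finset.card_univ, Fintype.card_fin,
    ← Complex.ofReal_pow, ← Complex.ofReal_pow, ← Real.exp_nat_mul] at h
  have e : (N : ℝ) * (-(1 / 8) * t ^ 2) = -(N / 8) * t ^ 2 := by ring
  rwa [e] at h

theorem exp_neg_sq_pow_le {a k : ℝ} {n : ℕ} (h : k ≤ n * a) (t : ℝ) :
    Real.exp (-a * t ^ 2) ^ n ≤ Real.exp (-k * t ^ 2) := by
  rw [← Real.exp_nat_mul]
  refine Real.exp_le_exp.2 ?_
  have := mul_le_mul_of_nonneg_right h (sq_nonneg t)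
  linarith

theorem norm_exp_mul_I_sub_exp_mul_I_le (t a b : ℝ) :
    ‖Complex.exp ((t * a : ℝ) * Complex.I) - Complex.exp ((t * b : ℝ) * Complex.I)‖
      ≤ |a - b| * |t| := by
  have e : Complex.exp ((t * a : ℝ) * Complex.I) - Complex.exp ((t * b : ℝ) * Complex.I)
      = Complex.exp ((t * b : ℝ) * Complex.I)
        * (Complex.exp (Complex.I * ((t * (a - b) : ℝ) : ℂ)) - 1) := by
    rw [mul_sub, ← Complex.exp_add, mul_one]
    congr 2
    push_cast; ring
  rw [e, norm_mul, Complex.norm_exp_ofReal_mul_I, one_mul]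
  refine (Real.norm_exp_I_mul_ofReal_sub_one_le).trans ?_
  rw [Real.norm_eq_abs, abs_mul, mul_comm]

/-- Two Gaussian characteristic functions with nearly equal means and variances. -/
theorem norm_gaussian_sub_gaussian_le {t a b u v D k : ℝ} (ht : |t| ≤ Real.pi)
    (hab : |a - b| ≤ D) (huv : |u - v| ≤ D / 2) (hu : k ≤ u) (hv : k ≤ v) (hD : 0 ≤ D) :
    ‖Complex.exp ((t * a : ℝ) * Complex.I) * (Real.exp (-u * t ^ 2) : ℝ)
      - Complex.exp ((t * b : ℝ) * Complex.I) * (Real.exp (-v * t ^ 2) : ℝ)‖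
      ≤ 3 * D * (|t| * Real.exp (-k * t ^ 2)) := by
  have e : Complex.exp ((t * a : ℝ) * Complex.I) * (Real.exp (-u * t ^ 2) : ℝ)
      - Complex.exp ((t * b : ℝ) * Complex.I) * (Real.exp (-v * t ^ 2) : ℝ)
      = Complex.exp ((t * a : ℝ) * Complex.I)
          * ((Real.exp (-(u * t ^ 2)) - Real.exp (-(v * t ^ 2)) : ℝ) : ℂ)
        + (Complex.exp ((t * a : ℝ) * Complex.I) - Complex.exp ((t * b : ℝ) * Complex.I))
          * (Real.exp (-v * t ^ 2) : ℝ) := by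
    rw [neg_mul, neg_mul]; push_cast; ring
  rw [e]
  refine (norm_add_le _ _).trans ?_
  rw [norm_mul, norm_mul, Complex.norm_exp_ofReal_mul_I, one_mul, Complex.norm_real,
    Complex.norm_real, Real.norm_eq_abs, Real.norm_eq_abs, Real.abs_exp]
  have h1 := abs_exp_neg_sub_exp_neg_le (mul_le_mul_of_nonneg_right hu (sq_nonneg t))
    (mul_le_mul_of_nonneg_right hv (sq_nonneg t))
  have h2 : |u * t ^ 2 - v * t ^ 2| ≤ 2 * D * |t| := by
    rw [← sub_mul, abs_mul, abs_of_nonneg (sq_nonneg t), ← sq_abs t, sq, ← mul_assoc]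
    refine mul_le_mul_of_nonneg_right ?_ (abs_nonneg t)
    calc _ ≤ D / 2 * 4 := by gcongr; exact ht.trans Real.pi_le_four
      _ = _ := by ring
  have h3 : Real.exp (-v * t ^ 2) ≤ Real.exp (-k * t ^ 2) :=
    Real.exp_le_exp.2 (mul_le_mul_of_nonneg_right (neg_le_neg hv) (sq_nonneg t))
  simp only [← neg_mul] at h1 ⊢
  calc _ ≤ 2 * D * |t| * Real.exp (-k * t ^ 2) + D * |t| * Real.exp (-k * t ^ 2) := by
        refine add_le_add (h1.trans (mul_le_mul_of_nonneg_right h2 (Real.exp_pos _).le)) ?_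
        refine mul_le_mul ?_ h3 (Real.exp_pos _).le (by positivity)
        exact (norm_exp_mul_I_sub_exp_mul_I_le t a b).trans
          (mul_le_mul_of_nonneg_right hab (abs_nonneg t))
    _ = _ := by ring

/-- The characteristic functions of a sum of `m` independent unimodal variables and of a shifted
binomial variable with approximately the same mean and variance are close. -/
theorem norm_charZ_sub_binomial_le {m : ℕ} (ν : Fin m → Measure ℤ) {B γ D K : ℝ}
    (hν : ∀ i, FourthMomentLE (ν i) B) (hu : ∀ i, Unimodal (ν i)) (hγ : 0 < γ)
    (hv : ∀ i, γ ≤ var (ν i)) (hD : 1 ≤ D) (N : ℕ) (c : ℤ)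
    (hmean : |∑ i, mean (ν i) - (c + N / 2)| ≤ D) (hvar : |∑ i, var (ν i) - N / 4| ≤ D)
    (hm0 : 0 < m) {G : ℝ} (hG : G = (1 + B) * (1 + 1 / γ) * D) (hm : 4 * G ^ 2 ≤ m)
    (hK : 10 ^ 20 ≤ K) :
    ((N : ℝ) ≤ 5 * m * G ∧ 0 < N) ∧ ∀ t : ℝ, |t| ≤ Real.pi →
    ‖charZ (indepSum ν) t - charZ (shiftedBinomial N c) t‖ ≤
      (47 * K * G ^ 14) * (|t| * Real.exp (-(m / (K * G ^ 12) / 4) * t ^ 2)) := by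
  have hB : 0 ≤ B := (hν ⟨0, hm0⟩).B_nonneg
  have hg0 : 0 < 1 / γ := by positivity
  obtain ⟨β, hβ⟩ : ∃ β, β = 1 + B := ⟨_, rfl⟩
  obtain ⟨g, hg⟩ : ∃ g, g = 1 + 1 / γ := ⟨_, rfl⟩
  have hβ1 : 1 ≤ β := by linarith
  have hg1 : 1 ≤ g := by linarith
  rw [← hβ, ← hg] at hG
  have hβgG : β * g ≤ G := by
    rw [hG]; exact le_mul_of_one_le_right (by positivity) hD
  have hβG : β ≤ G := (le_mul_of_one_le_right (by positivity) hg1).trans hβgG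
  have hgG : g ≤ G := (le_mul_of_one_le_left (by positivity) hβ1).trans hβgG
  have hDG : D ≤ G := by
    rw [hG]
    exact le_mul_of_one_le_left (by positivity) (one_le_mul_of_one_le_of_one_le hβ1 hg1)
  have hG1 : 1 ≤ G := hβ1.trans hβG
  have hG0 : 0 < G := by linarith
  have hγG : 1 ≤ G * γ := by
    have : 1 ≤ g * γ := by rw [hg, add_mul, one_div_mul_cancel hγ.ne']; linarith
    exact this.trans (mul_le_mul_of_nonneg_right hgG hγ.le)
  have hmR : (1 : ℝ) ≤ m := by exact_mod_cast hm0
  have hK20 : 20 ≤ K := le_trans (by norm_num) hK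
  have hK0 : 0 < K := by linarith
  have hG12 : G ≤ G ^ 12 := le_self_pow₀ hG1 (by norm_num)
  have hκγ : 20 * (1 / (K * G ^ 12)) ≤ γ := by
    rw [mul_one_div, div_le_iff₀ (by positivity)]
    calc (20 : ℝ) = 20 * 1 := by ring
      _ ≤ K * (G * γ) := by gcongr
      _ ≤ K * (G ^ 12 * γ) := by gcongr
      _ = _ := by ring
  have hκ0 : 0 < 1 / (K * G ^ 12) := by positivity
  have hmκ1 : (4 / (m * (1 / (K * G ^ 12)))) * m = 4 * (K * G ^ 12) := by
    field_simp
  have eexp : (m : ℝ) / (K * G ^ 12) / 4 = m * (1 / (K * G ^ 12)) / 4 := by ring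
  have hdecay : ∀ i, ∀ t : ℝ, |t| ≤ Real.pi →
      ‖charZ (ν i) t‖ ≤ Real.exp (-(1 / (K * G ^ 12)) * t ^ 2) := fun i t ht =>
    norm_charZ_le_of_unimodal (hν i) (hu i) hγ (hv i) (by rwa [← hβ, ← hg]) hK ht
  rw [eexp]
  obtain ⟨κ, hκ⟩ : ∃ κ, κ = 1 / (K * G ^ 12) := ⟨_, rfl⟩
  rw [← hκ] at hκγ hκ0 hmκ1 hdecay ⊢
  have hsge : m * γ ≤ ∑ i, var (ν i) := by
    calc (m : ℝ) * γ = ∑ _i : Fin m, γ := by simp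
      _ ≤ _ := Finset.sum_le_sum fun i _ => hv i
  have hsle : ∑ i, var (ν i) ≤ m * β := by
    calc _ ≤ ∑ _i : Fin m, β := Finset.sum_le_sum fun i _ => by rw [hβ]; exact (hν i).var_le
      _ = (m : ℝ) * β := by simp
  have hmγ : 4 * G ≤ m * γ := by
    calc 4 * G ≤ 4 * G * (G * γ) := le_mul_of_one_le_right (by positivity) hγG
      _ = 4 * G ^ 2 * γ := by ring
      _ ≤ m * γ := mul_le_mul_of_nonneg_right hm hγ.le
  have hm4 : 4 * G ≤ m := by
    have : G ≤ G ^ 2 := le_self_pow₀ hG1 (by norm_num)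
    linarith
  have hvar' := abs_le.1 hvar
  have hNge : 3 * (m * γ) ≤ N := by linarith [hvar'.2]
  have hNle : (N : ℝ) ≤ 5 * m * G := by
    have h1 : (m : ℝ) * β ≤ m * G := by gcongr
    have h2 : 4 * G * 1 ≤ m * G := by
      rw [mul_one]
      exact mul_le_mul_of_nonneg_right (by linarith) hG0.le
    linarith [hvar'.1]
  have hNpos : 0 < N := by
    have : (0 : ℝ) < N := by linarith
    exact_mod_cast this
  refine ⟨⟨hNle, hNpos⟩, fun t ht => ?_⟩
  have hm2 : (2 : ℝ) ≤ m := by linarith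
  have hmκ : 20 * (m * κ) ≤ m * γ := by
    have := mul_le_mul_of_nonneg_left hκγ (by positivity : (0 : ℝ) ≤ m)
    linarith
  have hmκ0 : 0 < m * κ := by positivity
  have hd1 := norm_charZ_indepSum_sub_gaussian_le ν hν ht (fun i => hdecay i t ht)
    (fun i => by linarith [hv i])
  have hd2 := norm_charZ_shiftedBinomial_sub_gaussian_le N c ht
  have hd3 := norm_gaussian_sub_gaussian_le (t := t) (a := ∑ i, mean (ν i)) (b := c + N / 2)
    (u := (∑ i, var (ν i)) / 2) (v := N / 8) (D := D) (k := m * κ / 2) ht hmean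
    (by rw [abs_le]; constructor <;> linarith [hvar'.1, hvar'.2]) (by linarith) (by linarith)
    (by linarith)
  have hp1 : Real.exp (-κ * t ^ 2) ^ (m - 1) ≤ Real.exp (-(m * κ / 2) * t ^ 2) := by
    refine exp_neg_sq_pow_le ?_ t
    rw [Nat.cast_sub (by omega), Nat.cast_one, sub_mul, one_mul]
    have := mul_le_mul_of_nonneg_right hm2 hκ0.le
    linarith
  have hp2 : Real.exp (-(1 / 20) * t ^ 2) ^ (N - 1) ≤ Real.exp (-(m * κ / 2) * t ^ 2) := by
    refine exp_neg_sq_pow_le ?_ t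
    rw [Nat.cast_sub (by omega), Nat.cast_one]
    linarith
  have hcube := cube_mul_exp_le hmκ0 t
  have hEE : Real.exp (-(m * κ / 2) * t ^ 2) ≤ Real.exp (-(m * κ / 4) * t ^ 2) := by
    refine Real.exp_le_exp.2 ?_
    have : 0 ≤ m * κ * t ^ 2 := by positivity
    linarith
  have htE := mul_le_mul_of_nonneg_left hEE (abs_nonneg t)
  rw [← hβ] at hd1
  have hd1' := hd1.trans (mul_le_mul_of_nonneg_left hp1 (by positivity))
  have hd2' := hd2.trans (mul_le_mul_of_nonneg_left hp2 (by positivity))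
  have hd3' := hd3.trans (mul_le_mul_of_nonneg_left htE (by positivity))
  rw [norm_sub_rev] at hd2'
  have htri := (norm_add₃_le (a := _) (b := _) (c := _)).trans
    (add_le_add (add_le_add hd1' hd3') hd2')
  rw [sub_add_sub_cancel, sub_add_sub_cancel] at htri
  refine htri.trans ?_
  set F := |t| * Real.exp (-(m * κ / 4) * t ^ 2) with hF
  have hF0 : 0 ≤ F := by positivity
  have hG2 : β ^ 2 ≤ G ^ 2 := by gcongr
  have hGG2 : G ≤ G ^ 2 := le_self_pow₀ hG1 (by norm_num)
  have hG14 : G ≤ G ^ 14 := le_self_pow₀ hG1 (by norm_num)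
  have hcoef : m * (6 * β ^ 2) + N ≤ 11 * G ^ 2 * m := by
    have h1 : (m : ℝ) * (6 * β ^ 2) ≤ m * (6 * G ^ 2) := by gcongr
    have h2 : 5 * m * G ≤ 5 * m * G ^ 2 := by gcongr
    linarith
  calc _ = (m * (6 * β ^ 2) + N) * (|t| ^ 3 * Real.exp (-(m * κ / 2) * t ^ 2)) + 3 * D * F := by
        ring
    _ ≤ (11 * G ^ 2 * m) * (4 / (m * κ) * F) + 3 * (K * G ^ 14) * F := by
        have : D ≤ K * G ^ 14 := by
          calc D ≤ 1 * G ^ 14 := by linarith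
            _ ≤ K * G ^ 14 := by gcongr; linarith
        gcongr
    _ = 11 * G ^ 2 * (4 / (m * κ) * m) * F + 3 * (K * G ^ 14) * F := by ring
    _ = _ := by rw [hmκ1]; ring

/-- A sum of `m` independent unimodal variables with variances at least `γ` and fourth central
moments at most `B` is `ε`-close to a shifted binomial variable with approximately the same mean and
variance as soon as `m` exceeds a polynomial in `B`, `1 / γ` times `(1 + log (1 / ε)) / ε ^ 2`. -/
theorem tvDist_indepSum_binomial_le {m : ℕ} (ν : Fin m → Measure ℤ) {B γ D ε K : ℝ}
    (hν : ∀ i, FourthMomentLE (ν i) B) (hu : ∀ i, Unimodal (ν i)) (hγ : 0 < γ)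
    (hv : ∀ i, γ ≤ var (ν i)) (hD : 1 ≤ D) (N : ℕ) (c : ℤ)
    (hmean : |∑ i, mean (ν i) - (c + N / 2)| ≤ D) (hvar : |∑ i, var (ν i) - N / 4| ≤ D)
    (hε0 : 0 < ε) (hε1 : ε < 1) (hB : 0 ≤ B) (hK : 10 ^ 20 ≤ K)
    (hm : 10 ^ 6 * K ^ 4 * ((1 + B) * (1 + 1 / γ) * D) ^ 53 * (1 + Real.log (1 / ε)) / ε ^ 2 ≤ m) :
    tvDist (indepSum ν) (shiftedBinomial N c) ≤ ε := by
  have hprob : ∀ i, IsProbabilityMeasure (ν i) := fun i => (hν i).prob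
  obtain ⟨G, hG⟩ : ∃ G, G = (1 + B) * (1 + 1 / γ) * D := ⟨_, rfl⟩
  rw [← hG] at hm
  set ℓ := 1 + Real.log (1 / ε) with hℓ
  have hg0 : 0 < 1 / γ := by positivity
  have hG1 : 1 ≤ G := by
    rw [hG]
    exact one_le_mul_of_one_le_of_one_le
      (one_le_mul_of_one_le_of_one_le (by linarith) (by linarith)) hD
  have hK1 : 1 ≤ K := le_trans (by norm_num) hK
  have hK0 : 0 < K := by linarith
  have hlog : 0 ≤ Real.log (1 / ε) := Real.log_nonneg (by rw [le_div_iff₀ hε0]; linarith)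
  have hℓ1 : 1 ≤ ℓ := by linarith
  have hε2 : ε ^ 2 ≤ 1 := pow_le_one₀ hε0.le hε1.le
  have hmbig : 10 ^ 6 * K ^ 4 * G ^ 53 * ℓ ≤ m * ε ^ 2 := by rwa [div_le_iff₀ (by positivity)] at hm
  have hmbig' : 10 ^ 6 * K ^ 4 * G ^ 53 * ℓ ≤ m :=
    hmbig.trans (mul_le_of_le_one_right (by positivity) hε2)
  have hG53 : G ^ 2 ≤ G ^ 53 := pow_le_pow_right₀ hG1 (by norm_num)
  have hG0 : 0 < G := by linarith
  have hGm : 10 ^ 6 * K ^ 4 * G ^ 53 ≤ m := by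
    have : 10 ^ 6 * K ^ 4 * G ^ 53 * 1 ≤ 10 ^ 6 * K ^ 4 * G ^ 53 * ℓ := by gcongr
    linarith
  have hm4 : 4 * G ^ 2 ≤ m := by
    have h1 : 1 * G ^ 53 ≤ K ^ 4 * G ^ 53 := by
      gcongr
      exact one_le_pow₀ hK1
    have h2 := pow_pos hG0 53
    linarith
  have hmpos : (0 : ℝ) < m := lt_of_lt_of_le (by positivity) hm4
  have hm0 : 0 < m := by exact_mod_cast hmpos
  have hm1 : (1 : ℝ) ≤ m := by exact_mod_cast hm0
  obtain ⟨⟨hNle, hNpos⟩, key⟩ :=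
    norm_charZ_sub_binomial_le ν hν hu hγ hv hD N c hmean hvar hm0 hG hm4 hK
  set a : ℝ := m / (K * G ^ 12) / 4 with ha
  have ha0 : 0 < a := by positivity
  -- inside the window the point masses are compared by Fourier inversion
  have hatom : ∀ x : ℤ, |(indepSum ν).real {x} - (shiftedBinomial N c).real {x}|
      ≤ 32 * K ^ 2 * G ^ 26 / m := by
    intro x
    have h := abs_sub_le_integral_charZ (indepSum ν) (shiftedBinomial N c) x
      (fun t => (47 * K * G ^ 14) * (|t| * Real.exp (-a * t ^ 2)))
      (Continuous.intervalIntegrable (by fun_prop) _ _) fun t ht => key t ht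
    rw [intervalIntegral.integral_const_mul] at h
    have h2 := integral_abs_mul_exp_neg_sq_le ha0 Real.pi Real.pi_pos.le
    have h3 : 2 * Real.pi * |(indepSum ν).real {x} - (shiftedBinomial N c).real {x}|
        ≤ 6 * (32 * K ^ 2 * G ^ 26 / m) := by
      refine h.trans ((mul_le_mul_of_nonneg_left h2 (by positivity)).trans ?_)
      rw [ha]
      have : 47 * K * G ^ 14 * (1 / ((m : ℝ) / (K * G ^ 12) / 4))
          = 188 * K ^ 2 * G ^ 26 / m := by field_simp; ring
      rw [this, mul_div_assoc']
      refine div_le_div_of_nonneg_right ?_ hmpos.le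
      have : 0 ≤ K ^ 2 * G ^ 26 := by positivity
      linarith
    have h4 := abs_nonneg ((indepSum ν).real {x} - (shiftedBinomial N c).real {x})
    nlinarith [Real.pi_gt_three]
  -- outside a window of radius `y` the binomial law has mass at most `ε / 2`, by Hoeffding
  set y := Real.sqrt (2 * N * ℓ) with hy
  have hN0 : (0 : ℝ) < N := by exact_mod_cast hNpos
  have hysq : y ^ 2 = 2 * N * ℓ := Real.sq_sqrt (by positivity)
  have hy0 : 0 ≤ y := Real.sqrt_nonneg _
  set W : Finset ℤ := Finset.Icc ⌈(c + N / 2 : ℝ) - y⌉ ⌊(c + N / 2 : ℝ) + y⌋ with hW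
  set r := Real.sqrt (m * G * ℓ) with hr
  have hr0 : 0 ≤ r := Real.sqrt_nonneg _
  have hrsq : r ^ 2 = m * G * ℓ := Real.sq_sqrt (by positivity)
  have hr1 : 1 ≤ r := by
    rw [hr, Real.one_le_sqrt]
    exact one_le_mul_of_one_le_of_one_le (one_le_mul_of_one_le_of_one_le hm1 hG1) hℓ1
  have hyr : y ≤ 7 / 2 * r := by
    refine abs_le_of_sq_le_sq' ?_ (by positivity) |>.2
    rw [hysq, mul_pow, hrsq]
    have : (N : ℝ) * ℓ ≤ 5 * m * G * ℓ := by gcongr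
    have h0 : 0 ≤ m * G * ℓ := by positivity
    nlinarith
  have hcard : (W.card : ℝ) ≤ 8 * r := by
    rw [hW, Int.card_Icc]
    have h1 := Int.floor_le ((c + N / 2 : ℝ) + y)
    have h2 := Int.le_ceil ((c + N / 2 : ℝ) - y)
    have h3 : ((⌊(c + N / 2 : ℝ) + y⌋ + 1 - ⌈(c + N / 2 : ℝ) - y⌉).toNat : ℝ)
        = ((⌊(c + N / 2 : ℝ) + y⌋ + 1 - ⌈(c + N / 2 : ℝ) - y⌉).toNat : ℤ) := by norm_cast
    rw [h3, Int.toNat_eq_max]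
    push_cast
    refine max_le ?_ ?_ <;> linarith
  have htail : (shiftedBinomial N c).real (W : Set ℤ)ᶜ ≤ ε / 2 := by
    have hsub : (shiftedBinomial N c).real (W : Set ℤ)ᶜ
        ≤ (shiftedBinomial N c).real {x : ℤ | y ≤ |(x : ℝ) - (c + N / 2)|} := by
      refine measureReal_mono fun x hx => ?_
      rw [Set.mem_ofPred_eq]
      by_contra hcon
      push Not at hcon
      rw [abs_lt] at hcon
      apply hx
      rw [hW, Finset.mem_coe, Finset.mem_Icc, Int.ceil_le, Int.le_floor]
      constructor <;> linarith [hcon.1, hcon.2]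
    refine hsub.trans ((shiftedBinomial_tail_le hNpos c hy0).trans ?_)
    have e1 : -(2 * y ^ 2 / N) = -(3 * ℓ) + -ℓ := by rw [hysq]; field_simp; ring
    have h1 : Real.exp (-(3 * ℓ)) ≤ 1 / 4 := by
      rw [Real.exp_neg, inv_eq_one_div]
      have := Real.add_one_le_exp (3 * ℓ)
      exact one_div_le_one_div_of_le (by norm_num) (by linarith)
    have h2 : Real.exp (-ℓ) ≤ ε := by
      have : Real.exp (-ℓ) ≤ Real.exp (Real.log ε) := by
        refine Real.exp_le_exp.2 ?_
        rw [hℓ, one_div, Real.log_inv]; linarith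
      rwa [Real.exp_log hε0] at this
    rw [e1, Real.exp_add]
    have h3 := Real.exp_pos (-(3 * ℓ))
    nlinarith [mul_le_mul h1 h2 (Real.exp_pos (-ℓ)).le (by norm_num)]
  have hwin : ∑ x ∈ W, |(indepSum ν).real {x} - (shiftedBinomial N c).real {x}| ≤ ε / 2 := by
    calc _ ≤ ∑ _x ∈ W, 32 * K ^ 2 * G ^ 26 / m := Finset.sum_le_sum fun x _ => hatom x
      _ = W.card * (32 * K ^ 2 * G ^ 26 / m) := by simp
      _ ≤ 8 * r * (32 * K ^ 2 * G ^ 26 / m) := by gcongr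
      _ = 256 * K ^ 2 * G ^ 26 * r / m := by ring
      _ ≤ ε / 2 := by
          rw [div_le_iff₀ hmpos]
          refine abs_le_of_sq_le_sq' ?_ (by positivity) |>.2
          have e1 : (256 * K ^ 2 * G ^ 26 * r) ^ 2
              = 65536 * (m * (K ^ 4 * G ^ 53 * ℓ)) := by
            rw [mul_pow, hrsq]; ring
          have e2 : (ε / 2 * m) ^ 2 = 1 / 4 * (m * (m * ε ^ 2)) := by ring
          rw [e1, e2]
          have h1 : 10 ^ 6 * ((m : ℝ) * (K ^ 4 * G ^ 53 * ℓ)) ≤ m * (m * ε ^ 2) := by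
            have := mul_le_mul_of_nonneg_left hmbig hmpos.le
            linarith
          have h2 : 0 ≤ (m : ℝ) * (K ^ 4 * G ^ 53 * ℓ) := by positivity
          linarith
  have := tvDist_le_window (indepSum ν) (shiftedBinomial N c) W
  linarith

/-! ### Hellinger affinity -/

/-- The Hellinger affinity (Bhattacharyya coefficient) `∑ x, √(μ x * ν x)` of two distributions on a
countable type. -/
def affinity {α : Type*} [MeasurableSpace α] (μ ν : Measure α) : ℝ :=
  ∑' x : α, √(μ.real {x}) * √(ν.real {x})

theorem tsum_mul_sq_le {α : Type*} {f g : α → ℝ} (hf : Summable fun x => f x ^ 2)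
    (hg : Summable fun x => g x ^ 2) (hf0 : ∀ x, 0 ≤ f x) (hg0 : ∀ x, 0 ≤ g x) :
    Summable (fun x => f x * g x) ∧
      ∑' x, f x * g x ≤ √(∑' x, f x ^ 2) * √(∑' x, g x ^ 2) := by
  have h := Real.summable_and_inner_le_Lp_mul_Lq_tsum_of_nonneg (p := 2) (q := 2)
    Real.HolderConjugate.two_two hf0 hg0 (by simpa using hf) (by simpa using hg)
  simpa [Real.sqrt_eq_rpow] using h

section Countable

variable {α : Type*} [MeasurableSpace α] [Countable α] [MeasurableSingletonClass α]

theorem hasSum_real_subtype (μ : Measure α) [IsFiniteMeasure μ] (s : Set α) :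
    HasSum (fun x : s => μ.real {(x : α)}) (μ.real s) := by
  have h : μ s = ∑' x : s, μ {(x : α)} := by
    conv_lhs => rw [← Set.biUnion_of_singleton s]
    exact measure_biUnion s.to_countable (fun x _ y _ hxy => by simpa using hxy)
      fun x _ => measurableSet_singleton x
  have h2 : μ.real s = ∑' x : s, μ.real {(x : α)} := by
    rw [Measure.real, h, ENNReal.tsum_toReal_eq fun x => measure_ne_top _ _]; rfl
  rw [h2]
  refine Summable.hasSum (ENNReal.summable_toReal ?_)
  rw [← h]; exact measure_ne_top _ _

theorem hasSum_real_univ (μ : Measure α) [IsProbabilityMeasure μ] :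
    HasSum (fun x : α => μ.real {x}) 1 := by
  have h := hasSum_real_subtype μ Set.univ
  rw [probReal_univ] at h
  exact (Equiv.Set.univ α).hasSum_iff (f := fun x : α => μ.real {x}) |>.1 h

theorem summable_affinity (μ ν : Measure α) [IsProbabilityMeasure μ] [IsProbabilityMeasure ν] :
    Summable fun x : α => √(μ.real {x}) * √(ν.real {x}) :=
  (tsum_mul_sq_le (by simpa [Real.sq_sqrt] using (hasSum_real_univ μ).summable)
    (by simpa [Real.sq_sqrt] using (hasSum_real_univ ν).summable)
    (fun _ => Real.sqrt_nonneg _) fun _ => Real.sqrt_nonneg _).1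

theorem affinity_self (μ : Measure α) [IsProbabilityMeasure μ] : affinity μ μ = 1 := by
  simp only [affinity, Real.mul_self_sqrt measureReal_nonneg]
  exact (hasSum_real_univ μ).tsum_eq

/-- Twice the squared Hellinger distance. -/
theorem hasSum_sqrt_sub_sq (μ ν : Measure α) [IsProbabilityMeasure μ] [IsProbabilityMeasure ν] :
    HasSum (fun x : α => (√(μ.real {x}) - √(ν.real {x})) ^ 2) (2 * (1 - affinity μ ν)) := by
  have h := ((hasSum_real_univ μ).add (hasSum_real_univ ν)).sub
    ((summable_affinity μ ν).hasSum.mul_left 2)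
  have e : (1 : ℝ) + 1 - 2 * ∑' x : α, √(μ.real {x}) * √(ν.real {x}) = 2 * (1 - affinity μ ν) := by
    rw [affinity]; ring
  rw [e] at h
  have e2 : (fun x : α => (√(μ.real {x}) - √(ν.real {x})) ^ 2)
      = fun x => μ.real {x} + ν.real {x} - 2 * (√(μ.real {x}) * √(ν.real {x})) := by
    funext x
    rw [sub_sq, Real.sq_sqrt measureReal_nonneg, Real.sq_sqrt measureReal_nonneg]; ring
  rw [e2]; exact h

theorem affinity_le_one (μ ν : Measure α) [IsProbabilityMeasure μ] [IsProbabilityMeasure ν] :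
    affinity μ ν ≤ 1 := by
  have := (hasSum_sqrt_sub_sq μ ν).nonneg fun x => sq_nonneg _
  linarith

/-- Triangle inequality for the Hellinger distance, squared. -/
theorem one_sub_affinity_triangle (μ ν ρ : Measure α) [IsProbabilityMeasure μ]
    [IsProbabilityMeasure ν] [IsProbabilityMeasure ρ] :
    1 - affinity μ ρ ≤ 2 * (1 - affinity μ ν) + 2 * (1 - affinity ν ρ) := by
  have h := hasSum_le (fun x => ?_) (hasSum_sqrt_sub_sq μ ρ)
    (((hasSum_sqrt_sub_sq μ ν).add (hasSum_sqrt_sub_sq ν ρ)).mul_left 2)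
  · linarith
  · nlinarith [sq_nonneg ((√(μ.real {x}) - √(ν.real {x})) - (√(ν.real {x}) - √(ρ.real {x})))]

/-- Differences of expectations are controlled by the Hellinger distance and second moments. -/
theorem tsum_mul_abs_sub_sq_le (μ ν : Measure α) [IsProbabilityMeasure μ] [IsProbabilityMeasure ν]
    {f : α → ℝ} (hf0 : ∀ x, 0 ≤ f x) {a b : ℝ} (ha : HasSum (fun x => f x ^ 2 * μ.real {x}) a)
    (hb : HasSum (fun x => f x ^ 2 * ν.real {x}) b) :
    Summable (fun x => f x * |μ.real {x} - ν.real {x}|) ∧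
    (∑' x, f x * |μ.real {x} - ν.real {x}|) ^ 2 ≤ 4 * (1 - affinity μ ν) * (a + b) := by
  have h1 := hasSum_sqrt_sub_sq μ ν
  have hle : ∀ x, (f x * (√(μ.real {x}) + √(ν.real {x}))) ^ 2
      ≤ 2 * (f x ^ 2 * μ.real {x} + f x ^ 2 * ν.real {x}) := by
    intro x
    have e1 := Real.sq_sqrt (measureReal_nonneg (μ := μ) (s := {x}))
    have e2 := Real.sq_sqrt (measureReal_nonneg (μ := ν) (s := {x}))
    have : (√(μ.real {x}) + √(ν.real {x})) ^ 2 ≤ 2 * (μ.real {x} + ν.real {x}) := by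
      nlinarith [sq_nonneg (√(μ.real {x}) - √(ν.real {x}))]
    rw [mul_pow]
    nlinarith [sq_nonneg (f x)]
  have hs2 : Summable fun x => (f x * (√(μ.real {x}) + √(ν.real {x}))) ^ 2 :=
    Summable.of_nonneg_of_le (fun _ => sq_nonneg _) hle ((ha.add hb).mul_left 2).summable
  have habs : (fun x => |√(μ.real {x}) - √(ν.real {x})| ^ 2)
      = fun x => (√(μ.real {x}) - √(ν.real {x})) ^ 2 := by funext x; rw [sq_abs]
  obtain ⟨h3, h4⟩ := tsum_mul_sq_le (f := fun x => |√(μ.real {x}) - √(ν.real {x})|)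
    (g := fun x => f x * (√(μ.real {x}) + √(ν.real {x})))
    (by rw [habs]; exact h1.summable) hs2 (fun _ => abs_nonneg _)
    (fun x => mul_nonneg (hf0 x) (by positivity))
  have e : (fun x => |√(μ.real {x}) - √(ν.real {x})| * (f x * (√(μ.real {x}) + √(ν.real {x}))))
      = fun x => f x * |μ.real {x} - ν.real {x}| := by
    funext x
    have e1 := Real.mul_self_sqrt (measureReal_nonneg (μ := μ) (s := {x}))
    have e2 := Real.mul_self_sqrt (measureReal_nonneg (μ := ν) (s := {x}))
    have : μ.real {x} - ν.real {x}
        = (√(μ.real {x}) - √(ν.real {x})) * (√(μ.real {x}) + √(ν.real {x})) := by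
      linear_combination e2 - e1
    rw [this, abs_mul, abs_of_nonneg (by positivity : 0 ≤ √(μ.real {x}) + √(ν.real {x}))]
    ring
  rw [e] at h3 h4
  refine ⟨h3, ?_⟩
  rw [habs, h1.tsum_eq] at h4
  have h5 : ∑' x, (f x * (√(μ.real {x}) + √(ν.real {x}))) ^ 2 ≤ 2 * (a + b) := by
    rw [← ((ha.add hb).mul_left 2).tsum_eq]
    exact hs2.tsum_le_tsum hle ((ha.add hb).mul_left 2).summable
  have h6 : 0 ≤ 1 - affinity μ ν := by linarith [affinity_le_one μ ν]
  have h7 : 0 ≤ ∑' x, f x * |μ.real {x} - ν.real {x}| :=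
    tsum_nonneg fun x => mul_nonneg (hf0 x) (abs_nonneg _)
  have h8 : 0 ≤ ∑' x, (f x * (√(μ.real {x}) + √(ν.real {x}))) ^ 2 := tsum_nonneg fun _ => sq_nonneg _
  calc _ ≤ (√(2 * (1 - affinity μ ν)) * √(∑' x, (f x * (√(μ.real {x}) + √(ν.real {x}))) ^ 2)) ^ 2 := by
        gcongr
    _ = 2 * (1 - affinity μ ν) * ∑' x, (f x * (√(μ.real {x}) + √(ν.real {x}))) ^ 2 := by
        rw [mul_pow, Real.sq_sqrt (by positivity), Real.sq_sqrt h8]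
    _ ≤ 2 * (1 - affinity μ ν) * (2 * (a + b)) := by gcongr
    _ = _ := by ring

/-- Data processing: the affinity does not decrease under a map. -/
theorem affinity_le_affinity_map {β : Type*} [MeasurableSpace β] [Countable β]
    [MeasurableSingletonClass β] (μ ν : Measure α) [IsProbabilityMeasure μ]
    [IsProbabilityMeasure ν] {f : α → β} (hf : Measurable f) :
    affinity μ ν ≤ affinity (μ.map f) (ν.map f) := by
  have := Measure.isProbabilityMeasure_map (μ := μ) hf.aemeasurable
  have := Measure.isProbabilityMeasure_map (μ := ν) hf.aemeasurable
  refine hasSum_le (fun y => ?_) ((summable_affinity μ ν).hasSum.tsum_fiberwise f)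
    (summable_affinity (μ.map f) (ν.map f)).hasSum
  have h1 := hasSum_real_subtype μ (f ⁻¹' {y})
  have h2 := hasSum_real_subtype ν (f ⁻¹' {y})
  have h := (tsum_mul_sq_le (f := fun x : f ⁻¹' {y} => √(μ.real {(x : α)}))
    (g := fun x : f ⁻¹' {y} => √(ν.real {(x : α)})) (by simpa [Real.sq_sqrt] using h1.summable)
    (by simpa [Real.sq_sqrt] using h2.summable) (fun _ => Real.sqrt_nonneg _)
    fun _ => Real.sqrt_nonneg _).2
  simp only [Real.sq_sqrt measureReal_nonneg] at h
  rw [h1.tsum_eq, h2.tsum_eq] at h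
  rwa [map_measureReal_apply hf (measurableSet_singleton y),
    map_measureReal_apply hf (measurableSet_singleton y)]

theorem affinity_prod {β : Type*} [MeasurableSpace β] [Countable β] [MeasurableSingletonClass β]
    (μ ν : Measure α) (μ' ν' : Measure β) [IsProbabilityMeasure μ] [IsProbabilityMeasure ν]
    [IsProbabilityMeasure μ'] [IsProbabilityMeasure ν'] :
    affinity (μ.prod μ') (ν.prod ν') = affinity μ ν * affinity μ' ν' := by
  unfold affinity
  have e : (fun z : α × β => √((μ.prod μ').real {z}) * √((ν.prod ν').real {z}))
      = fun z => (√(μ.real {z.1}) * √(ν.real {z.1})) * (√(μ'.real {z.2}) * √(ν'.real {z.2})) := by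
    funext z
    have : ({z} : Set (α × β)) = {z.1} ×ˢ {z.2} := by
      rw [Set.singleton_prod_singleton]
    rw [this, measureReal_prod_prod, measureReal_prod_prod, Real.sqrt_mul measureReal_nonneg,
      Real.sqrt_mul measureReal_nonneg]
    ring
  rw [e]
  refine ((summable_affinity μ ν).tsum_mul_tsum (summable_affinity μ' ν') ?_).symm
  exact (summable_affinity μ ν).mul_of_nonneg (summable_affinity μ' ν') (fun _ => by positivity)
    fun _ => by positivity

end Countable

theorem tvDist_sq_le (μ ν : Measure ℤ) [IsProbabilityMeasure μ] [IsProbabilityMeasure ν] :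
    tvDist μ ν ^ 2 ≤ 2 * (1 - affinity μ ν) := by
  have h := (tsum_mul_abs_sub_sq_le μ ν (f := fun _ => 1) (fun _ => zero_le_one) (a := 1) (b := 1)
    (by simpa using hasSum_real_univ μ) (by simpa using hasSum_real_univ ν)).2
  simp only [one_mul] at h
  rw [tvDist, mul_pow]
  linarith

theorem indepSum_succ {n : ℕ} (ν : Fin (n + 1) → Measure ℤ) [∀ i, IsProbabilityMeasure (ν i)] :
    indepSum ν = ((ν 0).prod (indepSum fun i => ν i.succ)).map (fun p : ℤ × ℤ => p.1 + p.2) := by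
  have h := (measurePreserving_piFinSuccAbove ν 0).symm.map_eq
  unfold indepSum
  rw [← h, Measure.map_map (measurable_of_countable _) (measurable_of_countable _)]
  have h2 : (ν 0).prod ((Measure.pi fun i : Fin n => ν i.succ).map fun x => ∑ i, x i)
      = ((ν 0).prod (Measure.pi fun i : Fin n => ν i.succ)).map
        (Prod.map id fun x : Fin n → ℤ => ∑ i, x i) := by
    rw [← Measure.map_prod_map _ _ measurable_id (measurable_of_countable _), Measure.map_id]
  rw [h2, Measure.map_map (measurable_of_countable _) (measurable_of_countable _)]
  congr 1
  funext p
  simp [Fin.sum_univ_succ, MeasurableEquiv.piFinSuccAbove]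

/-- The squared Hellinger distance is subadditive under independent sums. -/
theorem one_sub_affinity_indepSum_le {m : ℕ} (μ ν : Fin m → Measure ℤ)
    [∀ i, IsProbabilityMeasure (μ i)] [∀ i, IsProbabilityMeasure (ν i)] :
    1 - affinity (indepSum μ) (indepSum ν) ≤ ∑ i, (1 - affinity (μ i) (ν i)) := by
  induction m with
  | zero =>
    have : μ = ν := Subsingleton.elim _ _
    subst this
    rw [affinity_self]; simp
  | succ n ih =>
    rw [Fin.sum_univ_succ, indepSum_succ μ, indepSum_succ ν]
    have h := affinity_le_affinity_map ((μ 0).prod (indepSum fun i => μ i.succ))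
      ((ν 0).prod (indepSum fun i => ν i.succ)) (f := fun p : ℤ × ℤ => p.1 + p.2)
      (measurable_of_countable _)
    rw [affinity_prod] at h
    have h1 := ih (fun i => μ i.succ) (fun i => ν i.succ)
    have h2 := affinity_le_one (μ 0) (ν 0)
    have h3 := affinity_le_one (indepSum fun i => μ i.succ) (indepSum fun i => ν i.succ)
    nlinarith

/-! ### Exponential families on the integers -/

section ExpFam

variable {k : ℕ} {T : ℤ → Param k}

/-- The unnormalized weights `exp (-(a · T x))` have a finite sum. -/
def Admissible (T : ℤ → Param k) (a : Param k) : Prop :=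
  Summable fun x : ℤ => Real.exp (-inner ℝ a (T x))

/-- The partition function `∑ x, exp (-(a · T x))`. -/
def partition (T : ℤ → Param k) (a : Param k) : ℝ := ∑' x : ℤ, Real.exp (-inner ℝ a (T x))

theorem Admissible.integrable {a : Param k} (h : Admissible T a) :
    Integrable (fun x : ℤ => Real.exp (-inner ℝ a (T x))) (Measure.count : Measure ℤ) :=
  integrable_count_iff.2 h.norm

theorem Admissible.integral_eq {a : Param k} (h : Admissible T a) :
    ∫ x : ℤ, Real.exp (-inner ℝ a (T x)) ∂(Measure.count : Measure ℤ) = partition T a := by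
  rw [integral_countable h.integrable, partition]
  exact tsum_congr fun x => by simp [Measure.real]

theorem Admissible.isProbabilityMeasure {a : Param k} (h : Admissible T a) :
    IsProbabilityMeasure (expFam T a) := isProbabilityMeasure_tilted h.integrable

theorem Admissible.partition_pos {a : Param k} (h : Admissible T a) : 0 < partition T a :=
  h.tsum_pos (fun _ => (Real.exp_pos _).le) 0 (Real.exp_pos _)

theorem Admissible.real_singleton {a : Param k} (h : Admissible T a) (x : ℤ) :
    (expFam T a).real {x} = Real.exp (-inner ℝ a (T x)) / partition T a := by
  rw [Measure.real, expFam, tilted_apply, lintegral_singleton, h.integral_eq,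
    Measure.count_singleton, mul_one,
    ENNReal.toReal_ofReal (div_nonneg (Real.exp_pos _).le h.partition_pos.le)]

theorem Admissible.real_singleton_pos {a : Param k} (h : Admissible T a) (x : ℤ) :
    0 < (expFam T a).real {x} := by
  rw [h.real_singleton]; exact div_pos (Real.exp_pos _) h.partition_pos

theorem Admissible.real_le_iff {a : Param k} (h : Admissible T a) (x y : ℤ) :
    (expFam T a).real {x} ≤ (expFam T a).real {y} ↔ inner ℝ a (T y) ≤ inner ℝ a (T x) := by
  rw [h.real_singleton, h.real_singleton, div_le_div_iff_of_pos_right h.partition_pos,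
    Real.exp_le_exp, neg_le_neg_iff]

theorem Admissible.tendsto {a : Param k} (h : Admissible T a) :
    Filter.Tendsto (fun x : ℤ => inner ℝ a (T x)) Filter.cofinite Filter.atTop := by
  have := h.tendsto_cofinite_zero
  rw [Real.tendsto_exp_comp_nhds_zero] at this
  exact Filter.tendsto_neg_atBot_iff.1 this

/-- The weight at a point of a segment is dominated by the sum of the weights at its ends. -/
theorem exp_segment_le {a b : Param k} {s t : ℝ} (hs : 0 ≤ s) (ht : 0 ≤ t) (hst : s + t = 1)
    (x : ℤ) : Real.exp (-inner ℝ (s • a + t • b) (T x))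
      ≤ Real.exp (-inner ℝ a (T x)) + Real.exp (-inner ℝ b (T x)) := by
  have e : -inner ℝ (s • a + t • b) (T x)
      = s • (-inner ℝ a (T x) : ℝ) + t • (-inner ℝ b (T x) : ℝ) := by
    rw [inner_add_left, real_inner_smul_left, real_inner_smul_left, smul_eq_mul, smul_eq_mul]; ring
  rw [e]
  refine (convexOn_exp.2 (Set.mem_univ _) (Set.mem_univ _) hs ht hst).trans ?_
  have h1 := Real.exp_pos (-inner ℝ a (T x))
  have h2 := Real.exp_pos (-inner ℝ b (T x))
  simp only [smul_eq_mul]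
  nlinarith

theorem Admissible.segment {a b : Param k} (ha : Admissible T a) (hb : Admissible T b) {s t : ℝ}
    (hs : 0 ≤ s) (ht : 0 ≤ t) (hst : s + t = 1) : Admissible T (s • a + t • b) :=
  Summable.of_nonneg_of_le (fun _ => (Real.exp_pos _).le) (exp_segment_le hs ht hst) (ha.add hb)

theorem affinity_expFam {a b : Param k} (ha : Admissible T a) (hb : Admissible T b) :
    affinity (expFam T a) (expFam T b)
      = partition T ((1 / 2 : ℝ) • a + (1 / 2 : ℝ) • b) / √(partition T a * partition T b) := by
  unfold affinity partition
  rw [← tsum_div_const]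
  refine tsum_congr fun x => ?_
  rw [ha.real_singleton, hb.real_singleton, ← Real.sqrt_mul (by
    exact div_nonneg (Real.exp_pos _).le ha.partition_pos.le), div_mul_div_comm,
    Real.sqrt_div (by positivity), ← Real.exp_add]
  congr 1
  rw [← Real.exp_half]
  congr 1
  rw [inner_add_left, real_inner_smul_left, real_inner_smul_left]; ring

theorem segment_eq (a b : Param k) (s : ℝ) :
    (1 / 2 : ℝ) • a + (1 / 2 : ℝ) • b + s • (b - a)
      = (1 / 2 - s) • a + (1 / 2 + s) • b := by
  module

theorem continuousOn_partition_segment {a b : Param k} (ha : Admissible T a)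
    (hb : Admissible T b) :
    ContinuousOn (fun s : ℝ => partition T ((1 / 2 - s) • a + (1 / 2 + s) • b))
      (Set.Icc (-(1 / 2)) (1 / 2)) := by
  refine continuousOn_tsum (u := fun x : ℤ => Real.exp (-inner ℝ a (T x))
    + Real.exp (-inner ℝ b (T x))) (fun x => ?_) (ha.add hb) fun x s hs => ?_
  · refine Continuous.continuousOn ?_
    fun_prop
  · rw [Real.norm_eq_abs, Real.abs_exp]
    exact exp_segment_le (by linarith [hs.2]) (by linarith [hs.1]) (by ring) x

/-- If the variance of `(b - a) · T` is at most `V` along the segment from `a` to `b`, the second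
derivative of the logarithm of the partition function along the segment is at most `V`; hence the
affinity of the two end points is at least `exp (-V / 8)`. -/
theorem one_sub_affinity_expFam_le {a b : Param k} (ha : Admissible T a) (hb : Admissible T b)
    {V : ℝ} (hV : ∀ s ∈ Set.Ioo (-(1 / 2) : ℝ) (1 / 2),
      variance (fun x : ℤ => inner ℝ (b - a) (T x))
        (expFam T ((1 / 2 - s) • a + (1 / 2 + s) • b)) ≤ V) :
    1 - affinity (expFam T a) (expFam T b) ≤ V / 8 := by
  obtain ⟨c, hc⟩ : ∃ c, c = (1 / 2 : ℝ) • a + (1 / 2 : ℝ) • b := ⟨_, rfl⟩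
  have hcad : Admissible T c := hc ▸ ha.segment hb (by norm_num) (by norm_num) (by norm_num)
  have hseg : ∀ s ∈ Set.Icc (-(1 / 2) : ℝ) (1 / 2),
      Admissible T ((1 / 2 - s) • a + (1 / 2 + s) • b) := fun s hs =>
    ha.segment hb (by linarith [hs.2]) (by linarith [hs.1]) (by ring)
  set ν := expFam T c with hν
  have := hcad.isProbabilityMeasure
  set X : ℤ → ℝ := fun x => -inner ℝ (b - a) (T x) with hX
  have hexp : ∀ (s : ℝ) (x : ℤ), Real.exp (-inner ℝ c (T x)) * Real.exp (s * X x)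
      = Real.exp (-inner ℝ ((1 / 2 - s) • a + (1 / 2 + s) • b) (T x)) := by
    intro s x
    rw [← segment_eq, ← hc, ← Real.exp_add, hX, inner_add_left, real_inner_smul_left]
    ring_nf
  have hintexp : ∀ s ∈ Set.Icc (-(1 / 2) : ℝ) (1 / 2),
      Integrable (fun x => Real.exp (s * X x)) ν := by
    intro s hs
    rw [hν, expFam, integrable_tilted_iff hcad.integrable]
    simp_rw [smul_eq_mul, hexp]
    exact (hseg s hs).integrable
  have hmgf : ∀ s ∈ Set.Icc (-(1 / 2) : ℝ) (1 / 2), mgf X ν s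
      = partition T ((1 / 2 - s) • a + (1 / 2 + s) • b) / partition T c := by
    intro s hs
    rw [mgf, hν, expFam, integral_tilted, ← (hseg s hs).integral_eq, ← hcad.integral_eq,
      ← integral_div]
    refine integral_congr_ae (Filter.Eventually.of_forall fun x => ?_)
    simp only
    rw [← hexp, smul_eq_mul]; ring
  have hint : ∀ s ∈ Set.Ioo (-(1 / 2) : ℝ) (1 / 2), s ∈ interior (integrableExpSet X ν) := by
    intro s hs
    exact interior_mono (s := Set.Icc (-(1 / 2) : ℝ) (1 / 2)) (fun t ht => hintexp t ht)
      (by rwa [interior_Icc])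
  have hvar : ∀ s ∈ Set.Ioo (-(1 / 2) : ℝ) (1 / 2), iteratedDeriv 2 (cgf X ν) s ≤ V := by
    intro s hs
    rw [← variance_tilted_mul (hint s hs), hν, expFam, tilted_tilted hcad.integrable]
    have e : ((fun x : ℤ => -inner ℝ c (T x)) + fun x => s * X x)
        = fun x => -inner ℝ ((1 / 2 - s) • a + (1 / 2 + s) • b) (T x) := by
      funext x
      rw [← segment_eq, ← hc, hX, inner_add_left, real_inner_smul_left, Pi.add_apply]
      ring
    rw [e, hX]
    have hneg : variance (fun x : ℤ => -inner ℝ (b - a) (T x))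
        (expFam T ((1 / 2 - s) • a + (1 / 2 + s) • b))
        = variance (fun x : ℤ => inner ℝ (b - a) (T x))
        (expFam T ((1 / 2 - s) • a + (1 / 2 + s) • b)) := variance_fun_neg
    exact hneg.le.trans (hV s hs)
  -- `s ↦ cgf s - V * s ^ 2 / 2` is concave; compare its value at the midpoint with the end points
  have hconc : ConcaveOn ℝ (Set.Icc (-(1 / 2) : ℝ) (1 / 2)) fun s => cgf X ν s - V * s ^ 2 / 2 := by
    refine concaveOn_of_hasDerivWithinAt2_nonpos (convex_Icc _ _)
      (f' := fun s => deriv (cgf X ν) s - V * s)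
      (f'' := fun s => iteratedDeriv 2 (cgf X ν) s - V) ?_ ?_ ?_ ?_
    · refine ContinuousOn.sub ?_ (by fun_prop)
      have : ContinuousOn (fun s => Real.log (mgf X ν s)) (Set.Icc (-(1 / 2) : ℝ) (1 / 2)) := by
        refine ContinuousOn.log ?_ fun s hs => ?_
        · refine ContinuousOn.congr ((continuousOn_partition_segment ha hb).div_const
            (partition T c)) hmgf
        · rw [hmgf s hs]
          exact (div_pos (hseg s hs).partition_pos hcad.partition_pos).ne'
      exact this
    · intro s hs
      rw [interior_Icc] at hs
      have h1 := (analyticAt_cgf (hint s hs)).differentiableAt.hasDerivAt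
      have h2 : HasDerivAt (fun s : ℝ => V * s ^ 2 / 2) (V * s) s := by
        have := ((hasDerivAt_pow 2 s).const_mul V).div_const 2
        refine this.congr_deriv ?_
        push_cast; ring
      exact (h1.sub h2).hasDerivWithinAt
    · intro s hs
      rw [interior_Icc] at hs
      have h1 := (analyticAt_cgf (hint s hs)).deriv.differentiableAt.hasDerivAt
      have h2 : HasDerivAt (fun s : ℝ => V * s) V s := by
        simpa using (hasDerivAt_id s).const_mul V
      rw [iteratedDeriv_succ, iteratedDeriv_one]
      exact (h1.sub h2).hasDerivWithinAt
    · intro s hs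
      rw [interior_Icc] at hs
      linarith [hvar s hs]
  have hmid := hconc.2 (show (-(1 / 2) : ℝ) ∈ Set.Icc (-(1 / 2) : ℝ) (1 / 2) by norm_num)
    (show (1 / 2 : ℝ) ∈ Set.Icc (-(1 / 2) : ℝ) (1 / 2) by norm_num)
    (show (0 : ℝ) ≤ 1 / 2 by norm_num) (show (0 : ℝ) ≤ 1 / 2 by norm_num) (by norm_num)
  have e0 : (1 / 2 : ℝ) • (-(1 / 2) : ℝ) + (1 / 2 : ℝ) • (1 / 2 : ℝ) = 0 := by norm_num
  rw [e0] at hmid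
  simp only [smul_eq_mul, cgf] at hmid
  have hend1 : ((1 / 2 - -(1 / 2) : ℝ)) • a + (1 / 2 + -(1 / 2) : ℝ) • b = a := by norm_num
  have hend2 : ((1 / 2 - 1 / 2 : ℝ)) • a + (1 / 2 + 1 / 2 : ℝ) • b = b := by norm_num
  have hend3 : ((1 / 2 - 0 : ℝ)) • a + (1 / 2 + 0 : ℝ) • b = c := by rw [hc]; norm_num
  rw [hmgf _ (by norm_num), hmgf _ (by norm_num), hmgf _ (by norm_num), hend1, hend2, hend3,
    Real.log_div ha.partition_pos.ne' hcad.partition_pos.ne',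
    Real.log_div hb.partition_pos.ne' hcad.partition_pos.ne',
    div_self hcad.partition_pos.ne', Real.log_one] at hmid
  have hlog : -(V / 8) ≤ Real.log (affinity (expFam T a) (expFam T b)) := by
    have hpa := ha.partition_pos
    have hpb := hb.partition_pos
    rw [affinity_expFam ha hb, ← hc, Real.log_div hcad.partition_pos.ne'
      (Real.sqrt_pos.2 (by positivity)).ne', Real.log_sqrt (by positivity),
      Real.log_mul hpa.ne' hpb.ne']
    linarith
  have hpos : 0 < affinity (expFam T a) (expFam T b) := by
    have hpa := ha.partition_pos
    have hpb := hb.partition_pos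
    rw [affinity_expFam ha hb, ← hc]
    exact div_pos hcad.partition_pos (Real.sqrt_pos.2 (by positivity))
  have := Real.log_le_sub_one_of_pos hpos
  linarith

end ExpFam

/-! ### Shortening vectors of a polyhedral cone -/

section Cone

variable {k : ℕ}

/-- Near a unit vector `a₀` of the cone `{a | ∀ i, 0 ≤ ⟪g i, a⟫}`, the direction `a₀` itself is
supported on the functionals that are bounded below near `a₀`; compactness makes the bound uniform. -/
theorem exists_direction_of_large {ι : Type*} [Finite ι] (g : ι → Param k) :
    ∃ c : ℝ, 0 < c ∧ ∀ a : Param k, ‖a‖ = 1 → (∀ i, 0 ≤ inner ℝ (g i) a) →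
      ∃ u : Param k, u ≠ 0 ∧ (∀ i, 0 ≤ inner ℝ (g i) u) ∧
        ∀ i, inner ℝ (g i) a < c → inner ℝ (g i) u = 0 := by
  have hcomp : IsCompact {a : Param k | a ∈ Metric.sphere (0 : Param k) 1 ∧
      ∀ i, 0 ≤ inner ℝ (g i) a} := by
    refine (isCompact_sphere (0 : Param k) 1).inter_right (t := {a | ∀ i, 0 ≤ inner ℝ (g i) a}) ?_
    have e : {a : Param k | ∀ i, 0 ≤ inner ℝ (g i) a} = ⋂ i, {a | 0 ≤ inner ℝ (g i) a} := by
      ext; simp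
    rw [e]
    exact isClosed_iInter fun i => isClosed_le continuous_const (by fun_prop)
  have key := hcomp.induction_on
    (p := fun s => ∃ c : ℝ, 0 < c ∧ ∀ a ∈ s, ∃ u : Param k, u ≠ 0 ∧
      (∀ i, 0 ≤ inner ℝ (g i) u) ∧ ∀ i, inner ℝ (g i) a < c → inner ℝ (g i) u = 0)
    ⟨1, one_pos, by simp⟩
    (fun s t hst ⟨c, hc, h⟩ => ⟨c, hc, fun a ha => h a (hst ha)⟩)
    (fun s t ⟨c, hc, h⟩ ⟨c', hc', h'⟩ => ⟨min c c', lt_min hc hc', fun a ha => by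
      rcases ha with ha | ha
      · obtain ⟨u, h1, h2, h3⟩ := h a ha
        exact ⟨u, h1, h2, fun i hi => h3 i (hi.trans_le (min_le_left _ _))⟩
      · obtain ⟨u, h1, h2, h3⟩ := h' a ha
        exact ⟨u, h1, h2, fun i hi => h3 i (hi.trans_le (min_le_right _ _))⟩⟩)
    (fun a₀ ha₀ => by
      have h1 : ∀ᶠ c : ℝ in nhdsWithin 0 (Set.Ioi 0), ∀ i, 0 < inner ℝ (g i) a₀ →
          c < inner ℝ (g i) a₀ / 2 := by
        rw [Filter.eventually_all]
        intro i
        by_cases hi : 0 < inner ℝ (g i) a₀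
        · filter_upwards [Ioo_mem_nhdsGT (half_pos hi)] with c hc _ using hc.2
        · exact Filter.Eventually.of_forall fun c h => absurd h hi
      obtain ⟨c, hc, hc0⟩ := (h1.and self_mem_nhdsWithin).exists
      have h2 : ∀ᶠ a in nhds a₀, ∀ i, 0 < inner ℝ (g i) a₀ →
          inner ℝ (g i) a₀ / 2 < inner ℝ (g i) a := by
        rw [Filter.eventually_all]
        intro i
        by_cases hi : 0 < inner ℝ (g i) a₀
        · have hcont : Continuous fun a : Param k => (inner ℝ (g i) a : ℝ) := by fun_prop
          filter_upwards [hcont.continuousAt.eventually (lt_mem_nhds (half_lt_self hi))]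
            with a ha _ using ha
        · exact Filter.Eventually.of_forall fun c h => absurd h hi
      refine ⟨_, mem_nhdsWithin_of_mem_nhds h2, c, hc0, fun a ha => ⟨a₀, ?_, ha₀.2, ?_⟩⟩
      · rintro rfl
        simpa using ha₀.1
      · intro i hi
        by_contra hne
        have hpos := lt_of_le_of_ne (ha₀.2 i) (Ne.symm hne)
        linarith [ha i hpos, hc i hpos])
  obtain ⟨c, hc, h⟩ := key
  exact ⟨c, hc, fun a ha1 ha2 => h a ⟨by simpa using ha1, ha2⟩⟩

/-- A vector of the cone `{a | ∀ i, 0 ≤ ⟪g i, a⟫}` can be replaced by one of norm at most `K * τ`,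
without changing the values `⟪g i, a⟫` except for shrinking some of those above `τ` to values that
are still at least `τ`. As long as the vector is long, there is a direction supported on the
functionals whose value exceeds `τ`; subtracting it brings one of these values down to `τ`. -/
theorem exists_truncation {ι : Type*} [Fintype ι] (g : ι → Param k)
    (hspan : ∀ u : Param k, (∀ i, inner ℝ (g i) u = 0) → u = 0) :
    ∃ K : ℝ, 0 < K ∧ ∀ τ : ℝ, 0 < τ → ∀ a : Param k, (∀ i, 0 ≤ inner ℝ (g i) a) →
      ∃ a' : Param k, ‖a'‖ ≤ K * τ ∧ ∀ i, 0 ≤ inner ℝ (g i) a' ∧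
        inner ℝ (g i) a' ≤ inner ℝ (g i) a ∧
        (inner ℝ (g i) a' = inner ℝ (g i) a ∨ τ ≤ inner ℝ (g i) a') := by
  classical
  obtain ⟨c, hc, hdir⟩ := exists_direction_of_large g
  refine ⟨1 / c, by positivity, fun τ hτ a ha => ?_⟩
  induction hn : (Finset.univ.filter fun i => τ < inner ℝ (g i) a).card using
    Nat.strong_induction_on generalizing a with
  | _ n ih =>
    subst hn
    by_cases hle : ‖a‖ ≤ 1 / c * τ
    · exact ⟨a, hle, fun i => ⟨ha i, le_rfl, Or.inl rfl⟩⟩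
    push Not at hle
    have hna : 0 < ‖a‖ := lt_of_le_of_lt (by positivity) hle
    have hscale : ∀ i, inner ℝ (g i) (‖a‖⁻¹ • a) = inner ℝ (g i) a / ‖a‖ := fun i => by
      rw [real_inner_smul_right]; ring
    obtain ⟨u, hu0, hu, hz⟩ := hdir (‖a‖⁻¹ • a)
      (by rw [norm_smul, norm_inv, norm_norm, inv_mul_cancel₀ hna.ne'])
      (fun i => by rw [hscale]; exact div_nonneg (ha i) hna.le)
    have hz' : ∀ i, inner ℝ (g i) u ≠ 0 → τ < inner ℝ (g i) a := by
      intro i hi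
      by_contra hcon
      push Not at hcon
      refine hi (hz i ?_)
      rw [hscale, div_lt_iff₀ hna]
      rw [one_div_mul_eq_div, div_lt_iff₀ hc] at hle
      linarith
    set J := Finset.univ.filter fun i => 0 < inner ℝ (g i) u with hJ
    have hJne : J.Nonempty := by
      by_contra hemp
      rw [Finset.not_nonempty_iff_eq_empty] at hemp
      refine hu0 (hspan u fun i => le_antisymm ?_ (hu i))
      by_contra hcon
      have : i ∈ J := by rw [hJ]; simpa using hcon
      rw [hemp] at this
      simp at this
    obtain ⟨i₀, hi₀, hmin⟩ :=
      J.exists_min_image (fun i => (inner ℝ (g i) a - τ) / inner ℝ (g i) u) hJne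
    have hi₀pos : 0 < inner ℝ (g i₀) u := by simpa [hJ] using hi₀
    set s := (inner ℝ (g i₀) a - τ) / inner ℝ (g i₀) u with hs
    have hs0 : 0 < s := div_pos (by linarith [hz' i₀ hi₀pos.ne']) hi₀pos
    have hval : ∀ i, inner ℝ (g i) (a - s • u) = inner ℝ (g i) a - s * inner ℝ (g i) u :=
      fun i => by rw [inner_sub_right, real_inner_smul_right]
    have hge : ∀ i, inner ℝ (g i) u ≠ 0 → τ ≤ inner ℝ (g i) (a - s • u) := by
      intro i hi
      have hpos : 0 < inner ℝ (g i) u := lt_of_le_of_ne (hu i) (Ne.symm hi)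
      have := hmin i (by rw [hJ]; simpa using hpos)
      rw [le_div_iff₀ hpos] at this
      rw [hval]; linarith
    have heq : ∀ i, inner ℝ (g i) u = 0 → inner ℝ (g i) (a - s • u) = inner ℝ (g i) a :=
      fun i hi => by rw [hval, hi]; ring
    have hle' : ∀ i, inner ℝ (g i) (a - s • u) ≤ inner ℝ (g i) a := fun i => by
      rw [hval]; linarith [mul_nonneg hs0.le (hu i)]
    have hlt : (Finset.univ.filter fun i => τ < inner ℝ (g i) (a - s • u)).card
        < (Finset.univ.filter fun i => τ < inner ℝ (g i) a).card := by
      refine Finset.card_lt_card ?_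
      rw [Finset.ssubset_iff_of_subset]
      · refine ⟨i₀, by simpa using hz' i₀ hi₀pos.ne', ?_⟩
        simp only [Finset.mem_filter, Finset.mem_univ, true_and, not_lt]
        rw [hval, hs, div_mul_cancel₀ _ hi₀pos.ne']; linarith
      · intro i hi
        simp only [Finset.mem_filter, Finset.mem_univ, true_and] at hi ⊢
        exact hi.trans_le (hle' i)
    obtain ⟨a', hnorm, ha'⟩ := ih _ hlt (a - s • u) (fun i => by
      by_cases hi : inner ℝ (g i) u = 0
      · rw [heq i hi]; exact ha i
      · exact hτ.le.trans (hge i hi)) rfl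
    refine ⟨a', hnorm, fun i => ⟨(ha' i).1, (ha' i).2.1.trans (hle' i), ?_⟩⟩
    rcases (ha' i).2.2 with h | h
    · by_cases hi : inner ℝ (g i) u = 0
      · exact Or.inl (h.trans (heq i hi))
      · exact Or.inr (h ▸ hge i hi)
    · exact Or.inr h

theorem coneHull_smul_mem {A : Set (Param k)} {u : Param k} (hu : u ∈ coneHull A) {s : ℝ}
    (hs : 0 ≤ s) : s • u ∈ coneHull A :=
  PointedCone.smul_mem (PointedCone.hull ℝ A) hs hu

theorem zero_mem_coneHull (A : Set (Param k)) : (0 : Param k) ∈ coneHull A :=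
  (PointedCone.hull ℝ A).zero_mem

theorem subset_coneHull (A : Set (Param k)) : A ⊆ coneHull A := Submodule.subset_span

/-- A cone that is a polyhedron is cut out by homogeneous inequalities. -/
theorem exists_homogeneous {A : Set (Param k)} (h : IsPolyhedron (coneHull A)) :
    ∃ (t : ℕ) (g : Fin t → Param k), ∀ u, u ∈ coneHull A ↔ ∀ i, 0 ≤ inner ℝ (g i) u := by
  obtain ⟨t, g, c, hc⟩ := h
  have hmem : ∀ u, u ∈ coneHull A ↔ ∀ i, c i ≤ inner ℝ (g i) u := fun u => by rw [hc]; rfl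
  refine ⟨t, g, fun u => ⟨fun hu i => ?_, fun hu => (hmem u).2 fun i => ?_⟩⟩
  · by_contra hneg
    push Not at hneg
    set v := inner ℝ (g i) u with hv
    have h1 := (hmem _).1 (coneHull_smul_mem hu (s := (|c i| + 1) / (-v))
      (div_nonneg (by positivity) (by linarith))) i
    rw [real_inner_smul_right, ← hv, div_mul_eq_mul_div, div_neg, mul_div_assoc,
      div_self hneg.ne, mul_one] at h1
    linarith [neg_abs_le (c i)]
  · have := (hmem 0).1 (zero_mem_coneHull A) i
    rw [inner_zero_right] at this
    exact this.trans (hu i)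

end Cone

/-! ### Truncation of exponential family parameters -/

section Truncation

variable {k : ℕ} {T : ℤ → Param k} {A : Set (Param k)}

/-- The function `x ↦ u · T x` decreases up to some `M ∈ [-n, n]`, increases from `M` on, and takes
its minimum only inside `[-n, n]`. -/
def ValleyShaped (T : ℤ → Param k) (n : ℕ) (u : Param k) : Prop :=
  ∃ M : ℤ, |M| ≤ n ∧ (∀ x y : ℤ, M ≤ x → x ≤ y → inner ℝ u (T x) ≤ inner ℝ u (T y)) ∧
    (∀ x y : ℤ, y ≤ M → x ≤ y → inner ℝ u (T y) ≤ inner ℝ u (T x)) ∧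
    ∀ x : ℤ, n < |x| → inner ℝ u (T M) < inner ℝ u (T x)

theorem ValleyShaped.minimizer {n : ℕ} {u : Param k} (h : ValleyShaped T n u) :
    ∃ M : ℤ, |M| ≤ n ∧ (∀ x, inner ℝ u (T M) ≤ inner ℝ u (T x)) ∧
      ∀ x : ℤ, n < |x| → inner ℝ u (T M) < inner ℝ u (T x) := by
  obtain ⟨M, h1, h2, h3, h4⟩ := h
  refine ⟨M, h1, fun x => ?_, h4⟩
  rcases le_total M x with hx | hx
  · exact h2 M x le_rfl hx
  · exact h3 x M le_rfl hx

/-- Every nonzero parameter `a` of the cone can be replaced by a parameter `a'` of norm at most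
`K * τ` such that, relative to a common mode `x₀`, the exponents `a · (T x - T x₀)` do not change
except for becoming smaller while staying above `τ`. -/
theorem exists_small_parameter {n : ℕ} (hpoly : IsPolyhedron (coneHull A))
    (hshape : ∀ u ∈ coneHull A, u ≠ 0 → ValleyShaped T n u) :
    ∃ K : ℝ, 1 ≤ K ∧ ∀ τ : ℝ, 0 < τ → ∀ a ∈ coneHull A, a ≠ 0 →
      ∃ a' ∈ coneHull A, ∃ x₀ : ℤ, ‖a'‖ ≤ K * τ ∧ (a' = a ∨ τ ≤ K * ‖a'‖) ∧
        ∀ x : ℤ, 0 ≤ inner ℝ a' (T x - T x₀) ∧ inner ℝ a' (T x - T x₀) ≤ inner ℝ a (T x - T x₀) ∧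
          (inner ℝ a' (T x - T x₀) = inner ℝ a (T x - T x₀) ∨ τ ≤ inner ℝ a' (T x - T x₀)) := by
  classical
  obtain ⟨t, h, hcone⟩ := exists_homogeneous hpoly
  set W : Finset ℤ := Finset.Icc (-(n + 1 : ℤ)) (n + 1) with hW
  have hWmem : ∀ x : ℤ, x ∈ W ↔ |x| ≤ n + 1 := fun x => by rw [hW, Finset.mem_Icc, abs_le]
  -- the functionals for a given mode: the halfspaces of the cone and the comparisons with the mode
  let g : ℤ → (Fin t ⊕ W) → Param k := fun x₀ => Sum.elim h fun x => T x - T x₀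
  have hspan : ∀ x₀ : ℤ, ∀ u : Param k, (∀ i, inner ℝ (g x₀ i) u = 0) → u = 0 := by
    intro x₀ u hu
    by_contra hne
    have huc : u ∈ coneHull A := (hcone u).2 fun i => (hu (Sum.inl i)).ge
    obtain ⟨M, hM1, -, hM3⟩ := (hshape u huc hne).minimizer
    have e : ∀ x ∈ W, inner ℝ u (T x) = inner ℝ u (T x₀) := by
      intro x hx
      have := hu (Sum.inr ⟨x, hx⟩)
      simp only [g, Sum.elim_inr] at this
      rw [real_inner_comm, inner_sub_right] at this
      linarith
    have h1 := hM3 (n + 1) (by rw [abs_of_nonneg (by positivity)]; omega)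
    rw [e M ((hWmem _).2 (by omega)),
      e (n + 1) ((hWmem _).2 (by rw [abs_of_nonneg (by positivity)]))] at h1
    exact lt_irrefl _ h1
  choose K hK0 hK using fun x₀ => exists_truncation (g x₀) (hspan x₀)
  set K₁ : ℝ := 1 + ∑ x₀ ∈ W, K x₀ + ∑ x₀ ∈ W, ‖T (n + 1) - T x₀‖ with hK₁
  have hs1 : 0 ≤ ∑ x₀ ∈ W, K x₀ := Finset.sum_nonneg fun x _ => (hK0 x).le
  have hs2 : 0 ≤ ∑ x₀ ∈ W, ‖T (n + 1) - T x₀‖ := Finset.sum_nonneg fun x _ => norm_nonneg _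
  refine ⟨K₁, by linarith, fun τ hτ a ha ha0 => ?_⟩
  obtain ⟨x₀, hx₀, hmin, -⟩ := (hshape a ha ha0).minimizer
  have hx₀W : x₀ ∈ W := (hWmem _).2 (by omega)
  obtain ⟨a', hnorm, ha'⟩ := hK x₀ τ hτ a (by
    rintro (i | x)
    · exact (hcone a).1 ha i
    · simp only [g, Sum.elim_inr]
      rw [real_inner_comm, inner_sub_right]
      linarith [hmin x])
  have ha'c : a' ∈ coneHull A := (hcone a').2 fun i => (ha' (Sum.inl i)).1
  have hwin : ∀ x ∈ W, 0 ≤ inner ℝ a' (T x - T x₀) ∧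
      inner ℝ a' (T x - T x₀) ≤ inner ℝ a (T x - T x₀) ∧
      (inner ℝ a' (T x - T x₀) = inner ℝ a (T x - T x₀) ∨ τ ≤ inner ℝ a' (T x - T x₀)) := by
    intro x hx
    have := ha' (Sum.inr ⟨x, hx⟩)
    simp only [g, Sum.elim_inr] at this
    rwa [real_inner_comm a', real_inner_comm a] at this
  refine ⟨a', ha'c, x₀, ?_, ?_⟩
  · refine hnorm.trans (mul_le_mul_of_nonneg_right ?_ hτ.le)
    have := Finset.single_le_sum (f := K) (fun x _ => (hK0 x).le) hx₀W
    linarith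
  by_cases haa : a' = a
  · subst haa
    refine ⟨Or.inl rfl, fun x => ⟨?_, le_rfl, Or.inl rfl⟩⟩
    rw [inner_sub_right]; linarith [hmin x]
  -- the difference `a - a'` also lies in the cone and has `x₀` as a mode
  set d := a - a' with hd
  have hd0 : d ≠ 0 := sub_ne_zero.2 (Ne.symm haa)
  have hdc : d ∈ coneHull A := (hcone d).2 fun i => by
    have := (ha' (Sum.inl i)).2.1
    simp only [g, Sum.elim_inl] at this
    rw [hd, inner_sub_right]; linarith
  obtain ⟨Md, hMd1, hMd2, hMd3⟩ := (hshape d hdc hd0).minimizer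
  have hdx₀ : inner ℝ d (T x₀) ≤ inner ℝ d (T Md) := by
    have := (hwin Md ((hWmem _).2 (by omega))).2.1
    rw [hd, inner_sub_left, inner_sub_left]
    rw [inner_sub_right, inner_sub_right] at this
    linarith
  have hout : ∀ x : ℤ, (n : ℤ) < |x| → x ∈ W → τ ≤ inner ℝ a' (T x - T x₀) := by
    intro x hx hxW
    refine (hwin x hxW).2.2.resolve_left fun heq => ?_
    have h1 := hMd3 x hx
    have h2 : inner ℝ d (T x) = inner ℝ d (T x₀) := by
      rw [hd, inner_sub_left, inner_sub_left]
      rw [inner_sub_right, inner_sub_right] at heq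
      linarith
    linarith
  have hright := hout (n + 1) (by rw [abs_of_nonneg (by positivity)]; omega)
    ((hWmem _).2 (by rw [abs_of_nonneg (by positivity)]))
  have hleft := hout (-(n + 1)) (by rw [abs_neg, abs_of_nonneg (by positivity)]; omega)
    ((hWmem _).2 (by rw [abs_neg, abs_of_nonneg (by positivity)]))
  have ha'0 : a' ≠ 0 := by
    rintro rfl
    rw [inner_zero_left] at hright
    linarith
  obtain ⟨M', hM'1, hM'r, hM'l, -⟩ := hshape a' ha'c ha'0
  have hfar : ∀ x : ℤ, x ∉ W → τ ≤ inner ℝ a' (T x - T x₀) := by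
    intro x hx
    rw [hWmem, not_le] at hx
    rw [abs_le] at hM'1
    rw [inner_sub_right] at hright hleft ⊢
    rcases lt_abs.1 hx with h1 | h1
    · have := hM'r (n + 1) x (by omega) (by omega)
      linarith
    · have := hM'l x (-(n + 1)) (by omega) (by omega)
      linarith
  refine ⟨Or.inr ?_, fun x => ?_⟩
  · refine hright.trans ((real_inner_le_norm _ _).trans ?_)
    rw [mul_comm]
    refine mul_le_mul_of_nonneg_right ?_ (norm_nonneg _)
    have := Finset.single_le_sum (f := fun x => ‖T (n + 1) - T x‖) (fun x _ => norm_nonneg _) hx₀W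
    linarith
  · by_cases hx : x ∈ W
    · exact hwin x hx
    · have h1 := hfar x hx
      refine ⟨hτ.le.trans h1, ?_, Or.inr h1⟩
      have h2 := hMd2 x
      rw [inner_sub_right, inner_sub_right]
      rw [hd, inner_sub_left, inner_sub_left] at hdx₀ h2
      linarith

end Truncation

/-! ### Families satisfying the standing assumptions -/

section Family

variable {k : ℕ} {T : ℤ → Param k} {A : Set (Param k)} {ρ L B Λ γ : ℝ}

theorem isMode_of_monotone {ν : Measure ℤ} {M : ℤ}
    (hr : ∀ x : ℤ, M ≤ x → ν.real {x + 1} ≤ ν.real {x})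
    (hl : ∀ x : ℤ, x < M → ν.real {x} ≤ ν.real {x + 1}) : IsMode ν M := fun x => by
  rcases le_total M x with hx | hx
  · exact antitone_right hr le_rfl hx
  · exact monotone_left hl le_rfl hx

theorem rhoCone_anti {ρ' : ℝ} (h : ρ ≤ ρ') : rhoCone ρ' A ⊆ rhoCone ρ A :=
  Set.union_subset_union_right _ (Set.sdiff_subset_sdiff_right (Metric.ball_subset_ball h))

theorem mem_rhoCone_of_le_norm {a : Param k} (ha : a ∈ coneHull A) (h : ρ ≤ ‖a‖) :
    a ∈ rhoCone ρ A := Or.inr ⟨ha, by simpa using h⟩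

theorem rhoCone_subset_coneHull : rhoCone ρ A ⊆ coneHull A :=
  Set.union_subset (subset_coneHull A) Set.sdiff_subset

theorem smul_mem_rhoCone {u : Param k} (hu : u ∈ coneHull A) {s : ℝ} (hs0 : 0 ≤ s)
    (hs : ρ ≤ s * ‖u‖) : s • u ∈ rhoCone ρ A :=
  mem_rhoCone_of_le_norm (coneHull_smul_mem hu hs0) (by
    rwa [norm_smul, Real.norm_of_nonneg hs0])

theorem not_admissible_zero : ¬ Admissible T 0 := fun h => by
  have := h.tendsto_cofinite_zero
  simp only [inner_zero_left, neg_zero, Real.exp_zero] at this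
  exact one_ne_zero (tendsto_nhds_unique tendsto_const_nhds this)

namespace Assumptions

theorem admissible (h : Assumptions T A ρ L B Λ γ) {a : Param k} (ha : a ∈ rhoCone ρ A) :
    Admissible T a := h.wellDefined a ha

theorem ne_zero (h : Assumptions T A ρ L B Λ γ) {a : Param k} (ha : a ∈ rhoCone ρ A) : a ≠ 0 := by
  rintro rfl
  exact not_admissible_zero (h.admissible ha)

theorem fourthMomentLE (h : Assumptions T A ρ L B Λ γ) {a : Param k} (ha : a ∈ rhoCone ρ A) :
    FourthMomentLE (expFam T a) B where
  prob := (h.admissible ha).isProbabilityMeasure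
  memLp := (h.fourth_moment a ha).1
  moment_le := by
    have := (h.fourth_moment a ha).2
    simpa [centralMoment, mean] using this

theorem abs_mean_le (h : Assumptions T A ρ L B Λ γ) {a : Param k} (ha : a ∈ rhoCone ρ A) :
    |mean (expFam T a)| ≤ L + 12 * (1 + B) := by
  obtain ⟨M, hr, hl⟩ := h.unimodal a ha
  have h1 := h.bounded_modes a ha M (isMode_of_monotone hr hl)
  have h2 := (h.fourthMomentLE ha).abs_mean_sub_mode_le hr hl
  have h3 := abs_sub_abs_le_abs_sub (mean (expFam T a)) (M : ℝ)
  linarith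

/-- A scaled copy of each nonzero vector of the cone lies in the parameter space, where unimodality
and the bound on the modes apply. -/
theorem valleyShaped (h : Assumptions T A ρ L B Λ γ) {u : Param k} (hu : u ∈ coneHull A)
    (hu0 : u ≠ 0) : ValleyShaped T ⌈L⌉₊ u := by
  have hn : 0 < ‖u‖ := norm_pos_iff.2 hu0
  set s := ρ / ‖u‖ with hs
  have hs0 : 0 < s := div_pos h.rho_pos hn
  have hmem : s • u ∈ rhoCone ρ A :=
    smul_mem_rhoCone hu hs0.le (by rw [hs, div_mul_cancel₀ _ hn.ne'])
  have had := h.admissible hmem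
  have hle : ∀ x y : ℤ, (expFam T (s • u)).real {x} ≤ (expFam T (s • u)).real {y} ↔
      inner ℝ u (T y) ≤ inner ℝ u (T x) := fun x y => by
    rw [had.real_le_iff, real_inner_smul_left, real_inner_smul_left, mul_le_mul_iff_right₀ hs0]
  obtain ⟨M, hr, hl⟩ := h.unimodal _ hmem
  have hmode := isMode_of_monotone hr hl
  refine ⟨M, ?_, fun x y hx hxy => (hle _ _).1 (antitone_right hr hx hxy),
    fun x y hy hxy => (hle _ _).1 (monotone_left hl hy hxy), fun x hx => ?_⟩
  · have := (h.bounded_modes _ hmem M hmode).trans (Nat.le_ceil L)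
    exact_mod_cast this
  · by_contra hcon
    push Not at hcon
    have h1 := h.bounded_modes _ hmem x fun y => (hmode y).trans ((hle _ _).2 hcon)
    have h2 := h1.trans (Nat.le_ceil L)
    have h3 : |x| ≤ (⌈L⌉₊ : ℤ) := by exact_mod_cast h2
    omega

/-- The square root of the affinity deficit is Lipschitz in the parameter. -/
theorem one_sub_affinity_le (h : Assumptions T A ρ L B Λ γ) {a b : Param k}
    (ha : a ∈ rhoCone ρ A) (hb : b ∈ rhoCone ρ A) :
    1 - affinity (expFam T a) (expFam T b) ≤ Λ * ‖a - b‖ ^ 2 / 8 := by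
  refine one_sub_affinity_expFam_le (h.admissible ha) (h.admissible hb) fun s hs => ?_
  rw [norm_sub_rev]
  refine (h.covariance _ ?_).2 (b - a)
  exact (convex_convexHull ℝ _) (subset_convexHull ℝ _ ha) (subset_convexHull ℝ _ hb)
    (by linarith [hs.2]) (by linarith [hs.1]) (by ring)

end Assumptions

theorem Admissible.real_singleton_eq_mul {a : Param k} (h : Admissible T a) (x x₀ : ℤ) :
    (expFam T a).real {x} = (expFam T a).real {x₀} * Real.exp (-inner ℝ a (T x - T x₀)) := by
  rw [h.real_singleton, h.real_singleton, div_mul_eq_mul_div, ← Real.exp_add, inner_sub_right]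
  congr 2; ring

/-- Lowering the exponents `a · (T x - T x₀)`, but not below `τ`, changes the distribution by at
most the mass of the points where the new exponents exceed `τ`. -/
theorem one_sub_affinity_le_of_truncation {a a' : Param k} (ha : Admissible T a)
    (ha' : Admissible T a') (hh : Admissible T ((1 / 2 : ℝ) • a')) {x₀ : ℤ} {τ : ℝ}
    (H : ∀ x : ℤ, 0 ≤ inner ℝ a' (T x - T x₀) ∧
      inner ℝ a' (T x - T x₀) ≤ inner ℝ a (T x - T x₀) ∧
      (inner ℝ a' (T x - T x₀) = inner ℝ a (T x - T x₀) ∨ τ ≤ inner ℝ a' (T x - T x₀))) :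
    1 - affinity (expFam T a) (expFam T a')
      ≤ Real.exp (-τ / 2) / (expFam T ((1 / 2 : ℝ) • a')).real {x₀} := by
  have := ha.isProbabilityMeasure
  have := ha'.isProbabilityMeasure
  have := hh.isProbabilityMeasure
  set p := fun x : ℤ => (expFam T a).real {x} with hp
  set q := fun x : ℤ => (expFam T a').real {x} with hq
  set r := fun x : ℤ => (expFam T ((1 / 2 : ℝ) • a')).real {x} with hr
  have hp0 : 0 < p x₀ := ha.real_singleton_pos x₀
  have hq0 : 0 < q x₀ := ha'.real_singleton_pos x₀
  have hr0 : 0 < r x₀ := hh.real_singleton_pos x₀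
  have ep : ∀ x, p x = p x₀ * Real.exp (-inner ℝ a (T x - T x₀)) :=
    fun x => ha.real_singleton_eq_mul x x₀
  have eq : ∀ x, q x = q x₀ * Real.exp (-inner ℝ a' (T x - T x₀)) :=
    fun x => ha'.real_singleton_eq_mul x x₀
  have er : ∀ x, r x = r x₀ * Real.exp (-inner ℝ a' (T x - T x₀) / 2) := fun x => by
    rw [hr]
    refine (hh.real_singleton_eq_mul x x₀).trans ?_
    rw [real_inner_smul_left]; congr 2; ring
  have hqp : q x₀ ≤ p x₀ := by
    have h1 := (hasSum_real_singleton (expFam T a)).mul_left (q x₀)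
    have h2 := (hasSum_real_singleton (expFam T a')).mul_left (p x₀)
    have := hasSum_le (fun x => ?_) h1 h2
    · simpa using this
    · change q x₀ * p x ≤ p x₀ * q x
      rw [ep, eq x, mul_left_comm]
      gcongr
      exact (H x).2.1
  -- where the exponent changed, `q x` is at most `exp (-τ / 2)` times the weight for `a' / 2`
  have hterm : ∀ x, q x ≤ √(p x) * √(q x) + Real.exp (-τ / 2) / r x₀ * r x := by
    intro x
    have hqx : 0 ≤ q x := measureReal_nonneg
    have hrx : 0 ≤ r x := measureReal_nonneg
    rcases (H x).2.2 with h | h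
    · have h1 : q x ≤ p x := by
        rw [ep, eq x, h]; gcongr
      have h2 : q x ≤ √(p x) * √(q x) := by
        calc q x = √(q x) * √(q x) := (Real.mul_self_sqrt hqx).symm
          _ ≤ √(p x) * √(q x) := by gcongr
      have : 0 ≤ Real.exp (-τ / 2) / r x₀ * r x := by positivity
      linarith
    · have h1 : q x ≤ Real.exp (-τ / 2) / r x₀ * r x := by
        have hq1 : q x₀ ≤ 1 := measureReal_le_one
        rw [er x, ← mul_assoc, div_mul_cancel₀ _ hr0.ne', ← Real.exp_add, eq x]
        calc q x₀ * Real.exp (-inner ℝ a' (T x - T x₀))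
            ≤ 1 * Real.exp (-inner ℝ a' (T x - T x₀)) := by gcongr
          _ ≤ _ := by rw [one_mul, Real.exp_le_exp]; linarith
      have : 0 ≤ √(p x) * √(q x) := by positivity
      linarith
  have hs := ((summable_affinity (expFam T a) (expFam T a')).hasSum).add
    ((hasSum_real_singleton (expFam T ((1 / 2 : ℝ) • a'))).mul_left (Real.exp (-τ / 2) / r x₀))
  have := hasSum_le hterm (hasSum_real_singleton (expFam T a')) hs
  rw [mul_one] at this
  change 1 ≤ affinity _ _ + _ at this
  linarith

/-- Every member of the family is close to one with a parameter of bounded norm. -/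
theorem Assumptions.exists_norm_le (h : Assumptions T A ρ L B Λ γ) {K : ℝ} (hK1 : 1 ≤ K)
    (hK : ∀ τ : ℝ, 0 < τ → ∀ a ∈ coneHull A, a ≠ 0 →
      ∃ a' ∈ coneHull A, ∃ x₀ : ℤ, ‖a'‖ ≤ K * τ ∧ (a' = a ∨ τ ≤ K * ‖a'‖) ∧
        ∀ x : ℤ, 0 ≤ inner ℝ a' (T x - T x₀) ∧ inner ℝ a' (T x - T x₀) ≤ inner ℝ a (T x - T x₀) ∧
          (inner ℝ a' (T x - T x₀) = inner ℝ a (T x - T x₀) ∨ τ ≤ inner ℝ a' (T x - T x₀)))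
    {δ τ : ℝ} (hδ : 0 ≤ δ) (hτ : 2 * K * ρ ≤ τ) (hτδ : 10 * (1 + B) * Real.exp (-τ / 2) ≤ δ)
    {a : Param k} (ha : a ∈ rhoCone ρ A) :
    ∃ a' ∈ rhoCone ρ A, ‖a'‖ ≤ K * τ ∧ 1 - affinity (expFam T a) (expFam T a') ≤ δ := by
  have hρ := h.rho_pos
  have hτ0 : 0 < τ := lt_of_lt_of_le (by positivity) hτ
  obtain ⟨a', ha'c, x₀, hnorm, hor, H⟩ := hK τ hτ0 a (rhoCone_subset_coneHull ha) (h.ne_zero ha)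
  rcases hor with rfl | hor
  · have := (h.admissible ha).isProbabilityMeasure
    exact ⟨a', ha, hnorm, by rw [affinity_self]; simpa using hδ⟩
  -- the truncated parameter is long enough for its half to be a parameter as well
  have hlong : 2 * ρ ≤ ‖a'‖ := by
    have : K * (2 * ρ) ≤ K * ‖a'‖ := by linarith
    exact le_of_mul_le_mul_left this (by linarith)
  have ha' : a' ∈ rhoCone ρ A := mem_rhoCone_of_le_norm ha'c (by linarith)
  have hhalf : (1 / 2 : ℝ) • a' ∈ rhoCone ρ A :=
    smul_mem_rhoCone ha'c (by norm_num) (by linarith)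
  refine ⟨a', ha', hnorm, (one_sub_affinity_le_of_truncation (h.admissible ha) (h.admissible ha')
    (h.admissible hhalf) H).trans (le_trans ?_ hτδ)⟩
  have hmode : IsMode (expFam T ((1 / 2 : ℝ) • a')) x₀ := fun x => by
    rw [(h.admissible hhalf).real_le_iff, real_inner_smul_left, real_inner_smul_left]
    have := (H x).1
    rw [inner_sub_right] at this
    linarith
  have h1 := (h.fourthMomentLE hhalf).mode_mass_ge hmode
  rw [div_le_iff₀ ((h.admissible hhalf).real_singleton_pos x₀)]
  have := Real.exp_pos (-τ / 2)
  nlinarith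

/-- A bounded part of a set of vectors is covered by few balls centred at its points. -/
theorem exists_finite_net (S : Set (Param k)) {r h : ℝ} (hr : 0 ≤ r) (hh : 0 < h) :
    ∃ N : Finset (Param k), (∀ b ∈ N, b ∈ S) ∧ (N.card : ℝ) ≤ (2 * r / h + 2) ^ k ∧
      ∀ a ∈ S, ‖a‖ ≤ r → ∃ b ∈ N, ‖a - b‖ ≤ √k * h := by
  classical
  -- one representative from each grid cell that meets the set
  let cell : Param k → Fin k → ℤ := fun a i => ⌊a i / h⌋
  let F : Finset (Fin k → ℤ) := Fintype.piFinset fun _ => Finset.Icc ⌊-r / h⌋ ⌊r / h⌋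
  let F' := F.filter fun f => ∃ a ∈ S, cell a = f
  let rep : (Fin k → ℤ) → Param k := fun f => if hf : ∃ a ∈ S, cell a = f then hf.choose else 0
  refine ⟨F'.image rep, ?_, ?_, ?_⟩
  · intro b hb
    obtain ⟨f, hf, rfl⟩ := Finset.mem_image.1 hb
    have hf' := (Finset.mem_filter.1 hf).2
    simp only [rep, dif_pos hf']
    exact hf'.choose_spec.1
  · have h1 : (F'.image rep).card ≤ F.card :=
      Finset.card_image_le.trans (Finset.card_filter_le _ _)
    have h2 : F.card = (⌊r / h⌋ + 1 - ⌊-r / h⌋).toNat ^ k := by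
      simp [F, Fintype.card_piFinset, Int.card_Icc]
    have h3 : (((⌊r / h⌋ + 1 - ⌊-r / h⌋).toNat : ℕ) : ℝ) ≤ 2 * r / h + 2 := by
      have hle : ⌊-r / h⌋ ≤ ⌊r / h⌋ := Int.floor_le_floor (by gcongr; linarith)
      have : (((⌊r / h⌋ + 1 - ⌊-r / h⌋).toNat : ℕ) : ℝ) = ((⌊r / h⌋ + 1 - ⌊-r / h⌋ : ℤ) : ℝ) := by
        rw [← Int.cast_natCast, Int.toNat_of_nonneg (by omega)]
      rw [this]
      push_cast
      have e1 := Int.floor_le (r / h)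
      have e2 := Int.lt_floor_add_one (-r / h)
      rw [neg_div] at e2 ⊢
      have : 2 * r / h = r / h + r / h := by ring
      linarith
    calc ((F'.image rep).card : ℝ) ≤ F.card := by exact_mod_cast h1
      _ = (((⌊r / h⌋ + 1 - ⌊-r / h⌋).toNat : ℕ) : ℝ) ^ k := by rw [h2]; push_cast; rfl
      _ ≤ _ := by gcongr
  · intro a ha har
    have hcell : ∃ a' ∈ S, cell a' = cell a := ⟨a, ha, rfl⟩
    refine ⟨rep (cell a), Finset.mem_image_of_mem _ (Finset.mem_filter.2 ⟨?_, hcell⟩), ?_⟩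
    · refine Fintype.mem_piFinset.2 fun i => Finset.mem_Icc.2 ?_
      have hi : |a i| ≤ r := (PiLp.norm_apply_le a i).trans har
      rw [abs_le] at hi
      exact ⟨Int.floor_le_floor (by gcongr; exact hi.1), Int.floor_le_floor (by gcongr; exact hi.2)⟩
    · have hrep : cell (rep (cell a)) = cell a := by
        simp only [rep, dif_pos hcell]
        exact hcell.choose_spec.2
      set b := rep (cell a)
      have hcoord : ∀ i, (a i - b i) ^ 2 ≤ h ^ 2 := by
        intro i
        have e : ⌊b i / h⌋ = ⌊a i / h⌋ := congrFun hrep i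
        have := Int.abs_sub_lt_one_of_floor_eq_floor e.symm
        rw [← sub_div, abs_div, abs_of_pos hh, div_lt_one hh] at this
        exact sq_le_sq' (by linarith [neg_abs_le (a i - b i)]) (by linarith [le_abs_self (a i - b i)])
      rw [EuclideanSpace.norm_eq, ← Real.sqrt_sq hh.le, ← Real.sqrt_mul (Nat.cast_nonneg k)]
      refine Real.sqrt_le_sqrt ?_
      calc ∑ i, ‖(a - b) i‖ ^ 2 ≤ ∑ _i : Fin k, h ^ 2 := by
            refine Finset.sum_le_sum fun i _ => ?_
            rw [Real.norm_eq_abs, sq_abs]; exact hcoord i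
        _ = k * h ^ 2 := by simp

end Family

section Net

variable {k : ℕ} {T : ℤ → Param k} {A : Set (Param k)} {ρ L B Λ γ : ℝ}

/-! ### Bounding constants that depend on the family -/

namespace Assumptions

/-- The fluctuation of `a · T` is not constant, so `Λ` is bounded below by a positive constant
depending only on the family. -/
theorem variance_pos (h : Assumptions T A ρ L B Λ γ) {a : Param k} (ha : a ∈ rhoCone ρ A) :
    0 < variance (fun x : ℤ => inner ℝ a (T x)) (expFam T a) := by
  have had := h.admissible ha
  have := had.isProbabilityMeasure
  refine lt_of_le_of_ne (variance_nonneg _ _) fun h0 => ?_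
  have hmem : MemLp (fun x : ℤ => inner ℝ a (T x)) 2 (expFam T a) :=
    (h.covariance a (subset_convexHull ℝ _ ha)).1.const_inner a
  have h1 : evariance (fun x : ℤ => inner ℝ a (T x)) (expFam T a) = 0 := by
    rw [← ofReal_variance hmem, ← h0, ENNReal.ofReal_zero]
  rw [evariance_eq_zero_iff (measurable_of_countable _).aemeasurable] at h1
  obtain ⟨c, hc⟩ : ∃ c : ℝ, (fun x : ℤ => (inner ℝ a (T x) : ℝ)) =ᵐ[expFam T a] fun _ => c :=
    ⟨_, h1⟩
  have hall : ∀ x : ℤ, inner ℝ a (T x) = c := by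
    intro x
    by_contra hx
    have h2 : (expFam T a) {x} = 0 := measure_mono_null (by
      intro y hy
      rw [Set.mem_singleton_iff.1 hy]
      exact hx) hc
    have h3 := had.real_singleton_pos x
    rw [Measure.real, h2] at h3
    simp at h3
  obtain ⟨x, hx⟩ := (had.tendsto.eventually (Filter.eventually_gt_atTop c)).exists
  exact absurd (hall x) hx.ne'

/-- When `ρ` is small, the family contains flat distributions, so that `B` is large. -/
theorem exists_rho_lower_bound (h₀ : Assumptions T A ρ L B Λ γ) (G : ℝ) :
    ∃ r : ℝ, 0 < r ∧ ∀ ρ' L' B' Λ' γ' : ℝ, Assumptions T A ρ' L' B' Λ' γ' → ρ' < r →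
      G ≤ 1 + B' := by
  obtain ⟨a, ha⟩ := h₀.pathConnected.nonempty
  have haC : a ∈ coneHull A := subset_coneHull A ha
  have ha0 : a ≠ 0 := h₀.ne_zero (Or.inl ha)
  obtain ⟨M, -, hM, -⟩ := (h₀.valleyShaped haC ha0).minimizer
  -- for small `s`, the weights of `s • a` at `N` points are almost equal to the weight at the mode
  obtain ⟨N, hN⟩ := exists_nat_gt (10 * G)
  set W : Finset ℤ := Finset.Icc 1 (N : ℤ) with hW
  have hcont : Continuous fun s : ℝ => ∑ x ∈ W, Real.exp (-(s * inner ℝ a (T x - T M))) := by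
    fun_prop
  have h1 : ∀ᶠ s : ℝ in nhds 0, 10 * G < ∑ x ∈ W, Real.exp (-(s * inner ℝ a (T x - T M))) := by
    refine hcont.continuousAt.eventually (lt_mem_nhds ?_)
    simpa [hW] using hN
  obtain ⟨d, hd, hdball⟩ := Metric.eventually_nhds_iff.1 h1
  have hna : 0 < ‖a‖ := norm_pos_iff.2 ha0
  refine ⟨d * ‖a‖, by positivity, fun ρ' L' B' Λ' γ' h hρ' => ?_⟩
  have hρ0 := h.rho_pos
  set s := ρ' / ‖a‖ with hs
  have hs0 : 0 < s := by positivity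
  have hmem : s • a ∈ rhoCone ρ' A :=
    smul_mem_rhoCone haC hs0.le (by rw [hs, div_mul_cancel₀ _ hna.ne'])
  have had := h.admissible hmem
  have := had.isProbabilityMeasure
  have hmode : IsMode (expFam T (s • a)) M := fun x => by
    rw [had.real_le_iff, real_inner_smul_left, real_inner_smul_left]
    exact mul_le_mul_of_nonneg_left (hM x) hs0.le
  have h2 := (h.fourthMomentLE hmem).mode_mass_ge hmode
  have h3 := hdball (y := s) (by
    rw [Real.dist_eq, sub_zero, abs_of_pos hs0, hs, div_lt_iff₀ hna]; exact hρ')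
  have h4 : (expFam T (s • a)).real {M} * ∑ x ∈ W, Real.exp (-(s * inner ℝ a (T x - T M))) ≤ 1 := by
    rw [Finset.mul_sum]
    refine le_trans (Finset.sum_le_sum fun x _ => ?_)
      (sum_le_hasSum W (fun x _ => measureReal_nonneg) (hasSum_real_singleton (expFam T (s • a))))
    rw [had.real_singleton_eq_mul x M, real_inner_smul_left]
  set p := (expFam T (s • a)).real {M}
  have hp : 0 < p := had.real_singleton_pos M
  have h5 : p * (10 * G) ≤ 1 := (mul_le_mul_of_nonneg_left h3.le hp.le).trans h4
  have h6 : p * (10 * G) ≤ p * (10 * (1 + B')) := by linarith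
  linarith [le_of_mul_le_mul_left h6 hp]

/-- Any constant depending only on the family can be absorbed into `R = max 2 (ρ * √Λ / θ)` and
`B`, by choosing `θ` small: `Λ` is bounded below, and `B` is large if `ρ` is small. If `ρ` is
smaller than the value `ρ₀` in some valid choice of constants, the parameter space may be reduced to
the one for `ρ₀`. -/
theorem exists_theta {ρ₀ L₀ B₀ Λ₀ γ₀ : ℝ} (h₀ : Assumptions T A ρ₀ L₀ B₀ Λ₀ γ₀) {K : ℝ}
    (hK : 0 < K) :
    ∃ θ : ℝ, 0 < θ ∧ ∀ ρ L B Λ γ : ℝ, Assumptions T A ρ L B Λ γ →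
      ∃ ρ' Λ' : ℝ, ρ ≤ ρ' ∧ Assumptions T A ρ' L B Λ' γ ∧
        K * √Λ' * (1 + ρ') ≤ max 2 (ρ * √Λ / θ) * (1 + B) := by
  have hρ₀ := h₀.rho_pos
  have hΛ₀ := h₀.Lam_pos
  set G := K * √Λ₀ * (1 + ρ₀) with hG
  have hG0 : 0 < G := by positivity
  obtain ⟨r, hr, hr'⟩ := h₀.exists_rho_lower_bound G
  obtain ⟨a, ha⟩ := h₀.pathConnected.nonempty
  have ha0 : a ≠ 0 := h₀.ne_zero (Or.inl ha)
  have hna : 0 < ‖a‖ := norm_pos_iff.2 ha0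
  set Λm := variance (fun x : ℤ => inner ℝ a (T x)) (expFam T a) / ‖a‖ ^ 2 with hΛm
  have hΛm0 : 0 < Λm := div_pos (h₀.variance_pos (Or.inl ha)) (by positivity)
  have hK' : 0 < K * (1 + 1 / ρ₀) := by positivity
  set θ := min (1 / (K * (1 + 1 / ρ₀))) (r * √Λm / G) with hθ
  have hθ0 : 0 < θ := lt_min (by positivity) (by positivity)
  refine ⟨θ, hθ0, fun ρ L B Λ γ h => ?_⟩
  have hρ := h.rho_pos
  have hB := h.B_pos
  have hΛ := h.Lam_pos
  have hR0 : 0 < max 2 (ρ * √Λ / θ) := lt_of_lt_of_le two_pos (le_max_left _ _)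
  by_cases hcase : ρ₀ ≤ ρ
  · refine ⟨ρ, Λ, le_rfl, h, ?_⟩
    have h1 : (1 + ρ) ≤ (1 + 1 / ρ₀) * ρ := by
      have : 1 ≤ 1 / ρ₀ * ρ := by rw [one_div_mul_eq_div, le_div_iff₀ hρ₀]; linarith
      linarith
    have h2 : K * (1 + 1 / ρ₀) ≤ 1 / θ := by
      rw [le_div_iff₀ hθ0]
      have := min_le_left (1 / (K * (1 + 1 / ρ₀))) (r * √Λm / G)
      rw [← hθ, le_div_iff₀ hK'] at this
      linarith
    calc K * √Λ * (1 + ρ) ≤ K * √Λ * ((1 + 1 / ρ₀) * ρ) := by gcongr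
      _ = (K * (1 + 1 / ρ₀)) * (ρ * √Λ) := by ring
      _ ≤ 1 / θ * (ρ * √Λ) := by gcongr
      _ = ρ * √Λ / θ := by ring
      _ ≤ max 2 (ρ * √Λ / θ) * 1 := by rw [mul_one]; exact le_max_right _ _
      _ ≤ max 2 (ρ * √Λ / θ) * (1 + B) := by gcongr; linarith
  · push Not at hcase
    have hsub := rhoCone_anti (A := A) hcase.le
    refine ⟨ρ₀, Λ₀, hcase.le, ⟨hρ₀, h.L_pos, hB, hΛ₀, h.gamma_pos, h₀.wellDefined, h.isClosed,
      h.polyhedral, h₀.unimodal, fun a ha => h.bounded_modes a (hsub ha),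
      fun a ha => h.fourth_moment a (hsub ha), h₀.covariance, h.pathConnected, h.variance_ge⟩, ?_⟩
    rw [← hG]
    by_cases hsmall : ρ < r
    · have h1 := hr' ρ L B Λ γ h hsmall
      have h2 : (2 : ℝ) ≤ max 2 (ρ * √Λ / θ) := le_max_left _ _
      nlinarith
    · push Not at hsmall
      have h1 : Λm ≤ Λ := by
        rw [hΛm, div_le_iff₀ (by positivity)]
        exact (h.covariance a (subset_convexHull ℝ _ (Or.inl ha))).2 a
      have h2 : G ≤ ρ * √Λ / θ := by
        rw [le_div_iff₀ hθ0]
        have := min_le_right (1 / (K * (1 + 1 / ρ₀))) (r * √Λm / G)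
        rw [← hθ, le_div_iff₀ hG0] at this
        calc G * θ = θ * G := mul_comm _ _
          _ ≤ r * √Λm := this
          _ ≤ ρ * √Λ := by gcongr
      calc G ≤ max 2 (ρ * √Λ / θ) * 1 := by rw [mul_one]; exact h2.trans (le_max_right _ _)
        _ ≤ _ := by gcongr; linarith

/-! ### Nets of the family -/

/-- A net of the family in the Hellinger metric: parameters are truncated to bounded norm, and then
rounded to a grid. The number `θ` absorbs the constants that depend on `T` and `A`, among them the
dimension. -/
theorem exists_net (h₀ : Assumptions T A ρ L B Λ γ) :
    ∃ θ : ℝ, 0 < θ ∧ ∀ ρ L B Λ γ : ℝ, Assumptions T A ρ L B Λ γ → ∀ s : ℝ, 1 ≤ s →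
      ∃ N : Finset (Param k), (∀ b ∈ N, b ∈ rhoCone ρ A) ∧
        (N.card : ℝ) ≤ (3 * max 2 (ρ * √Λ / θ) * (1 + B) ^ 2 * s ^ 3) ^ k ∧
        ∀ a ∈ A, ∃ b ∈ N, 1 - affinity (expFam T a) (expFam T b) ≤ 1 / s ^ 4 := by
  obtain ⟨K, hK1, hK⟩ := exists_small_parameter h₀.polyhedral fun u hu hu0 => h₀.valleyShaped hu hu0
  obtain ⟨θ, hθ0, hθ⟩ := h₀.exists_theta (K := 64 * K ^ 2 * (1 + √k)) (by positivity)
  refine ⟨θ, hθ0, fun ρ L B Λ γ h s hs => ?_⟩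
  obtain ⟨ρ', Λ', hρρ', h', hbound⟩ := hθ ρ L B Λ γ h
  have hρ' := h'.rho_pos
  have hB := h'.B_pos
  have hΛ' := h'.Lam_pos
  obtain ⟨R, hR⟩ : ∃ R, R = max 2 (ρ * √Λ / θ) := ⟨_, rfl⟩
  rw [← hR] at hbound ⊢
  have hR2 : 2 ≤ R := hR ▸ le_max_left _ _
  have hs0 : 0 < s := by linarith
  -- truncation at level `τ` costs at most `1 / (4 * s ^ 4)` in affinity
  set τ := 2 * K * ρ' + 2 * Real.log (40 * (1 + B) * s ^ 4) with hτ
  have hlog0 : 0 ≤ Real.log (40 * (1 + B) * s ^ 4) := by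
    refine Real.log_nonneg ?_
    have : 1 ≤ s ^ 4 := one_le_pow₀ hs
    nlinarith
  have hlog : Real.log (40 * (1 + B) * s ^ 4) ≤ 8 * (1 + B) * s := by
    have h40 : Real.log 40 ≤ 4 := by
      rw [Real.log_le_iff_le_exp (by norm_num)]
      have h1 := Real.exp_one_gt_d9
      have : Real.exp 4 = Real.exp 1 ^ 4 := by rw [← Real.exp_nat_mul]; norm_num
      rw [this]
      calc (40 : ℝ) ≤ 2.7 ^ 4 := by norm_num
        _ ≤ Real.exp 1 ^ 4 := by gcongr; linarith
    rw [Real.log_mul (by positivity) (by positivity), Real.log_mul (by norm_num) (by positivity),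
      Real.log_pow]
    have h1 := Real.log_le_sub_one_of_pos (show 0 < 1 + B by linarith)
    have h2 := Real.log_le_sub_one_of_pos hs0
    push_cast
    nlinarith
  set δ := √k * (s ^ 2 * (√Λ' * (1 + √k)))⁻¹ with hδ
  have hsk : 0 ≤ √(k : ℝ) := Real.sqrt_nonneg _
  have hsΛ : 0 < √Λ' := Real.sqrt_pos.2 hΛ'
  have hKρ : 0 ≤ 2 * K * ρ' := by positivity
  have hr0 : 0 ≤ K * τ := by positivity
  obtain ⟨N, hNS, hcard, hN⟩ := exists_finite_net (rhoCone ρ' A) hr0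
    (h := (s ^ 2 * (√Λ' * (1 + √k)))⁻¹) (by positivity)
  refine ⟨N, fun b hb => rhoCone_anti hρρ' (hNS b hb), hcard.trans ?_, fun a ha => ?_⟩
  · gcongr
    rw [div_inv_eq_mul]
    have h1 : τ ≤ 16 * K * (1 + ρ') * (1 + B) * s := by
      have e1 : 2 * K * ρ' ≤ 16 * K * ρ' * ((1 + B) * s) := by
        have : 1 ≤ (1 + B) * s := one_le_mul_of_one_le_of_one_le (by linarith) hs
        have h5 : 0 ≤ K * ρ' := by positivity
        nlinarith
      have e2 : 16 * (1 + B) * s ≤ K * (16 * (1 + B) * s) :=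
        le_mul_of_one_le_left (by positivity) hK1
      rw [hτ]
      linarith
    calc 2 * (K * τ) * (s ^ 2 * (√Λ' * (1 + √k))) + 2
        ≤ 2 * (K * (16 * K * (1 + ρ') * (1 + B) * s)) * (s ^ 2 * (√Λ' * (1 + √k))) + 2 := by gcongr
      _ = (64 * K ^ 2 * (1 + √k) * √Λ' * (1 + ρ')) * ((1 + B) * s ^ 3) / 2 + 2 := by ring
      _ ≤ (R * (1 + B)) * ((1 + B) * s ^ 3) / 2 + 2 := by gcongr
      _ ≤ 3 * R * (1 + B) ^ 2 * s ^ 3 := by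
        have h3 : 1 ≤ (1 + B) ^ 2 * s ^ 3 :=
          one_le_mul_of_one_le_of_one_le (one_le_pow₀ (by linarith)) (one_le_pow₀ hs)
        have h4 : R * 1 ≤ R * ((1 + B) ^ 2 * s ^ 3) := by gcongr
        nlinarith
  · obtain ⟨a', ha', hnorm, haff⟩ := h'.exists_norm_le hK1 hK (δ := 1 / (4 * s ^ 4)) (τ := τ)
      (by positivity) (by rw [hτ]; linarith) (by
        have : -τ / 2 ≤ -Real.log (40 * (1 + B) * s ^ 4) := by rw [hτ]; linarith
        have h2 := Real.exp_le_exp.2 this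
        rw [Real.exp_neg, Real.exp_log (by positivity)] at h2
        calc 10 * (1 + B) * Real.exp (-τ / 2) ≤ 10 * (1 + B) * (40 * (1 + B) * s ^ 4)⁻¹ := by gcongr
          _ = 1 / (4 * s ^ 4) := by field_simp; norm_num) (Or.inl ha)
    obtain ⟨b, hb, hab⟩ := hN a' ha' hnorm
    refine ⟨b, hb, ?_⟩
    have hbm := hNS b hb
    have := (h'.admissible (Or.inl ha)).isProbabilityMeasure
    have := (h'.admissible ha').isProbabilityMeasure
    have := (h'.admissible hbm).isProbabilityMeasure
    have h1 := one_sub_affinity_triangle (expFam T a) (expFam T a') (expFam T b)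
    have h2 := h'.one_sub_affinity_le ha' hbm
    have hδ1 : δ ≤ (s ^ 2 * √Λ')⁻¹ := by
      rw [hδ, mul_inv, mul_inv, mul_inv]
      have : √(k : ℝ) * (1 + √k)⁻¹ ≤ 1 := by
        rw [← div_eq_mul_inv, div_le_one (by positivity)]; linarith
      calc √(k : ℝ) * ((s ^ 2)⁻¹ * ((√Λ')⁻¹ * (1 + √k)⁻¹))
          = (√(k : ℝ) * (1 + √k)⁻¹) * ((s ^ 2)⁻¹ * (√Λ')⁻¹) := by ring
        _ ≤ 1 * ((s ^ 2)⁻¹ * (√Λ')⁻¹) := by gcongr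
        _ = _ := one_mul _
    have h3 : Λ' * ‖a' - b‖ ^ 2 ≤ 1 / s ^ 4 := by
      calc Λ' * ‖a' - b‖ ^ 2 ≤ Λ' * ((s ^ 2 * √Λ')⁻¹) ^ 2 := by
            gcongr; exact hab.trans hδ1
        _ = Λ' * (s ^ 4 * √Λ' ^ 2)⁻¹ := by rw [inv_pow]; ring_nf
        _ = 1 / s ^ 4 := by rw [Real.sq_sqrt hΛ'.le]; field_simp
    have h4 : 1 / (4 * s ^ 4) = 1 / s ^ 4 / 4 := by ring
    have h5 : 0 < 1 / s ^ 4 := by positivity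
    linarith

end Assumptions

end Net

/-! ### Approximating a long sum by an i.i.d. sum -/

/-- Expectations depend continuously on the distribution in the Hellinger metric, as long as second
moments are bounded. -/
theorem integral_sub_integral_sq_le (μ ν : Measure ℤ) [IsProbabilityMeasure μ]
    [IsProbabilityMeasure ν] {f : ℤ → ℝ} {C : ℝ} (hμ : Integrable (fun x => f x ^ 2) μ)
    (hν : Integrable (fun x => f x ^ 2) ν) (hCμ : ∫ x, f x ^ 2 ∂μ ≤ C) (hCν : ∫ x, f x ^ 2 ∂ν ≤ C) :
    (∫ x, f x ∂μ - ∫ x, f x ∂ν) ^ 2 ≤ 8 * C * (1 - affinity μ ν) := by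
  have int : ∀ ξ : Measure ℤ, IsProbabilityMeasure ξ → Integrable (fun x => f x ^ 2) ξ →
      Integrable f ξ := fun ξ hξ h =>
    ((memLp_two_iff_integrable_sq (measurable_of_countable f).aestronglyMeasurable).2 h).integrable
      (by norm_num)
  have hsub := (hasSum_integral_int μ (int μ inferInstance hμ)).sub
    (hasSum_integral_int ν (int ν inferInstance hν))
  obtain ⟨hs, hle⟩ := tsum_mul_abs_sub_sq_le μ ν (f := fun x => |f x|) (fun x => abs_nonneg _)
    (by simpa using hasSum_integral_int μ hμ) (by simpa using hasSum_integral_int ν hν)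
  have habs : |∫ x, f x ∂μ - ∫ x, f x ∂ν| ≤ ∑' x, |f x| * |μ.real {x} - ν.real {x}| := by
    rw [← hsub.tsum_eq, ← Real.norm_eq_abs]
    have e : ∀ x, ‖f x * μ.real {x} - f x * ν.real {x}‖ = |f x| * |μ.real {x} - ν.real {x}| :=
      fun x => by rw [← mul_sub, norm_mul, Real.norm_eq_abs, Real.norm_eq_abs]
    calc _ ≤ ∑' x, ‖f x * μ.real {x} - f x * ν.real {x}‖ :=
          norm_tsum_le_tsum_norm (by simpa only [e] using hs)
      _ = _ := tsum_congr e
  have haff := affinity_le_one μ ν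
  calc (∫ x, f x ∂μ - ∫ x, f x ∂ν) ^ 2 = |∫ x, f x ∂μ - ∫ x, f x ∂ν| ^ 2 := (sq_abs _).symm
    _ ≤ _ := pow_le_pow_left₀ (abs_nonneg _) habs 2
    _ ≤ 4 * (1 - affinity μ ν) * (∫ x, f x ^ 2 ∂μ + ∫ x, f x ^ 2 ∂ν) := hle
    _ ≤ 4 * (1 - affinity μ ν) * (C + C) := by
      gcongr
    _ = _ := by ring

namespace Assumptions

variable {k : ℕ} {T : ℤ → Param k} {A : Set (Param k)} {ρ L B Λ γ : ℝ}

theorem continuousOn_integral (h : Assumptions T A ρ L B Λ γ) {f : ℤ → ℝ} {C : ℝ}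
    (hf : ∀ a ∈ A, Integrable (fun x => f x ^ 2) (expFam T a) ∧ ∫ x, f x ^ 2 ∂(expFam T a) ≤ C) :
    ContinuousOn (fun a => ∫ x, f x ∂(expFam T a)) A := by
  rcases A.eq_empty_or_nonempty with rfl | ⟨a₀, ha₀⟩
  · exact continuousOn_empty _
  have hC : 0 ≤ C := (integral_nonneg fun x => sq_nonneg (f x)).trans (hf a₀ ha₀).2
  have hΛ := h.Lam_pos
  refine (LipschitzOnWith.of_dist_le_mul (K := (√(C * Λ)).toNNReal) fun a ha b hb => ?_).continuousOn
  have := (h.admissible (Or.inl ha)).isProbabilityMeasure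
  have := (h.admissible (Or.inl hb)).isProbabilityMeasure
  rw [Real.coe_toNNReal _ (Real.sqrt_nonneg _), Real.dist_eq, dist_eq_norm]
  refine abs_le_of_sq_le_sq ?_ (by positivity)
  rw [mul_pow, Real.sq_sqrt (by positivity)]
  have h1 := integral_sub_integral_sq_le _ _ (hf a ha).1 (hf b hb).1 (hf a ha).2 (hf b hb).2
  have h2 := h.one_sub_affinity_le (Or.inl ha) (Or.inl hb)
  have h3 : 8 * C * (1 - affinity (expFam T a) (expFam T b)) ≤ 8 * C * (Λ * ‖a - b‖ ^ 2 / 8) := by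
    gcongr
  linarith

theorem continuousOn_mean_var (h : Assumptions T A ρ L B Λ γ) :
    ContinuousOn (fun a => mean (expFam T a)) A ∧ ContinuousOn (fun a => var (expFam T a)) A := by
  have hB := h.B_pos
  have hL := h.L_pos
  set E := L + 12 * (1 + B) with hE
  have hE0 : 0 ≤ E := by positivity
  have hmean : ∀ a ∈ A, |mean (expFam T a)| ≤ E := fun a ha => h.abs_mean_le (Or.inl ha)
  have hm : ContinuousOn (fun a => mean (expFam T a)) A := by
    refine h.continuousOn_integral (C := 1 + B + E ^ 2) fun a ha => ?_
    have hF := h.fourthMomentLE (Or.inl ha)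
    have e1 := hF.integrable_sq 0
    have e2 := hF.integral_sq_eq 0
    simp only [sub_zero] at e1 e2
    refine ⟨e1, ?_⟩
    rw [e2]
    have := hF.var_le
    have := sq_le_sq.2 ((hmean a ha).trans (le_abs_self E))
    linarith
  have hs : ContinuousOn (fun a => ∫ x : ℤ, (x : ℝ) ^ 2 ∂(expFam T a)) A := by
    refine h.continuousOn_integral (C := 8 * (B + E ^ 4)) fun a ha => ?_
    have hF := h.fourthMomentLE (Or.inl ha)
    have e1 := hF.integrable_pow_four 0
    have e2 := hF.integral_pow_four_le 0
    have e : ∀ x : ℤ, ((x : ℝ) ^ 2) ^ 2 = ((x : ℝ) - 0) ^ 4 := fun x => by ring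
    simp only [e]
    refine ⟨e1, e2.trans ?_⟩
    have h4 : (mean (expFam T a) - 0) ^ 4 ≤ E ^ 4 := by
      rw [sub_zero, ← Even.pow_abs (by decide)]
      exact pow_le_pow_left₀ (abs_nonneg _) (hmean a ha) 4
    linarith
  refine ⟨hm, (hs.sub (hm.pow 2)).congr fun a ha => ?_⟩
  have e2 := (h.fourthMomentLE (Or.inl ha)).integral_sq_eq 0
  simp only [sub_zero] at e2
  simp only [Pi.sub_apply, Pi.pow_apply]
  linarith

/-- The parameter space contains a member whose ratio of mean and variance is that of a given
sum: the ratios of the summands lie on both sides, and the parameter space is connected. -/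
theorem exists_matching_parameter (h : Assumptions T A ρ L B Λ γ) {m : ℕ} (hm : 1 ≤ m)
    (a : Fin m → Param k) (ha : ∀ i, a i ∈ A) :
    ∃ b ∈ A, mean (expFam T b) * ∑ i, var (expFam T (a i))
      = (∑ i, mean (expFam T (a i))) * var (expFam T b) := by
  set V := ∑ i, var (expFam T (a i)) with hV
  set μ := ∑ i, mean (expFam T (a i)) with hμ
  obtain ⟨hcm, hcv⟩ := h.continuousOn_mean_var
  have hsum : ∑ i, (mean (expFam T (a i)) * V - μ * var (expFam T (a i))) = 0 := by
    rw [Finset.sum_sub_distrib, ← Finset.sum_mul, ← Finset.mul_sum]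
    exact sub_self _
  have hne : (Finset.univ : Finset (Fin m)).Nonempty := ⟨⟨0, hm⟩, Finset.mem_univ _⟩
  obtain ⟨i, -, hi⟩ := Finset.exists_le_of_sum_le (s := Finset.univ) (g := fun _ : Fin m => (0 : ℝ))
    hne (by rw [hsum, Finset.sum_const_zero])
  obtain ⟨j, -, hj⟩ := Finset.exists_le_of_sum_le (s := Finset.univ) (f := fun _ : Fin m => (0 : ℝ))
    hne (by rw [hsum, Finset.sum_const_zero])
  obtain ⟨b, hb, hb'⟩ := h.pathConnected.isConnected.isPreconnected.intermediate_value₂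
    (ha i) (ha j) (hcm.mul (continuousOn_const (c := V))) ((continuousOn_const (c := μ)).mul hcv)
    (by simpa using hi) (by simpa using hj)
  exact ⟨b, hb, hb'⟩

/-- A long sum is close to an i.i.d. sum with almost the same mean and variance, as both are close
to the same shifted binomial distribution. -/
theorem exists_iid_tvDist_le (h : Assumptions T A ρ L B Λ γ) {ε K : ℝ} (hε0 : 0 < ε) (hε1 : ε < 1)
    (hK : 10 ^ 20 ≤ K) {m : ℕ} (a : Fin m → Param k) (ha : ∀ i, a i ∈ A)
    (hm : (10 ^ 6 * K ^ 4 * ((1 + B) * (1 + 1 / γ) * (20 * (1 + B) * (1 + L))) ^ 53 *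
      (1 + Real.log (1 / ε)) / ε ^ 2 + 1) * ((1 + B) * (1 + 1 / γ)) ≤ m) :
    ∃ b ∈ A, ∃ m' : ℕ, 1 ≤ m' ∧ (m' : ℝ) ≤ m * ((1 + B) / γ) ∧
      tvDist (sumLaw T a) (sumLaw T fun _ : Fin m' => b) ≤ 2 * ε := by
  have hB := h.B_pos
  have hL := h.L_pos
  have hγ := h.gamma_pos
  obtain ⟨D, hD⟩ : ∃ D, D = 20 * (1 + B) * (1 + L) := ⟨_, rfl⟩
  rw [← hD] at hm
  have hlog : 0 ≤ Real.log (1 / ε) := Real.log_nonneg (by rw [le_div_iff₀ hε0]; linarith)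
  have hK0 : 0 ≤ K := le_trans (by positivity) hK
  obtain ⟨U, hU0, hmU, hU⟩ : ∃ U : ℝ, 0 ≤ U ∧ (U + 1) * ((1 + B) * (1 + 1 / γ)) ≤ m ∧
      ∀ x : ℝ, U ≤ x → 10 ^ 6 * K ^ 4 * ((1 + B) * (1 + 1 / γ) * D) ^ 53 *
        (1 + Real.log (1 / ε)) / ε ^ 2 ≤ x :=
    ⟨_, by rw [hD]; positivity, hm, fun x hx => hx⟩
  clear hm
  have hBL : 0 < B * L := mul_pos hB hL
  have hD1 : 1 ≤ D := by rw [hD]; nlinarith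
  have hDE : L + 12 * (1 + B) + 1 ≤ D := by
    have : D = 20 + 20 * B + 20 * L + 20 * (B * L) := by rw [hD]; ring
    linarith only [this, hB, hL, hBL]
  have hγ1 : 0 < 1 / γ := by positivity
  have hm_large : U + 1 ≤ m := by
    refine le_trans (le_mul_of_one_le_right (by linarith) ?_) hmU
    exact one_le_mul_of_one_le_of_one_le (by linarith) (by linarith)
  have hm0 : (0 : ℝ) < m := by linarith only [hm_large, hU0]
  have hm1 : 1 ≤ m := by exact_mod_cast (show (1 : ℝ) ≤ m by linarith)
  obtain ⟨b, hb, hmatch⟩ := h.exists_matching_parameter hm1 a ha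
  obtain ⟨V, hV⟩ : ∃ V, V = ∑ i, var (expFam T (a i)) := ⟨_, rfl⟩
  obtain ⟨μ, hμ⟩ : ∃ μ, μ = ∑ i, mean (expFam T (a i)) := ⟨_, rfl⟩
  obtain ⟨v, hv⟩ : ∃ v, v = var (expFam T b) := ⟨_, rfl⟩
  obtain ⟨e, he⟩ : ∃ e, e = mean (expFam T b) := ⟨_, rfl⟩
  rw [← hV, ← hμ, ← hv, ← he] at hmatch
  have hFb := h.fourthMomentLE (Or.inl hb)
  have hvγ : γ ≤ v := hv ▸ h.variance_ge b hb
  have hvB : v ≤ 1 + B := hv ▸ hFb.var_le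
  have hv0 : 0 < v := hγ.trans_le hvγ
  have hVlow : m * γ ≤ V := by
    rw [hV]
    calc (m : ℝ) * γ = ∑ _i : Fin m, γ := by simp
      _ ≤ _ := Finset.sum_le_sum fun i _ => h.variance_ge _ (ha i)
  have hVup : V ≤ m * (1 + B) := by
    rw [hV]
    calc _ ≤ ∑ _i : Fin m, (1 + B) :=
          Finset.sum_le_sum fun i _ => (h.fourthMomentLE (Or.inl (ha i))).var_le
      _ = m * (1 + B) := by
          rw [Finset.sum_const, Finset.card_univ, Fintype.card_fin, nsmul_eq_mul]
  have hV0 : 0 < V := (mul_pos hm0 hγ).trans_le hVlow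
  have hratio0 : 0 ≤ V / v := by positivity
  have hratio : U + 1 ≤ V / v := by
    rw [le_div_iff₀ hv0]
    calc (U + 1) * v ≤ (U + 1) * (1 + B) := by gcongr
      _ ≤ (U + 1) * (1 + B) * (γ + 1) := le_mul_of_one_le_right (by positivity) (by linarith)
      _ = (U + 1) * ((1 + B) * (1 + 1 / γ)) * γ := by field_simp
      _ ≤ m * γ := by gcongr
      _ ≤ V := hVlow
  -- rounding the number of summands changes the mean and the variance by at most `|e|` and `v`
  set m' := ⌊V / v⌋₊ with hm'
  have hfl := Nat.floor_le hratio0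
  have hlt := Nat.lt_floor_add_one (V / v)
  rw [← hm'] at hfl hlt
  have hm'U : U ≤ m' := by linarith
  have hm'1 : 1 ≤ m' := by
    have : (0 : ℝ) < m' := by linarith
    exact_mod_cast this
  have hVv : V / v * v = V := div_mul_cancel₀ _ hv0.ne'
  have hμe : μ = V / v * e := by
    rw [div_mul_eq_mul_div, eq_div_iff hv0.ne', ← hmatch, mul_comm]
  have heb : |e| ≤ L + 12 * (1 + B) := he ▸ h.abs_mean_le (Or.inl hb)
  set N := ⌊4 * V⌋₊ with hN
  have hN1 := Nat.floor_le (show 0 ≤ 4 * V by linarith)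
  have hN2 := Nat.lt_floor_add_one (4 * V)
  rw [← hN] at hN1 hN2
  set c := ⌊μ - N / 2⌋ with hc
  have hc1 := Int.floor_le (μ - N / 2)
  have hc2 := Int.lt_floor_add_one (μ - N / 2)
  rw [← hc] at hc1 hc2
  have hlen : |(m' : ℝ) - V / v| ≤ 1 := by rw [abs_le]; constructor <;> linarith
  have hmeanb : |(m' : ℝ) * e - (c + N / 2)| ≤ D := by
    have h1 : |(m' : ℝ) * e - μ| ≤ L + 12 * (1 + B) := by
      rw [hμe, ← sub_mul, abs_mul]
      calc _ ≤ 1 * |e| := by gcongr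
        _ ≤ _ := by rw [one_mul]; exact heb
    rw [abs_le] at h1 ⊢
    constructor <;> linarith only [h1.1, h1.2, hc1, hc2, hDE]
  have hvarb : |(m' : ℝ) * v - N / 4| ≤ D := by
    have h1 : |(m' : ℝ) * v - V| ≤ 1 + B := by
      rw [← hVv, ← sub_mul, abs_mul, abs_of_pos hv0]
      calc _ ≤ 1 * v := by gcongr
        _ ≤ _ := by rw [one_mul]; exact hvB
    rw [abs_le] at h1 ⊢
    constructor <;> linarith only [h1.1, h1.2, hN1, hN2, hDE, hL, hB]
  have t1 := tvDist_indepSum_binomial_le (fun i => expFam T (a i)) (D := D) (ε := ε) (K := K)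
    (fun i => h.fourthMomentLE (Or.inl (ha i))) (fun i => h.unimodal _ (Or.inl (ha i))) hγ
    (fun i => h.variance_ge _ (ha i)) hD1 N c
    (by rw [← hμ, abs_le]; constructor <;> linarith only [hc1, hc2, hD1])
    (by rw [← hV, abs_le]; constructor <;> linarith only [hN1, hN2, hD1]) hε0 hε1 hB.le hK
    (hU _ (by linarith))
  have t2 := tvDist_indepSum_binomial_le (fun _ : Fin m' => expFam T b) (D := D) (ε := ε) (K := K)
    (fun _ => hFb) (fun _ => h.unimodal _ (Or.inl hb)) hγ (fun _ => hv ▸ hvγ) hD1 N c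
    (by simpa [← he] using hmeanb) (by simpa [← hv] using hvarb) hε0 hε1 hB.le hK (hU _ hm'U)
  have : ∀ i, IsProbabilityMeasure (expFam T (a i)) :=
    fun i => (h.admissible (Or.inl (ha i))).isProbabilityMeasure
  have := hFb.prob
  refine ⟨b, hb, m', hm'1, ?_, ?_⟩
  · refine hfl.trans ?_
    calc V / v ≤ (m * (1 + B)) / γ := by gcongr
      _ = _ := by ring
  · rw [sumLaw_eq_indepSum, sumLaw_eq_indepSum]
    have := tvDist_triangle (indepSum fun i => expFam T (a i)) (shiftedBinomial N c)
      (indepSum fun _ : Fin m' => expFam T b)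
    rw [tvDist_comm (shiftedBinomial N c)] at this
    linarith

end Assumptions

/-! ### The candidate sets -/

section Candidates

variable {k : ℕ} {T : ℤ → Param k} {A : Set (Param k)} {ρ L B Λ γ : ℝ}

/-- In dimension `0` no parameter has a finite partition function. -/
theorem Assumptions.dim_pos (h : Assumptions T A ρ L B Λ γ) : 1 ≤ k := by
  obtain ⟨a, ha⟩ := h.pathConnected.nonempty
  have ha0 := h.ne_zero (Or.inl ha)
  by_contra hk
  obtain rfl : k = 0 := by omega
  exact ha0 (Subsingleton.elim _ _)

/-- Replacing all parameters by neighbours in a net changes the sum little. -/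
theorem tvDist_sumLaw_sq_le {m : ℕ} {a b : Fin m → Param k} (ha : ∀ i, Admissible T (a i))
    (hb : ∀ i, Admissible T (b i)) {δ : ℝ}
    (hab : ∀ i, 1 - affinity (expFam T (a i)) (expFam T (b i)) ≤ δ) :
    tvDist (sumLaw T a) (sumLaw T b) ^ 2 ≤ 2 * (m * δ) := by
  have := fun i => (ha i).isProbabilityMeasure
  have := fun i => (hb i).isProbabilityMeasure
  rw [sumLaw_eq_indepSum, sumLaw_eq_indepSum]
  refine (tvDist_sq_le _ _).trans (mul_le_mul_of_nonneg_left ?_ two_pos.le)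
  refine (one_sub_affinity_indepSum_le _ _).trans ((Finset.sum_le_sum fun i _ => hab i).trans ?_)
  simp

/-- All sums of at most `min n n₀` variables with parameters in the net. -/
theorem exists_sparse_candidates (N : Finset (Param k)) (hN : ∀ b ∈ N, b ∈ rhoCone ρ A) {W : ℝ}
    (hW : 1 ≤ W) (hcard : (N.card : ℝ) ≤ W) (n n₀ : ℕ) :
    ∃ S : Finset (Measure ℤ), (∀ Y ∈ S, IsSIIRV T (rhoCone ρ A) n Y) ∧
      (S.card : ℝ) ≤ n₀ * W ^ n₀ ∧ ∀ m : ℕ, 1 ≤ m → m ≤ n → m ≤ n₀ →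
        ∀ f : Fin m → Param k, (∀ i, f i ∈ N) → sumLaw T f ∈ S := by
  classical
  refine ⟨(Finset.Icc 1 (min n n₀)).biUnion fun m =>
    (Fintype.piFinset fun _ : Fin m => N).image (sumLaw T), ?_, ?_, ?_⟩
  · intro Y hY
    obtain ⟨m, hm, hY⟩ := Finset.mem_biUnion.1 hY
    obtain ⟨f, hf, rfl⟩ := Finset.mem_image.1 hY
    rw [Finset.mem_Icc] at hm
    exact ⟨m, hm.1, hm.2.trans (min_le_left _ _), f,
      fun i => hN _ (Fintype.mem_piFinset.1 hf i), rfl⟩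
  · have h1 : ((Finset.Icc 1 (min n n₀)).biUnion fun m =>
        (Fintype.piFinset fun _ : Fin m => N).image (sumLaw T)).card
        ≤ ∑ m ∈ Finset.Icc 1 (min n n₀), N.card ^ m := by
      refine Finset.card_biUnion_le.trans (Finset.sum_le_sum fun m _ => ?_)
      refine Finset.card_image_le.trans ?_
      simp [Fintype.card_piFinset]
    have h2 : ∑ m ∈ Finset.Icc 1 (min n n₀), (N.card : ℝ) ^ m
        ≤ ∑ _m ∈ Finset.Icc 1 (min n n₀), W ^ n₀ := by
      refine Finset.sum_le_sum fun m hm => ?_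
      rw [Finset.mem_Icc] at hm
      exact (pow_le_pow_left₀ (Nat.cast_nonneg _) hcard m).trans
        (pow_le_pow_right₀ hW (hm.2.trans (min_le_right _ _)))
    have h3 : ((min n n₀ : ℕ) : ℝ) ≤ n₀ := by exact_mod_cast min_le_right n n₀
    calc _ ≤ ∑ m ∈ Finset.Icc 1 (min n n₀), (N.card : ℝ) ^ m := by exact_mod_cast h1
      _ ≤ _ := h2
      _ = ((min n n₀ : ℕ) : ℝ) * W ^ n₀ := by
        rw [Finset.sum_const, Nat.card_Icc, nsmul_eq_mul, Nat.add_sub_cancel]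
      _ ≤ _ := by gcongr
  · intro m hm1 hmn hmn₀ f hf
    exact Finset.mem_biUnion.2 ⟨m, Finset.mem_Icc.2 ⟨hm1, le_min hmn hmn₀⟩,
      Finset.mem_image_of_mem _ (Fintype.mem_piFinset.2 hf)⟩

/-- All sums of at most `M` i.i.d. variables with parameter in the net. -/
theorem exists_dense_candidates (N : Finset (Param k)) (hN : ∀ b ∈ N, b ∈ rhoCone ρ A) (M : ℕ) :
    ∃ D : Finset (Measure ℤ), (∀ Y ∈ D, IsIIDSum T (rhoCone ρ A) Y) ∧
      D.card ≤ M * N.card ∧ ∀ m : ℕ, 1 ≤ m → m ≤ M → ∀ b ∈ N,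
        sumLaw T (fun _ : Fin m => b) ∈ D := by
  classical
  refine ⟨(Finset.Icc 1 M ×ˢ N).image fun p => sumLaw T fun _ : Fin p.1 => p.2, ?_, ?_, ?_⟩
  · intro Y hY
    obtain ⟨p, hp, rfl⟩ := Finset.mem_image.1 hY
    rw [Finset.mem_product, Finset.mem_Icc] at hp
    exact ⟨p.1, hp.1.1, p.2, hN _ hp.2, rfl⟩
  · refine Finset.card_image_le.trans ?_
    simp
  · intro m hm1 hmM b hb
    exact Finset.mem_image.2 ⟨(m, b),
      Finset.mem_product.2 ⟨Finset.mem_Icc.2 ⟨hm1, hmM⟩, hb⟩, rfl⟩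

theorem one_le_one_add_log {ε : ℝ} (hε0 : 0 < ε) (hε1 : ε < 1) : 1 ≤ 1 + Real.log (1 / ε) := by
  have := Real.log_nonneg (show 1 ≤ 1 / ε by rw [le_div_iff₀ hε0]; linarith)
  linarith

/-- The number of summands above which a sum is close to an i.i.d. sum. -/
theorem exists_length_threshold : ∃ Z : ℝ, 1 ≤ Z ∧ ∀ (k : ℕ) (T : ℤ → Param k)
    (A : Set (Param k)) (ρ L B Λ γ : ℝ), Assumptions T A ρ L B Λ γ → ∀ ε : ℝ, 0 < ε → ε < 1 →
      ∀ (m : ℕ) (a : Fin m → Param k), (∀ i, a i ∈ A) →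
        Z * ((1 + B) * (1 + L) * (1 + 1 / γ)) ^ 107 * (1 + Real.log (1 / ε)) / ε ^ 2 ≤ m →
        ∃ b ∈ A, ∃ m' : ℕ, 1 ≤ m' ∧ (m' : ℝ) ≤ m * ((1 + B) / γ) ∧
          tvDist (sumLaw T a) (sumLaw T fun _ : Fin m' => b) ≤ ε / 2 := by
  obtain ⟨K, hK⟩ : ∃ K : ℝ, 10 ^ 20 ≤ K := ⟨_, le_rfl⟩
  have hK0 : 0 ≤ K := le_trans (by positivity) hK
  obtain ⟨Y, hY0, hY⟩ : ∃ Y : ℝ, 0 ≤ Y ∧ Y = 10 ^ 6 * K ^ 4 * 20 ^ 53 := ⟨_, by positivity, rfl⟩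
  refine ⟨48 * Y + 1, by linarith, fun k T A ρ L B Λ γ h ε hε0 hε1 m a ha hm => ?_⟩
  have hB := h.B_pos
  have hL := h.L_pos
  have hγ := h.gamma_pos
  have hγ' : 0 < 1 / γ := by positivity
  obtain ⟨Γ, hΓ⟩ : ∃ Γ, Γ = (1 + B) * (1 + L) * (1 + 1 / γ) := ⟨_, rfl⟩
  obtain ⟨ℓ, hℓ⟩ : ∃ ℓ, ℓ = 1 + Real.log (1 / ε) := ⟨_, rfl⟩
  have hℓ1 : 1 ≤ ℓ := hℓ ▸ one_le_one_add_log hε0 hε1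
  have hlog : 1 + Real.log (1 / (ε / 4)) ≤ 3 * ℓ := by
    have h4 : Real.log 4 ≤ 2 := by
      have e : (4 : ℝ) = 2 ^ 2 := by norm_num
      rw [e, Real.log_pow]
      have := Real.log_two_lt_d9
      push_cast
      linarith
    have e : 1 / (ε / 4) = 4 * (1 / ε) := by field_simp
    rw [e, Real.log_mul (by norm_num) (by positivity)]
    linarith
  have hlog0 : 0 ≤ 1 + Real.log (1 / (ε / 4)) :=
    zero_le_one.trans (one_le_one_add_log (by positivity) (by linarith))
  have hBg : 1 ≤ (1 + B) * (1 + 1 / γ) := one_le_mul_of_one_le_of_one_le (by linarith) (by linarith)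
  have hBgΓ : (1 + B) * (1 + 1 / γ) ≤ Γ := by
    rw [hΓ, mul_right_comm]
    exact le_mul_of_one_le_right (by linarith) (by linarith)
  have hΓ1 : 1 ≤ Γ := hBg.trans hBgΓ
  have hprod : (1 + B) * (1 + 1 / γ) * (20 * (1 + B) * (1 + L)) ≤ 20 * Γ ^ 2 := by
    have e : (1 + B) * (1 + 1 / γ) * (20 * (1 + B) * (1 + L)) = 20 * ((1 + B) * Γ) := by
      rw [hΓ]; ring
    have h1 : 1 + B ≤ Γ := le_trans (le_mul_of_one_le_right (by linarith) (by linarith)) hBgΓ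
    rw [e, sq]
    gcongr
  obtain ⟨b, hb, m', h1, h2, h3⟩ := h.exists_iid_tvDist_le (ε := ε / 4) (by positivity)
    (by linarith) hK a ha (by
      rw [← hΓ, ← hℓ] at hm
      refine le_trans ?_ hm
      have h0 : 10 ^ 6 * K ^ 4 * ((1 + B) * (1 + 1 / γ) * (20 * (1 + B) * (1 + L))) ^ 53 *
          (1 + Real.log (1 / (ε / 4))) / (ε / 4) ^ 2
          ≤ 10 ^ 6 * K ^ 4 * (20 * Γ ^ 2) ^ 53 * (3 * ℓ) / (ε / 4) ^ 2 := by gcongr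
      have e1 : 10 ^ 6 * K ^ 4 * (20 * Γ ^ 2) ^ 53 * (3 * ℓ) / (ε / 4) ^ 2
          = 48 * Y * Γ ^ 106 * ℓ / ε ^ 2 := by
        rw [hY, mul_pow, ← pow_mul, div_pow]
        field_simp
        norm_num
        ring
      rw [e1] at h0
      have h4 : 1 ≤ Γ ^ 106 * ℓ / ε ^ 2 := by
        rw [le_div_iff₀ (by positivity), one_mul]
        have h5 : 1 ≤ Γ ^ 106 * ℓ := one_le_mul_of_one_le_of_one_le (one_le_pow₀ hΓ1) hℓ1
        have h6 : ε ^ 2 ≤ 1 := pow_le_one₀ hε0.le hε1.le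
        linarith
      calc _ ≤ (48 * Y * Γ ^ 106 * ℓ / ε ^ 2 + Γ ^ 106 * ℓ / ε ^ 2) * Γ := by gcongr
        _ = _ := by ring)
  exact ⟨b, hb, m', h1, h2, by linarith⟩

/-- The sparse bound: powers of the size of a net, with the logarithms of the accuracy and of the
number of summands moved to the exponent. -/
theorem sparse_count_le {R w Γ ℓ Z ε s B : ℝ} {k n₀ : ℕ} (hk : 1 ≤ k) (hR : 2 ≤ R) (hZ : 1 ≤ Z)
    (hB : 0 ≤ B) (hBΓ : 1 + B ≤ Γ) (hℓ1 : 1 ≤ ℓ) (hℓ : ℓ = 1 + Real.log (1 / ε)) (hε0 : 0 < ε)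
    (hs : 1 ≤ s) (hs4 : s ^ 4 = 2 * (2 * Z * Γ ^ 107 * ℓ / ε ^ 2) / ε ^ 2)
    (hn₀ : (n₀ : ℝ) ≤ 2 * Z * Γ ^ 107 * ℓ / ε ^ 2) (hw : w = 3 * R * (1 + B) ^ 2 * s ^ 3) :
    (n₀ : ℝ) * (w ^ k) ^ n₀
      ≤ R ^ ((k : ℝ) * (6 * Z * (24 * Z + 114) * (1 / ε ^ 2) * ℓ ^ 2) * Γ ^ 108) := by
  have hΓ1 : 1 ≤ Γ := by linarith
  have hw0 : 0 ≤ w := by rw [hw]; positivity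
  set Y := (24 * Z + 114) * (Γ * ℓ) with hY
  have hΓℓ : 1 ≤ Γ * ℓ := one_le_mul_of_one_le_of_one_le hΓ1 hℓ1
  have hY1 : 1 ≤ Y := by nlinarith
  have h1 : 6 * (1 + B) ^ 2 * s ^ 3 ≤ 24 * Z * Γ ^ 109 * ℓ * (1 / ε) ^ 4 := by
    calc 6 * (1 + B) ^ 2 * s ^ 3 ≤ 6 * Γ ^ 2 * s ^ 4 := by
          gcongr
          norm_num
      _ = _ := by rw [hs4]; field_simp; norm_num
  have h2 : 24 * Z * Γ ^ 109 * ℓ * (1 / ε) ^ 4 ≤ Real.exp Y := by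
    have hpos : 0 < 24 * Z * Γ ^ 109 * ℓ * (1 / ε) ^ 4 := by positivity
    rw [← Real.log_le_iff_le_exp hpos, Real.log_mul (by positivity) (by positivity),
      Real.log_mul (by positivity) (by positivity), Real.log_mul (by positivity) (by positivity),
      Real.log_pow, Real.log_pow]
    have e1 := Real.log_le_sub_one_of_pos (show 0 < 24 * Z by positivity)
    have e2 := Real.log_le_sub_one_of_pos (show 0 < Γ by positivity)
    have e3 := Real.log_le_sub_one_of_pos (show 0 < ℓ by positivity)
    have e4 : Real.log (1 / ε) = ℓ - 1 := by rw [hℓ]; ring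
    rw [e4]
    have f1 : Γ ≤ Γ * ℓ := le_mul_of_one_le_right (by linarith) hℓ1
    have f2 : ℓ ≤ Γ * ℓ := le_mul_of_one_le_left (by linarith) hΓ1
    have f3 : 24 * Z ≤ 24 * Z * (Γ * ℓ) := le_mul_of_one_le_right (by positivity) hΓℓ
    have f4 : Y = 24 * Z * (Γ * ℓ) + 114 * (Γ * ℓ) := by rw [hY]; ring
    push_cast
    linarith
  have h3 : Real.exp Y ≤ R ^ (2 * Y) := by
    rw [Real.rpow_def_of_pos (by linarith), Real.exp_le_exp]
    have := Real.log_two_gt_d9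
    have h4 : Real.log 2 ≤ Real.log R := Real.log_le_log two_pos hR
    nlinarith
  have h5 : 2 * w ≤ R ^ (3 * Y) := by
    calc 2 * w = R * (6 * (1 + B) ^ 2 * s ^ 3) := by rw [hw]; ring
      _ ≤ R * R ^ (2 * Y) := by gcongr; exact (h1.trans h2).trans h3
      _ = R ^ (1 + 2 * Y) := by rw [Real.rpow_add (by linarith), Real.rpow_one]
      _ ≤ _ := Real.rpow_le_rpow_of_exponent_le (by linarith) (by linarith)
  have h6 : (n₀ : ℝ) ≤ 2 ^ (k * n₀) := by
    have : n₀ ≤ 2 ^ (k * n₀) :=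
      Nat.lt_two_pow_self.le.trans (Nat.pow_le_pow_right (by norm_num) (Nat.le_mul_of_pos_left _ hk))
    exact_mod_cast this
  calc (n₀ : ℝ) * (w ^ k) ^ n₀ ≤ 2 ^ (k * n₀) * (w ^ k) ^ n₀ := by gcongr
    _ = (2 * w) ^ (k * n₀) := by rw [← pow_mul, mul_pow]
    _ ≤ (R ^ (3 * Y)) ^ (k * n₀) := by gcongr
    _ = R ^ (3 * Y * (k * n₀ : ℕ)) := by rw [Real.rpow_mul_natCast (by linarith)]
    _ ≤ _ := by
      refine Real.rpow_le_rpow_of_exponent_le (by linarith) ?_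
      push_cast
      calc 3 * Y * (k * n₀) ≤ 3 * Y * (k * (2 * Z * Γ ^ 107 * ℓ / ε ^ 2)) := by gcongr
        _ = _ := by rw [hY]; ring

/-- The dense bound: since `n ≥ 1 / ε ^ 2`, the accuracy needed for up to `n` summands costs at most
a factor `n / ε` per coordinate. -/
theorem dense_count_le {R ε s B g : ℝ} {k n M c : ℕ} (hk : 1 ≤ k) (hR : 2 ≤ R) (hB : 0 ≤ B)
    (hg : 0 ≤ g) (hε0 : 0 < ε) (hs : 1 ≤ s) (hs4 : s ^ 4 = 8 * (n * ((1 + B) * (1 + g))) / ε ^ 2)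
    (hn : 1 / ε ^ 2 ≤ n) (hn1 : 1 ≤ n) (hM : (M : ℝ) ≤ n * ((1 + B) * (1 + g)))
    (hc : (c : ℝ) ≤ (3 * R * (1 + B) ^ 2 * s ^ 3) ^ k) :
    (M : ℝ) * c ≤ ((n : ℝ) ^ 2 * ((1 + B) ^ 4 * (1 + g) ^ 2) * (24 * (R / ε))) ^ k := by
  set G := (1 + B) * (1 + g) with hG
  have hG1 : 1 ≤ G := one_le_mul_of_one_le_of_one_le (by linarith) (by linarith)
  have hn1' : (1 : ℝ) ≤ n := by exact_mod_cast hn1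
  have hnG : 1 ≤ n * G := one_le_mul_of_one_le_of_one_le hn1' hG1
  have hs3 : s ^ 3 ≤ 8 * (n * G) / ε := by
    refine le_of_pow_le_pow_left₀ (n := 4) (by norm_num) (by positivity) ?_
    calc (s ^ 3) ^ 4 = (s ^ 4) ^ 3 := by ring
      _ = 512 * (n * G) ^ 3 * (1 / ε ^ 2) / ε ^ 4 := by rw [hs4]; field_simp; norm_num
      _ ≤ 4096 * (n * G) ^ 3 * (n * G) / ε ^ 4 := by
        gcongr
        · norm_num
        · exact hn.trans (le_mul_of_one_le_right (by positivity) hG1)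
      _ = _ := by field_simp; norm_num
  calc (M : ℝ) * c ≤ (n * G) * (3 * R * (1 + B) ^ 2 * s ^ 3) ^ k := by gcongr
    _ ≤ (n * G) ^ k * (3 * R * (1 + B) ^ 2 * s ^ 3) ^ k := by
      gcongr
      exact le_self_pow₀ hnG (by omega)
    _ = ((n * G) * (3 * R * (1 + B) ^ 2 * s ^ 3)) ^ k := (mul_pow _ _ _).symm
    _ ≤ ((n * G) * (3 * R * (1 + B) ^ 2 * (8 * (n * G) / ε))) ^ k := by gcongr
    _ = _ := by rw [hG]; ring

end Candidates

end SIIERV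

end

theorem theorem3p1 :
    ∃ (C : ℝ) (c : ℕ) (P : MvPolynomial (Fin 3) ℝ) (C' : ℝ) (Q : MvPolynomial (Fin 2) ℝ),
      ∀ (k : ℕ) (T : ℤ → SIIERV.Param k) (A : Set (SIIERV.Param k)),
        ∃ θ : ℝ, 0 < θ ∧
          ∀ ρ L B Λ γ : ℝ, SIIERV.Assumptions T A ρ L B Λ γ →
            ∀ (n : ℕ) (ε : ℝ), 0 < ε → ε < 1 →
              ∃ S D : Finset (Measure ℤ),
                (∀ Y ∈ S, SIIERV.IsSIIRV T (SIIERV.rhoCone ρ A) n Y) ∧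
                (S.card : ℝ) ≤ (max 2 (ρ * Real.sqrt Λ / θ)) ^
                  ((k : ℝ) * (C * (1 / ε ^ 2) * (1 + Real.log (1 / ε)) ^ c) *
                    MvPolynomial.eval ![B, L, 1 / γ] P) ∧
                (∀ Y ∈ D, SIIERV.IsIIDSum T (SIIERV.rhoCone ρ A) Y) ∧
                (D.card : ℝ) ≤ ((n : ℝ) ^ 2 * MvPolynomial.eval ![B, 1 / γ] Q *
                  (C' * (max 2 (ρ * Real.sqrt Λ / θ) / ε))) ^ k ∧
                ∀ X : Measure ℤ, SIIERV.IsSIIRV T A n X →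
                  (∃ Y ∈ S, SIIERV.tvDist X Y ≤ ε) ∨ (∃ Y ∈ D, SIIERV.tvDist X Y ≤ ε) := by
  open SIIERV in
  obtain ⟨Z, hZ, hthr⟩ := exists_length_threshold
  refine ⟨6 * Z * (24 * Z + 114), 2,
    ((1 + MvPolynomial.X 0) * (1 + MvPolynomial.X 1) * (1 + MvPolynomial.X 2)) ^ 108, 24,
    (1 + MvPolynomial.X 0) ^ 4 * (1 + MvPolynomial.X 1) ^ 2, fun k T A => ?_⟩
  by_cases hex : ∃ ρ L B Λ γ : ℝ, Assumptions T A ρ L B Λ γ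
  swap
  · exact ⟨1, one_pos, fun ρ L B Λ γ h => absurd ⟨ρ, L, B, Λ, γ, h⟩ hex⟩
  obtain ⟨ρ₀, L₀, B₀, Λ₀, γ₀, h₀⟩ := hex
  obtain ⟨θ, hθ0, hnet⟩ := h₀.exists_net
  refine ⟨θ, hθ0, fun ρ L B Λ γ h n ε hε0 hε1 => ?_⟩
  have hk := h.dim_pos
  have hB := h.B_pos
  have hL := h.L_pos
  have hγ := h.gamma_pos
  have hγ' : 0 < 1 / γ := by positivity
  obtain ⟨R, hR⟩ : ∃ R, R = max 2 (ρ * √Λ / θ) := ⟨_, rfl⟩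
  have hR2 : 2 ≤ R := hR ▸ le_max_left _ _
  obtain ⟨Γ, hΓ⟩ : ∃ Γ, Γ = (1 + B) * (1 + L) * (1 + 1 / γ) := ⟨_, rfl⟩
  obtain ⟨ℓ, hℓ⟩ : ∃ ℓ, ℓ = 1 + Real.log (1 / ε) := ⟨_, rfl⟩
  have hℓ1 : 1 ≤ ℓ := hℓ ▸ one_le_one_add_log hε0 hε1
  have hP : MvPolynomial.eval ![B, L, 1 / γ]
      (((1 + MvPolynomial.X 0) * (1 + MvPolynomial.X 1) * (1 + MvPolynomial.X 2)) ^ 108 :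
        MvPolynomial (Fin 3) ℝ) = Γ ^ 108 := by
    simp [hΓ]
  have hQ : MvPolynomial.eval ![B, 1 / γ]
      ((1 + MvPolynomial.X 0) ^ 4 * (1 + MvPolynomial.X 1) ^ 2 : MvPolynomial (Fin 2) ℝ)
      = (1 + B) ^ 4 * (1 + 1 / γ) ^ 2 := by
    simp
  rw [hP, hQ, ← hℓ, ← hR]
  clear hP hQ
  have hBΓ : 1 + B ≤ Γ := by
    rw [hΓ, mul_assoc]
    exact le_mul_of_one_le_right (by linarith)
      (one_le_mul_of_one_le_of_one_le (by linarith) (by linarith))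
  have hΓ1 : 1 ≤ Γ := by linarith
  have hε2 : ε ^ 2 ≤ 1 := pow_le_one₀ hε0.le hε1.le
  obtain ⟨U, hU⟩ : ∃ U, U = Z * Γ ^ 107 * ℓ / ε ^ 2 := ⟨_, rfl⟩
  have hUε : 1 / ε ^ 2 ≤ U := by
    rw [hU]
    gcongr
    exact one_le_mul_of_one_le_of_one_le
      (one_le_mul_of_one_le_of_one_le hZ (one_le_pow₀ hΓ1)) hℓ1
  have hε2' : 1 ≤ 1 / ε ^ 2 := by rw [le_div_iff₀ (by positivity)]; linarith
  have hU1 : 1 ≤ U := hε2'.trans hUε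
  set n₀ := ⌈U⌉₊ with hn₀
  have hn₀U : (n₀ : ℝ) ≤ 2 * U := by
    have := Nat.ceil_lt_add_one (show 0 ≤ U by linarith)
    linarith
  have e2U : 2 * U = 2 * Z * Γ ^ 107 * ℓ / ε ^ 2 := by rw [hU]; ring
  -- the accuracy `1 / s ^ 4 = ε ^ 2 / (4 * U)` per summand suffices for up to `n₀ ≤ 2 * U` summands
  obtain ⟨s, hs⟩ : ∃ s, s = √√(2 * (2 * U) / ε ^ 2) := ⟨_, rfl⟩
  have hs4 : s ^ 4 = 2 * (2 * U) / ε ^ 2 := by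
    have e : s ^ 4 = (s ^ 2) ^ 2 := by ring
    rw [e, hs, Real.sq_sqrt (Real.sqrt_nonneg _),
      Real.sq_sqrt (div_nonneg (by linarith only [hU1]) (sq_nonneg ε))]
  have hs1 : 1 ≤ s := by
    rw [hs, Real.one_le_sqrt, Real.one_le_sqrt, le_div_iff₀ (by positivity)]
    linarith
  obtain ⟨N, hNmem, hNcard, hN⟩ := hnet ρ L B Λ γ h s hs1
  rw [← hR] at hNcard
  obtain ⟨w, hw⟩ : ∃ w, w = 3 * R * (1 + B) ^ 2 * s ^ 3 := ⟨_, rfl⟩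
  have hw1 : 1 ≤ w := by
    rw [hw]
    refine one_le_mul_of_one_le_of_one_le (one_le_mul_of_one_le_of_one_le (by linarith)
      (one_le_pow₀ (by linarith))) (one_le_pow₀ hs1)
  rw [← hw] at hNcard
  obtain ⟨S, hS1, hS2, hS3⟩ := exists_sparse_candidates (T := T) N hNmem (one_le_pow₀ hw1) hNcard n n₀
  have hScard := hS2.trans (sparse_count_le hk hR2 hZ hB.le hBΓ hℓ1 hℓ hε0 hs1
    (by rw [hs4, e2U]) (by rw [← e2U]; exact hn₀U) hw)
  have hshort : ∀ m : ℕ, 1 ≤ m → m ≤ n → m ≤ n₀ → ∀ a : Fin m → Param k, (∀ i, a i ∈ A) →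
      ∃ Y ∈ S, tvDist (sumLaw T a) Y ≤ ε := by
    intro m hm1 hmn hmn₀ a ha
    choose b hb hab using fun i => hN (a i) (ha i)
    refine ⟨_, hS3 m hm1 hmn hmn₀ b hb, ?_⟩
    refine le_of_pow_le_pow_left₀ two_ne_zero hε0.le ?_
    refine (tvDist_sumLaw_sq_le (fun i => h.admissible (Or.inl (ha i)))
      (fun i => h.admissible (hNmem _ (hb i))) hab).trans ?_
    have hm : (m : ℝ) ≤ 2 * U := le_trans (by exact_mod_cast hmn₀) hn₀U
    calc 2 * ((m : ℝ) * (1 / s ^ 4)) ≤ 2 * (2 * U * (1 / s ^ 4)) := by gcongr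
      _ = ε ^ 2 := by rw [hs4]; field_simp
  by_cases hnn₀ : n < n₀
  · refine ⟨S, ∅, hS1, hScard, by simp, ?_, ?_⟩
    · rw [Finset.card_empty, Nat.cast_zero]; positivity
    · rintro X ⟨m, hm1, hmn, a, ha, rfl⟩
      exact Or.inl (hshort m hm1 hmn (by omega) a ha)
  push Not at hnn₀
  have hnU : U ≤ n := (Nat.le_ceil U).trans (by exact_mod_cast hnn₀)
  have hn1' : (1 : ℝ) ≤ n := hU1.trans hnU
  have hn1 : 1 ≤ n := by exact_mod_cast hn1'
  obtain ⟨G, hG⟩ : ∃ G, G = (1 + B) * (1 + 1 / γ) := ⟨_, rfl⟩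
  have hG1 : 1 ≤ G := hG ▸ one_le_mul_of_one_le_of_one_le (by linarith) (by linarith)
  have hnG : 1 ≤ n * G := one_le_mul_of_one_le_of_one_le hn1' hG1
  -- the accuracy `1 / t ^ 4` per summand suffices for up to `n * G` summands, within `ε / 2`
  obtain ⟨t, ht⟩ : ∃ t, t = √√(8 * (n * G) / ε ^ 2) := ⟨_, rfl⟩
  have ht4 : t ^ 4 = 8 * (n * G) / ε ^ 2 := by
    have e : t ^ 4 = (t ^ 2) ^ 2 := by ring
    rw [e, ht, Real.sq_sqrt (Real.sqrt_nonneg _),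
      Real.sq_sqrt (div_nonneg (by linarith only [hnG]) (sq_nonneg ε))]
  have ht1 : 1 ≤ t := by
    rw [ht, Real.one_le_sqrt, Real.one_le_sqrt, le_div_iff₀ (by positivity)]
    linarith
  obtain ⟨N', hNmem', hNcard', hN'⟩ := hnet ρ L B Λ γ h t ht1
  rw [← hR] at hNcard'
  have hfloor := Nat.floor_le (show 0 ≤ n * G by linarith)
  obtain ⟨D, hD1, hD2, hD3⟩ := exists_dense_candidates (T := T) N' hNmem' ⌊n * G⌋₊
  have hDcard : (D.card : ℝ) ≤ (⌊n * G⌋₊ : ℝ) * N'.card := by exact_mod_cast hD2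
  refine ⟨S, D, hS1, hScard, hD1, hDcard.trans (dense_count_le hk hR2 hB.le hγ'.le hε0 ht1
    (by rw [ht4, hG]) (hUε.trans hnU) hn1 (by rw [← hG]; exact hfloor) hNcard'), ?_⟩
  rintro X ⟨m, hm1, hmn, a, ha, rfl⟩
  rcases le_total m n₀ with hmn₀ | hmn₀
  · exact Or.inl (hshort m hm1 hmn hmn₀ a ha)
  right
  have hmU : U ≤ m := (Nat.le_ceil U).trans (by exact_mod_cast hmn₀)
  obtain ⟨b, hb, m', hm'1, hm'2, htv⟩ := hthr k T A ρ L B Λ γ h ε hε0 hε1 m a ha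
    (by rw [← hΓ, ← hℓ, ← hU]; exact hmU)
  have hm'G : (m' : ℝ) ≤ n * G := by
    refine hm'2.trans ?_
    have h1 : (1 + B) / γ ≤ G := by
      rw [hG, div_eq_mul_one_div]; gcongr; linarith
    have h2 : (m : ℝ) ≤ n := by exact_mod_cast hmn
    gcongr
  obtain ⟨b', hb', hbb'⟩ := hN' b hb
  refine ⟨_, hD3 m' hm'1 (Nat.le_floor hm'G) b' hb', ?_⟩
  have had := h.admissible (Or.inl hb)
  have had' := h.admissible (hNmem' b' hb')
  have hclose : tvDist (sumLaw T fun _ : Fin m' => b) (sumLaw T fun _ : Fin m' => b') ≤ ε / 2 := by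
    refine le_of_pow_le_pow_left₀ two_ne_zero (half_pos hε0).le ?_
    refine (tvDist_sumLaw_sq_le (fun _ => had) (fun _ => had') fun _ => hbb').trans ?_
    calc 2 * ((m' : ℝ) * (1 / t ^ 4)) ≤ 2 * (n * G * (1 / t ^ 4)) := by gcongr
      _ = (ε / 2) ^ 2 := by rw [ht4]; field_simp; norm_num
  have := fun i => (h.admissible (Or.inl (ha i))).isProbabilityMeasure
  have := had.isProbabilityMeasure
  have := had'.isProbabilityMeasure
  have htri := tvDist_triangle (indepSum fun i => expFam T (a i))
    (indepSum fun _ : Fin m' => expFam T b) (indepSum fun _ : Fin m' => expFam T b')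
  rw [← sumLaw_eq_indepSum, ← sumLaw_eq_indepSum T (fun _ : Fin m' => b),
    ← sumLaw_eq_indepSum T (fun _ : Fin m' => b')] at htri
  linarith
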